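/- Let $K=\mathbb{Q}(t,q)$ and $\mathscr P_k^+=K[x_1,\dots,x_k]$. On polynomials put $T_if=s_if+(1-t)x_i\frac{f-s_if}{x_i-x_{i+1}}$, so that $(T_i-1)(T_i+t)=0$, and on $\mathscr P_k^+$ ($k\ge 1$) put $$\omega_k^{-1}f=f(x_2,\dots,x_k,qx_1),\qquad \widetilde\omega_k^{-1}=T_1\cdots T_{k-1}x_k,\qquad \varpi_k=\mathrm{pr}_1\,\omega_k^{-1},$$ $$\widetilde Y^{(k)}_1=t^k\varpi_kT_{k-1}^{-1}\cdots T_1^{-1},\qquad \widetilde Y^{(k)}_{i+1}=t^{-1}T_i\widetilde Y^{(k)}_iT_i\quad(1\le i\le k-1),$$ where $\mathrm{pr}_1$ is the identity on monomials divisible by $x_1$ and $0$ on the other monomials. Let $\mathscr P_\infty^+$ be the inverse limit of the graded rings $\mathscr P_k^+$ along $\pi_k:x_k\mapsto 0$ (sequences of bounded degree), with projections $\Pi_k:\mathscr P_\infty^+\to\mathscr P_k^+$. The $T_i$ induce operators $\mathscr T_i$ on $\mathscr P_\infty^+$ (with $\Pi_k\mathscr T_i=T_i\Pi_k$ for $k>i$),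 and $\mathscr X_i$ is multiplication by $x_i$. Let $\mathscr P(k)^+=\{F\in\mathscr P_\infty^+ : \mathscr T_iF=F \text{ for all } i>k\}$, $\mathscr P_{\rm as}^+=\bigcup_k\mathscr P(k)^+$ and $\mathrm{Sym}=\mathscr P(0)^+$. For $F\in\mathrm{Sym}$ let $F[\mathbf X_k]$ be $F$ evaluated at the alphabet $x_{k+1},x_{k+2},\dots$; multiplication gives $\mathscr P(k)^+\cong \mathscr P_k^+\otimes \mathrm{Sym}[\mathbf X_k]$. A sequence $a_k\in K$ converges to $a$ if the order of vanishing at $t=0$ of $a_k-a$ tends to $+\infty$. A sequence $f_k\in\mathscr P_k^+$ (defined for all large $k$) converges to $h+\sum_{i=1}^Na_ig_i\in\mathscr P_\infty^+$ if, for all large $k$, $f_k=\Pi_kh+\sum_{i=1}^N a_{i,k}\Pi_kg_i$ with $h\in\mathscr P_\infty^+$, $g_i\in\mathscr P_{\rm as}^+$ and $a_{i,k}\to a_i$ in $K$. Let $\mathscr Y_iF=\lim_k\widetilde Y_i^{(k)}\Pi_kF$ for $F\in\mathscr P_{\rm as}^+$. Let $\mathscr B_0$ be the operator on $\mathrm{Sym}$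 with $\mathscr B_0P_\mu(X;t^{-1})=t^{\ell(\mu)}P_\mu(X;t^{-1})$ for all Hall–Littlewood functions $P_\mu$, and $\mathscr B_{n+1}=[\mathscr B_\infty,\mathscr B_n]$, where $\mathscr B_\infty$ is multiplication by $e_1$. Extend $\omega_k^{-1}$ and $\widetilde\omega_k^{-1}$ to $\mathscr P(k)^+$ linearly over $\mathrm{Sym}[\mathbf X_k]$, let $\iota(k):\mathscr P(k)^+\to\mathscr P(k+1)^+$ be the inclusion, and define $$\partial_k=-\widetilde\omega^{-1}_{k+1}\iota(k),\qquad \partial^*_k=\omega_{k+1}^{-1}\iota(k):\ \mathscr P(k)^+\to\mathscr P(k+1)^+,$$ and $\partial^-_k:\mathscr P(k)^+\to\mathscr P(k-1)^+$ ($k\ge1$) as the $\mathscr P_{k-1}^+$-linear map with $\partial_k^-(x_k^nF[\mathbf X_k])=(\mathscr B_nF)[\mathbf X_{k-1}]$ for $n\ge 0$, $F\in\mathrm{Sym}$. The double Dyck path algebra $\mathbb A_{t,q}$ is the path algebra over $K$ of the quiver with vertices $k\in\mathbb Z_{\ge0}$, arrows $d_+,d_+^*:k\to k+1$, $d_-:k+1\to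 k$ and loops $T_1,\dots,T_{k-1}$ at $k$, modulo the following relations (between paths starting at $k$, read as compositions of operators): - $T_iT_j=T_jT_i$ ($|i-j|>1$), $T_iT_{i+1}T_i=T_{i+1}T_iT_{i+1}$, $(T_i-1)(T_i+t)=0$; - $d_-^2T_{k-1}=d_-^2$ ($k\ge 2$), $T_id_-=d_-T_i$ ($1\le i\le k-2$); - $T_1d_+^2=d_+^2$, $d_+T_i=T_{i+1}d_+$, $T_1(d_+^*)^2=(d_+^*)^2$, $d_+^*T_i=T_{i+1}d_+^*$ ($1\le i\le k-1$); - $d_-[d_+,d_-]T_{k-1}=t[d_+,d_-]d_-$ ($k\ge2$), $T_1[d_+,d_-]d_+=t\,d_+[d_+,d_-]$ ($k\ge1$); - $t\,d_-[d_+^*,d_-]=[d_+^*,d_-]d_-T_{k-1}$ ($k\ge2$), $t[d_+^*,d_-]d_+^*=T_1d_+^*[d_+^*,d_-]$ ($k\ge1$); - $d_+z_i=z_{i+1}d_+$, $d_+^*y_i=y_{i+1}d_+^*$ ($1\le i\le k-1$), $z_1d_+=-qt^{k+1}y_1d_+^*$, where $y_i,z_i$ ($1\le i\le k$) are the loops at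 $k$ given by $y_1=\frac{1}{t^{k-1}(t-1)}[d_+,d_-]T_{k-1}\cdots T_1$, $y_{i+1}=tT_i^{-1}y_iT_i^{-1}$, $z_1=\frac{t^k}{1-t}[d_+^*,d_-]T_{k-1}^{-1}\cdots T_1^{-1}$, $z_{i+1}=t^{-1}T_iz_iT_i$. **Theorem.** The limits defining the operators $\mathscr Y_i$ exist on $\mathscr P_{\rm as}^+$ and lie in $\mathscr P_{\rm as}^+$. The assignment $T_i\mapsto\mathscr T_i$, $d_+\mapsto\partial$, $d_+^*\mapsto\partial^*$, $d_-\mapsto\partial^-$ defines an $\mathbb A_{t,q}$-module structure (quiver representation) on $\mathscr P_\bullet=(\mathscr P(k)^+)_{k\ge0}$. Under this action the loops $y_i$, $z_i$ ($1\le i\le k$) at the vertex $k$ act on $\mathscr P(k)^+$ as the restrictions of the global operators $\mathscr X_i$, $\mathscr Y_i$. -/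

import Mathlib

/-!
Indexing convention: everything is indexed from `0`.  The variable `x_{i+1}` is `MvPolynomial.X i`,
and the operators / loops with subscript `i+1` (`T_{i+1}`, `X_{i+1}`, `Y_{i+1}`, `y_{i+1}`,
`z_{i+1}`) carry the index `i`.
-/

noncomputable section

namespace StableDAHA

open MvPolynomial Filter

/-! ### The field `ℚ(t,q)` and convergence in it -/

/-- The field `ℚ(t,q)` of rational functions in two parameters. -/
def QTQ : Type := FractionRing (MvPolynomial (Fin 2) ℚ)

instance : Field QTQ := inferInstanceAs (Field (FractionRing (MvPolynomial (Fin 2) ℚ)))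

instance : Algebra (MvPolynomial (Fin 2) ℚ) QTQ :=
  inferInstanceAs (Algebra (MvPolynomial (Fin 2) ℚ) (FractionRing (MvPolynomial (Fin 2) ℚ)))

instance : IsFractionRing (MvPolynomial (Fin 2) ℚ) QTQ :=
  inferInstanceAs (IsFractionRing (MvPolynomial (Fin 2) ℚ)
    (FractionRing (MvPolynomial (Fin 2) ℚ)))

/-- The parameter `t`. -/
def tc : QTQ := algebraMap (MvPolynomial (Fin 2) ℚ) QTQ (X 0)

/-- The parameter `q`. -/
def qc : QTQ := algebraMap (MvPolynomial (Fin 2) ℚ) QTQ (X 1)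

/-- `c` vanishes at `t = 0` to order at least `M`: `c = t ^ M * A / B` with polynomials `A`, `B`
such that `t` does not divide `B`. -/
def OrdGE (M : ℕ) (c : QTQ) : Prop :=
  ∃ A B : MvPolynomial (Fin 2) ℚ, ¬ (X 0 ∣ B) ∧
    c * algebraMap _ QTQ B = algebraMap _ QTQ (X 0 ^ M * A)

/-- `a n → b` for the order of vanishing at `t = 0`. -/
def CoeffTendsto (a : ℕ → QTQ) (b : QTQ) : Prop :=
  ∀ M : ℕ, ∀ᶠ n in atTop, OrdGE M (a n - b)

/-! ### Polynomials -/

/-- The polynomial ring `ℚ(t,q)[x_1, x_2, …]`; it contains all the rings `𝒫_k^+`. -/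
abbrev Poly : Type := MvPolynomial ℕ QTQ

/-- `𝒫_k^+ = ℚ(t,q)[x_1, …, x_k]`. -/
def PolyLT (k : ℕ) : Subalgebra QTQ Poly := MvPolynomial.supported QTQ {i | i < k}

/-- The specialization `x_{m+1} = x_{m+2} = ⋯ = 0`.  On `𝒫_{m+1}^+` it is the structure map
`π_{m+1} : 𝒫_{m+1}^+ → 𝒫_m^+`. -/
def trunc (m : ℕ) : Poly →ₐ[QTQ] Poly := aeval fun j => if j < m then X j else 0

/-- The simple transposition exchanging the variables of index `i` and `i + 1`. -/
def swapVar (i : ℕ) : Poly →ₐ[QTQ] Poly := rename (Equiv.swap i (i + 1))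

theorem X_sub_X_ne_zero (i : ℕ) : (X i - X (i + 1) : Poly) ≠ 0 := by
  rw [sub_ne_zero]
  intro h
  have := MvPolynomial.X_injective h
  omega

theorem dvd_sub_swapVar (i : ℕ) (f : Poly) : (X i - X (i + 1) : Poly) ∣ f - swapVar i f := by
  rw [← Ideal.mem_span_singleton, ← Ideal.Quotient.eq]
  have h : (Ideal.Quotient.mkₐ QTQ (Ideal.span {(X i - X (i + 1) : Poly)})) =
      (Ideal.Quotient.mkₐ QTQ (Ideal.span {(X i - X (i + 1) : Poly)})).comp (swapVar i) := by
    have key : Ideal.Quotient.mk (Ideal.span {(X i - X (i + 1) : Poly)}) (X i) =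
        Ideal.Quotient.mk (Ideal.span {(X i - X (i + 1) : Poly)}) (X (i + 1)) := by
      rw [Ideal.Quotient.eq]
      exact Ideal.mem_span_singleton_self _
    apply MvPolynomial.algHom_ext
    intro j
    simp only [AlgHom.comp_apply, swapVar, rename_X, Ideal.Quotient.mkₐ_eq_mk]
    rcases eq_or_ne j i with rfl | h1
    · rw [Equiv.swap_apply_left, key]
    · rcases eq_or_ne j (i + 1) with rfl | h2
      · rw [Equiv.swap_apply_right, key]
      · rw [Equiv.swap_apply_of_ne_of_ne h1 h2]
  exact congrArg (fun φ => φ f) h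

/-- The divided difference `(f - s_i f) / (x_i - x_{i+1})`. -/
def divDiff (i : ℕ) : Poly →ₗ[QTQ] Poly where
  toFun f := Classical.choose (dvd_sub_swapVar i f)
  map_add' f g := by
    apply mul_left_cancel₀ (X_sub_X_ne_zero i)
    rw [mul_add, ← Classical.choose_spec (dvd_sub_swapVar i (f + g)),
      ← Classical.choose_spec (dvd_sub_swapVar i f), ← Classical.choose_spec (dvd_sub_swapVar i g),
      map_add]
    ring
  map_smul' c f := by
    apply mul_left_cancel₀ (X_sub_X_ne_zero i)
    rw [RingHom.id_apply, mul_smul_comm, ← Classical.choose_spec (dvd_sub_swapVar i (c • f)),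
      ← Classical.choose_spec (dvd_sub_swapVar i f), map_smul, smul_sub]

theorem X_sub_X_mul_divDiff (i : ℕ) (f : Poly) :
    (X i - X (i + 1)) * divDiff i f = f - swapVar i f :=
  (Classical.choose_spec (dvd_sub_swapVar i f)).symm

/-- Multiplication by a variable. -/
def mulX (i : ℕ) : Poly →ₗ[QTQ] Poly := LinearMap.mulLeft QTQ (X i)

/-- `T_i f = s_i f + (1 - t) x_i (f - s_i f) / (x_i - x_{i+1})`. -/
def polyT (i : ℕ) : Poly →ₗ[QTQ] Poly :=
  (swapVar i).toLinearMap + (1 - tc) • (mulX i ∘ₗ divDiff i)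

/-- `T_i⁻¹ = t⁻¹ (T_i + t - 1)`, by the quadratic relation `(T_i - 1)(T_i + t) = 0`. -/
def polyTInv (i : ℕ) : Poly →ₗ[QTQ] Poly :=
  tc⁻¹ • (polyT i + (tc - 1) • LinearMap.id)

/-- `polyTAsc n = T_1 T_2 ⋯ T_n`. -/
def polyTAsc : ℕ → (Poly →ₗ[QTQ] Poly)
  | 0 => LinearMap.id
  | n + 1 => polyTAsc n ∘ₗ polyT n

/-- `polyTInvDesc n = T_n⁻¹ ⋯ T_2⁻¹ T_1⁻¹`. -/
def polyTInvDesc : ℕ → (Poly →ₗ[QTQ] Poly)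
  | 0 => LinearMap.id
  | n + 1 => polyTInv n ∘ₗ polyTInvDesc n

/-- The action of `ω_k⁻¹`, `k ≥ 1`, on `𝒫_k^+`: `f ↦ f(x_2, …, x_k, q x_1)`. -/
def omegaInv (k : ℕ) : Poly →ₗ[QTQ] Poly :=
  (aeval fun j => if j + 1 < k then X (j + 1) else if j + 1 = k then qc • X 0 else X j :
    Poly →ₐ[QTQ] Poly).toLinearMap

/-- The action of `ω̃_k⁻¹ = T_1 ⋯ T_{k-1} X_k`, `k ≥ 1`, on `𝒫_k^+`. -/
def omegaTildeInv (k : ℕ) : Poly →ₗ[QTQ] Poly := polyTAsc (k - 1) ∘ₗ mulX (k - 1)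

/-- The projection onto `x_1 𝒫_k^+` which kills the monomials not divisible by `x_1`. -/
def prFirst : Poly →ₗ[QTQ] Poly :=
  LinearMap.id - (aeval fun j => if j = 0 then 0 else X j : Poly →ₐ[QTQ] Poly).toLinearMap

/-- `ϖ_k f = pr_1 f(x_2, …, x_k, q x_1)`, `k ≥ 1`. -/
def varpi (k : ℕ) : Poly →ₗ[QTQ] Poly := prFirst ∘ₗ omegaInv k

/-- The deformed Cherednik operators on `𝒫_k^+`: `Ỹ_1 = t^k ϖ_k T_{k-1}⁻¹ ⋯ T_1⁻¹` and
`Ỹ_{i+1} = t⁻¹ T_i Ỹ_i T_i`.  Only the indices `i < k` are meaningful. -/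
def polyY (k : ℕ) : ℕ → (Poly →ₗ[QTQ] Poly)
  | 0 => tc ^ k • (varpi k ∘ₗ polyTInvDesc (k - 1))
  | i + 1 => tc⁻¹ • (polyT i ∘ₗ polyY k i ∘ₗ polyT i)

/-! ### The inverse limit `𝒫_∞^+` -/

theorem totalDegree_trunc_le (m : ℕ) (f : Poly) : (trunc m f).totalDegree ≤ f.totalDegree := by
  rw [trunc, aeval_def, eval₂_eq]
  refine (totalDegree_finsetSum _ _).trans (Finset.sup_le fun d hd => ?_)
  refine le_trans ?_ (le_totalDegree hd)
  refine (totalDegree_mul _ _).trans ?_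
  rw [algebraMap_eq, totalDegree_C, zero_add, Finsupp.sum]
  refine (totalDegree_finsetProd _ _).trans (Finset.sum_le_sum fun j _ => ?_)
  refine (totalDegree_pow _ _).trans ?_
  split_ifs <;> simp

theorem trunc_trunc (m n : ℕ) (f : Poly) : trunc m (trunc n f) = trunc (min m n) f := by
  have h : (trunc m).comp (trunc n) = trunc (min m n) := by
    apply MvPolynomial.algHom_ext
    intro j
    simp only [trunc, AlgHom.comp_apply, aeval_X]
    by_cases hn : j < n
    · by_cases hm : j < m <;> simp [hn, hm]
    · simp [hn]
  exact congrArg (fun φ => φ f) h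

/-- `𝒫_∞^+`: the inverse limit of the graded rings `𝒫_m^+`, that is, the sequences of polynomials
`(f_m)` with `f_m ∈ 𝒫_m^+` and `π_{m+1} f_{m+1} = f_m`, of bounded degree. -/
def pInfSubalgebra : Subalgebra QTQ (ℕ → Poly) where
  carrier := {f | (∀ m, trunc m (f (m + 1)) = f m) ∧ ∃ d : ℕ, ∀ m, (f m).totalDegree ≤ d}
  mul_mem' := by
    rintro f g ⟨hf, d, hd⟩ ⟨hg, e, he⟩
    exact ⟨fun m => by simp [hf, hg], d + e, fun m =>
      (totalDegree_mul _ _).trans (add_le_add (hd m) (he m))⟩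
  add_mem' := by
    rintro f g ⟨hf, d, hd⟩ ⟨hg, e, he⟩
    exact ⟨fun m => by simp [hf, hg], max d e, fun m =>
      (totalDegree_add _ _).trans (max_le_max (hd m) (he m))⟩
  algebraMap_mem' c := ⟨fun m => by simp, 0, fun m => by simp [MvPolynomial.algebraMap_eq]⟩

/-- The ring `𝒫_∞^+` as a type. -/
def PInf : Type := pInfSubalgebra

instance : CommRing PInf := inferInstanceAs (CommRing pInfSubalgebra)

instance : Algebra QTQ PInf := inferInstanceAs (Algebra QTQ pInfSubalgebra)

/-- The canonical map `Π_m : 𝒫_∞^+ → 𝒫_m^+`. -/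
def proj (F : PInf) (m : ℕ) : Poly := F.1 m

theorem trunc_proj (F : PInf) {m n : ℕ} (h : m ≤ n) : trunc m (proj F n) = proj F m := by
  induction n, h using Nat.le_induction with
  | base =>
    have h := F.2.1 m
    change trunc m (F.1 m) = F.1 m
    rw [← h, trunc_trunc, min_self]
  | succ n hmn ih =>
    have h := F.2.1 n
    change trunc m (F.1 (n + 1)) = F.1 m
    change trunc m (F.1 n) = F.1 m at ih
    rw [← ih, ← h, trunc_trunc, min_eq_left hmn]

/-- The canonical map from polynomials to `𝒫_∞^+` (on `𝒫_k^+` it is the map `J_k`). -/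
def ofPoly (p : Poly) : PInf :=
  ⟨fun m => trunc m p, fun m => by rw [trunc_trunc, min_eq_left (Nat.le_succ m)],
    p.totalDegree, fun m => totalDegree_trunc_le m p⟩

theorem trunc_swapVar {i m : ℕ} (h : i + 1 < m) (f : Poly) :
    trunc m (swapVar i f) = swapVar i (trunc m f) := by
  have : (trunc m).comp (swapVar i) = (swapVar i).comp (trunc m) := by
    apply MvPolynomial.algHom_ext
    intro j
    simp only [trunc, swapVar, AlgHom.comp_apply, aeval_X, rename_X]
    rcases eq_or_ne j i with rfl | h1
    · rw [Equiv.swap_apply_left, if_pos h, if_pos (by omega), rename_X, Equiv.swap_apply_left]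
    · rcases eq_or_ne j (i + 1) with rfl | h2
      · rw [Equiv.swap_apply_right, if_pos h, if_pos (by omega), rename_X, Equiv.swap_apply_right]
      · rw [Equiv.swap_apply_of_ne_of_ne h1 h2]
        split_ifs
        · rw [rename_X, Equiv.swap_apply_of_ne_of_ne h1 h2]
        · rw [map_zero]
  exact congrArg (fun φ => φ f) this

theorem trunc_polyT {i m : ℕ} (h : i + 1 < m) (f : Poly) :
    trunc m (polyT i f) = polyT i (trunc m f) := by
  have hX : ∀ j, j < m → trunc m (X j) = X j := fun j hj => by simp [trunc, hj]
  have hd : trunc m (divDiff i f) = divDiff i (trunc m f) := by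
    apply mul_left_cancel₀ (X_sub_X_ne_zero i)
    rw [X_sub_X_mul_divDiff, ← trunc_swapVar h, ← map_sub, ← X_sub_X_mul_divDiff, map_mul, map_sub,
      hX i (by omega), hX (i + 1) h]
  simp only [polyT, mulX, LinearMap.add_apply, LinearMap.smul_apply, LinearMap.comp_apply,
    AlgHom.toLinearMap_apply, LinearMap.mulLeft_apply, map_add, map_smul, map_mul, hd,
    trunc_swapVar h, hX i (by omega)]

theorem totalDegree_swapVar_le (i : ℕ) (f : Poly) : (swapVar i f).totalDegree ≤ f.totalDegree :=
  totalDegree_rename_le _ _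

theorem totalDegree_polyT_le (i : ℕ) (f : Poly) : (polyT i f).totalDegree ≤ f.totalDegree := by
  have hs := totalDegree_swapVar_le i f
  have h2 : (X i * divDiff i f).totalDegree ≤ f.totalDegree := by
    by_cases h0 : divDiff i f = 0
    · simp [h0]
    have h1 := totalDegree_mul_of_isDomain (X_sub_X_ne_zero i) h0
    rw [X_sub_X_mul_divDiff] at h1
    have h3 : (f - swapVar i f).totalDegree ≤ f.totalDegree :=
      (totalDegree_sub _ _).trans (max_le le_rfl hs)
    have h4 : 1 ≤ (X i - X (i + 1) : Poly).totalDegree := by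
      have hmem : Finsupp.single i 1 ∈ (X i - X (i + 1) : Poly).support := by
        have hne : Finsupp.single (i + 1) 1 ≠ Finsupp.single i 1 := fun h => by
          have := Finsupp.single_left_injective one_ne_zero h
          omega
        rw [mem_support_iff, coeff_sub, coeff_X, coeff_X, if_pos rfl, if_neg hne]
        simp
      simpa using le_totalDegree hmem
    refine (totalDegree_mul _ _).trans ?_
    rw [totalDegree_X]
    omega
  have h5 : polyT i f = swapVar i f + (1 - tc) • (X i * divDiff i f) := rfl
  rw [h5]
  exact (totalDegree_add _ _).trans (max_le hs ((totalDegree_smul_le _ _).trans h2))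

/-- The limit operator `𝒯_i` on `𝒫_∞^+`; see `proj_calT`. -/
def calT (i : ℕ) : PInf →ₗ[QTQ] PInf where
  toFun F := ⟨fun m => trunc m (polyT i (proj F (m + i + 2))), fun m => by
      beta_reduce
      rw [trunc_trunc, min_eq_left (Nat.le_succ m), ← trunc_proj F (show m + i + 2 ≤ m + 1 + i + 2
        by omega), ← trunc_polyT (by omega), trunc_trunc, min_eq_left (by omega)], by
      obtain ⟨d, hd⟩ := F.2.2
      exact ⟨d, fun m => (totalDegree_trunc_le _ _).trans
        ((totalDegree_polyT_le _ _).trans (hd _))⟩⟩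
  map_add' F G := by
    apply Subtype.ext
    funext m
    change trunc m (polyT i (proj F (m + i + 2) + proj G (m + i + 2))) = _
    rw [map_add, map_add]
    rfl
  map_smul' c F := by
    apply Subtype.ext
    funext m
    change trunc m (polyT i (c • proj F (m + i + 2))) = _
    rw [map_smul, map_smul]
    rfl

/-- `Π_m 𝒯_i = T_i Π_m` as soon as `𝒫_m^+` contains the two variables on which `T_i` acts. -/
theorem proj_calT {i m : ℕ} (h : i + 1 < m) (F : PInf) :
    proj (calT i F) m = polyT i (proj F m) := by
  change trunc m (polyT i (proj F (m + i + 2))) = _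
  rw [trunc_polyT h, trunc_proj F (by omega)]

/-- The limit operator `𝒳_i` on `𝒫_∞^+`: multiplication by the variable. -/
def calX (i : ℕ) : PInf →ₗ[QTQ] PInf := LinearMap.mulLeft QTQ (ofPoly (X i))

theorem polyT_eq_self_iff (i : ℕ) (f : Poly) : polyT i f = f ↔ swapVar i f = f := by
  have h5 : polyT i f = swapVar i f + (1 - tc) • (X i * divDiff i f) := rfl
  have h6 := X_sub_X_mul_divDiff i f
  constructor
  · intro h
    have h7 : (X (i + 1) - C tc * X i) * divDiff i f = 0 := by
      rw [h5, smul_eq_C_mul, C_sub, C_1] at h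
      linear_combination h - h6
    have h8 : (X (i + 1) - C tc * X i : Poly) ≠ 0 := by
      intro h0
      have := congrArg (coeff (Finsupp.single (i + 1) 1)) h0
      have hne : Finsupp.single i 1 ≠ Finsupp.single (i + 1) 1 := fun h => by
        have := Finsupp.single_left_injective one_ne_zero h
        omega
      rw [coeff_sub, coeff_X, coeff_C_mul, coeff_X, if_pos rfl, if_neg hne] at this
      simp at this
    rw [(mul_eq_zero.mp h7).resolve_left h8, mul_zero] at h6
    exact (sub_eq_zero.mp h6.symm).symm
  · intro h
    rw [h, sub_self] at h6
    rw [h5, h, (mul_eq_zero.mp h6).resolve_left (X_sub_X_ne_zero i), mul_zero, smul_zero, add_zero]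

theorem calT_eq_self_iff (i : ℕ) (F : PInf) :
    calT i F = F ↔ ∀ m, i + 1 < m → swapVar i (proj F m) = proj F m := by
  constructor
  · intro h m hm
    rw [← polyT_eq_self_iff, ← proj_calT hm, h]
  · intro h
    apply Subtype.ext
    funext m
    change trunc m (polyT i (proj F (m + i + 2))) = proj F m
    rw [(polyT_eq_self_iff _ _).mpr (h _ (by omega)), trunc_proj F (by omega)]

/-- `𝒫(k)^+ = {F ∈ 𝒫_∞^+ : 𝒯_i F = F for all i > k}` (in `1`-based indexing). -/
def PSym (k : ℕ) : Subalgebra QTQ PInf where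
  carrier := {F | ∀ i, k ≤ i → calT i F = F}
  mul_mem' {F G} hF hG i hi := by
    rw [calT_eq_self_iff]
    intro m hm
    change swapVar i (proj F m * proj G m) = proj F m * proj G m
    rw [map_mul, (calT_eq_self_iff i F).mp (hF i hi) m hm,
      (calT_eq_self_iff i G).mp (hG i hi) m hm]
  add_mem' {F G} hF hG i hi := by
    rw [map_add, hF i hi, hG i hi]
  algebraMap_mem' c i hi := by
    rw [calT_eq_self_iff]
    intro m hm
    exact (swapVar i).commutes c

theorem PSym_le_succ (k : ℕ) : PSym k ≤ PSym (k + 1) :=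
  fun _ hF i hi => hF i ((Nat.le_succ k).trans hi)

/-- The canonical inclusion `𝒫(k)^+ → 𝒫(k+1)^+`. -/
def incl (k : ℕ) : PSym k →ₗ[QTQ] PSym (k + 1) :=
  (Subalgebra.inclusion (PSym_le_succ k)).toLinearMap

/-- The almost symmetric module `𝒫_as^+ = ⋃_k 𝒫(k)^+`. -/
def PAs : Set PInf := {F | ∃ k, F ∈ PSym k}

/-- The ring `Sym[X] = 𝒫(0)^+` of symmetric functions. -/
abbrev SymFn : Type := PSym 0

/-- The alphabet shift `F[X] ↦ F[x_{k+1} + x_{k+2} + ⋯]`. -/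
def shift (k : ℕ) (F : PInf) : PInf :=
  ⟨fun m => rename (fun j => j + k) (proj F (m - k)), by
    intro m
    have key : ∀ n : ℕ, ∀ f : Poly, trunc n (rename (fun j => j + k) f) =
        rename (fun j => j + k) (trunc (n - k) f) := by
      intro n f
      have : (trunc n).comp (rename (fun j => j + k)) =
          (rename (fun j => j + k)).comp (trunc (n - k)) := by
        apply MvPolynomial.algHom_ext
        intro j
        simp only [trunc, AlgHom.comp_apply, aeval_X, rename_X]
        by_cases h : j + k < n
        · rw [if_pos h, if_pos (by omega), rename_X]
        · rw [if_neg h, if_neg (by omega), map_zero]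
      exact congrArg (fun φ => φ f) this
    rw [key, trunc_proj F (by omega)], by
    obtain ⟨d, hd⟩ := F.2.2
    exact ⟨d, fun m => (totalDegree_rename_le _ _).trans (hd _)⟩⟩

/-! ### The stable limit and the limit Cherednik operators -/

/-- The sequence of polynomials `f m ∈ 𝒫_m^+` converges to `F ∈ 𝒫_∞^+`:
`f m = h_m + ∑ a_{i,m} g_{i,m}` where `h = (h_m)` is in `𝒫_∞^+`, the finitely many `g_i = (g_{i,m})`
are in `𝒫_as^+`, the coefficients `a_{i,m}` converge to `b_i`, and `F = h + ∑ b_i g_i`.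
Finitely many terms of the sequence are irrelevant. -/
def HasStableLimit (f : ℕ → Poly) (F : PInf) : Prop :=
  ∃ (N : ℕ) (h : PInf) (g : Fin N → PInf) (a : Fin N → ℕ → QTQ) (b : Fin N → QTQ),
    (∀ i, g i ∈ PAs) ∧ (∀ i, CoeffTendsto (a i) (b i)) ∧
    (∀ᶠ m in atTop, f m = proj h m + ∑ i, a i m • proj (g i) m) ∧
    F = h + ∑ i, b i • g i

open Classical in
/-- The limit Cherednik operator `𝒴_i F = lim_m Ỹ_i^{(m)} Π_m F` (meaningful when the limit exists,
in particular on `𝒫_as^+`). -/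
def calY (i : ℕ) (F : PInf) : PInf :=
  if h : ∃ G, HasStableLimit (fun m => polyY m i (proj F m)) G then Classical.choose h else 0

/-! ### Hall–Littlewood functions and the operators `ℬ_n` -/

/-- `v_m(s) = ∏_{i=1}^m (1 - s^i) / (1 - s)`. -/
def vFact (s : QTQ) (m : ℕ) : QTQ := ∏ i ∈ Finset.range m, ∑ j ∈ Finset.range (i + 1), s ^ j

/-- `F` is the Hall–Littlewood symmetric function `P_μ(X; s)` of the partition
`μ 0 ≥ μ 1 ≥ ⋯` of length `ℓ`: for all `n ≥ ℓ`, in `n` variables,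
`P_μ = v_μ(s)⁻¹ ∑_{w ∈ S_n} w (x^μ ∏_{i<j} (x_i - s x_j) / (x_i - x_j))`, where `v_μ(s)` is the
product of the `v_m(s)` over the multiplicities `m` of the entries of `(μ 0, …, μ (n-1))`.
The formula is stated after multiplication by `v_μ(s) ∏_{i<j} (x_i - x_j)`. -/
def IsHallLittlewood (s : QTQ) (μ : ℕ → ℕ) (ℓ : ℕ) (F : SymFn) : Prop :=
  ∀ n, ℓ ≤ n →
    (∏ a ∈ (Finset.range n).image μ, vFact s ((Finset.range n).filter (fun i => μ i = a)).card) •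
        (proj F.1 n * ∏ i : Fin n, ∏ j ∈ Finset.Ioi i, (X (i : ℕ) - X (j : ℕ))) =
      ∑ w : Equiv.Perm (Fin n), ((Equiv.Perm.sign w : ℤ) : Poly) *
        ((∏ i : Fin n, X (w i : ℕ) ^ μ i) *
          ∏ i : Fin n, ∏ j ∈ Finset.Ioi i, (X (w i : ℕ) - C s * X (w j : ℕ)))

/-- `B₀` is the operator `ℬ_0`: the (unique) operator with `ℬ_0 P_μ(X; t⁻¹) = t^{ℓ(μ)} P_μ(X; t⁻¹)` for all
partitions `μ`. -/
def IsHLZero (B₀ : Module.End QTQ SymFn) : Prop :=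
  ∀ (μ : ℕ → ℕ) (ℓ : ℕ), Antitone μ → (∀ i, μ i = 0 ↔ ℓ ≤ i) →
    ∀ F : SymFn, IsHallLittlewood tc⁻¹ μ ℓ F → B₀ F = tc ^ ℓ • F

/-- The element `x_1 + x_2 + ⋯` of `𝒫_∞^+`. -/
def e1Inf : PInf :=
  ⟨fun m => ∑ i ∈ Finset.range m, X i, fun m => by
    beta_reduce
    rw [map_sum, Finset.sum_range_succ]
    have h1 : ∀ i ∈ Finset.range m, trunc m (X i : Poly) = X i := fun i hi => by
      rw [trunc, aeval_X, if_pos (Finset.mem_range.mp hi)]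
    have h2 : trunc m (X m : Poly) = 0 := by
      rw [trunc, aeval_X, if_neg (lt_irrefl m)]
    rw [Finset.sum_congr rfl h1, h2, add_zero], 1, fun m =>
      (totalDegree_finsetSum _ _).trans (Finset.sup_le fun i _ => by rw [totalDegree_X])⟩

theorem e1Inf_mem : e1Inf ∈ PSym 0 := by
  intro i _
  rw [calT_eq_self_iff]
  intro m hm
  change swapVar i (∑ j ∈ Finset.range m, X j) = ∑ j ∈ Finset.range m, X j
  rw [map_sum]
  simp only [swapVar, rename_X]
  refine Finset.sum_equiv (Equiv.swap i (i + 1)) (fun j => ?_) (fun _ _ => rfl)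
  simp only [Finset.mem_range]
  rcases eq_or_ne j i with rfl | h1
  · rw [Equiv.swap_apply_left]; omega
  · rcases eq_or_ne j (i + 1) with rfl | h2
    · rw [Equiv.swap_apply_right]; omega
    · rw [Equiv.swap_apply_of_ne_of_ne h1 h2]

/-- The symmetric function `e_1 = x_1 + x_2 + ⋯`. -/
def e1 : SymFn := ⟨e1Inf, e1Inf_mem⟩

/-- `ℬ_∞`, multiplication by `e_1`. -/
def hlInf : Module.End QTQ SymFn := LinearMap.mulLeft QTQ e1

/-- The operators `ℬ_n` built from `ℬ_0` by `ℬ_{n+1} = [ℬ_∞, ℬ_n]`. -/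
def hlOp (B₀ : Module.End QTQ SymFn) : ℕ → Module.End QTQ SymFn
  | 0 => B₀
  | n + 1 => hlInf * hlOp B₀ n - hlOp B₀ n * hlInf

/-! ### The operators between the spaces `𝒫(k)^+` -/

/-- `A` is the (unique) extension of the operator `a` on `𝒫_k^+` to an operator on
`𝒫(k)^+ = 𝒫_k^+ ⊗ Sym[x_{k+1} + x_{k+2} + ⋯]`, linear over the second factor. -/
def IsSymLinearExt (k : ℕ) (a : Poly →ₗ[QTQ] Poly) (A : PSym k →ₗ[QTQ] PSym k) : Prop :=
  ∀ p ∈ PolyLT k, ∀ (G : SymFn) (F : PSym k), F.1 = ofPoly p * shift k G.1 →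
    (A F).1 = ofPoly (a p) * shift k G.1

/-- `D` is the (unique) operator `∂^-_{k+1} : 𝒫(k+1)^+ → 𝒫(k)^+` attached to a family of operators `B n` on
symmetric functions: the `𝒫_k^+`-linear map with
`x_{k+1}^n G[x_{k+2} + x_{k+3} + ⋯] ↦ (B n G)[x_{k+1} + x_{k+2} + ⋯]`. -/
def IsPartialMinus (B : ℕ → Module.End QTQ SymFn) (k : ℕ)
    (D : PSym (k + 1) →ₗ[QTQ] PSym k) : Prop :=
  ∀ p ∈ PolyLT k, ∀ (n : ℕ) (G : SymFn) (F : PSym (k + 1)),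
    F.1 = ofPoly p * ofPoly (X k) ^ n * shift (k + 1) G.1 →
      (D F).1 = ofPoly p * shift k (B n G).1

/-! ### The double Dyck path algebra -/

/-- The arrows of the quiver with vertex set `ℕ`. -/
inductive Arrow : ℕ → ℕ → Type
  | dPlus (k : ℕ) : Arrow k (k + 1)
  | dStar (k : ℕ) : Arrow k (k + 1)
  | dMinus (k : ℕ) : Arrow (k + 1) k
  | loopT (k i : ℕ) (h : i + 1 < k) : Arrow k k

/-- Generators of the path algebra: the trivial paths and the arrows. -/
inductive Gen : Type
  | vertex (k : ℕ) : Gen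
  | arrow {k l : ℕ} (a : Arrow k l) : Gen

/-- The free unital algebra on the generators. -/
abbrev FreeGen : Type := FreeAlgebra QTQ Gen

namespace FreeGen

/-- The trivial path at `k`. -/
def e (k : ℕ) : FreeGen := FreeAlgebra.ι QTQ (Gen.vertex k)

/-- `d_+ : k → k + 1`. -/
def dP (k : ℕ) : FreeGen := FreeAlgebra.ι QTQ (Gen.arrow (Arrow.dPlus k))

/-- `d_+^* : k → k + 1`. -/
def dS (k : ℕ) : FreeGen := FreeAlgebra.ι QTQ (Gen.arrow (Arrow.dStar k))

/-- `d_- : k + 1 → k`. -/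
def dM (k : ℕ) : FreeGen := FreeAlgebra.ι QTQ (Gen.arrow (Arrow.dMinus k))

/-- The loop `T_{i+1}` at `k` (for `i + 1 < k`). -/
def T (k i : ℕ) : FreeGen :=
  if h : i + 1 < k then FreeAlgebra.ι QTQ (Gen.arrow (Arrow.loopT k i h)) else 0

/-- The inverse `t⁻¹ (T_{i+1} + t - 1)` of the loop `T_{i+1}` at `k`. -/
def TInv (k i : ℕ) : FreeGen := tc⁻¹ • (T k i + (tc - 1) • e k)

/-- `T_n ⋯ T_1` at `k`. -/
def TDesc (k : ℕ) : ℕ → FreeGen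
  | 0 => 1
  | n + 1 => T k n * TDesc k n

/-- `T_n⁻¹ ⋯ T_1⁻¹` at `k`. -/
def TInvDesc (k : ℕ) : ℕ → FreeGen
  | 0 => 1
  | n + 1 => TInv k n * TInvDesc k n

/-- `[d_+, d_-]` at the vertex `k + 1`. -/
def commP (k : ℕ) : FreeGen := dP k * dM k - dM (k + 1) * dP (k + 1)

/-- `[d_+^*, d_-]` at the vertex `k + 1`. -/
def commS (k : ℕ) : FreeGen := dS k * dM k - dM (k + 1) * dS (k + 1)

/-- The loop `y_{i+1}` at the vertex `k + 1` (for `i ≤ k`). -/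
def y (k : ℕ) : ℕ → FreeGen
  | 0 => (tc ^ k * (tc - 1))⁻¹ • (commP k * TDesc (k + 1) k)
  | i + 1 => tc • (TInv (k + 1) i * y k i * TInv (k + 1) i)

/-- The loop `z_{i+1}` at the vertex `k + 1` (for `i ≤ k`). -/
def z (k : ℕ) : ℕ → FreeGen
  | 0 => (tc ^ (k + 1) / (1 - tc)) • (commS k * TInvDesc (k + 1) k)
  | i + 1 => tc⁻¹ • (T (k + 1) i * z k i * T (k + 1) i)

/-- The defining relations of the double Dyck path algebra.  A product of paths is read as a
composition of operators, from right to left.  The first four relations are those of the path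
algebra of the quiver. -/
inductive Rel : FreeGen → FreeGen → Prop
  | vertex_sq (k : ℕ) : Rel (e k * e k) (e k)
  | vertex_ne (k l : ℕ) (h : k ≠ l) : Rel (e k * e l) 0
  | source {k l : ℕ} (a : Arrow k l) :
      Rel (FreeAlgebra.ι QTQ (Gen.arrow a) * e k) (FreeAlgebra.ι QTQ (Gen.arrow a))
  | target {k l : ℕ} (a : Arrow k l) :
      Rel (e l * FreeAlgebra.ι QTQ (Gen.arrow a)) (FreeAlgebra.ι QTQ (Gen.arrow a))
  | T_comm (k i j : ℕ) (hij : i + 1 < j) (hj : j + 1 < k) :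
      Rel (T k i * T k j) (T k j * T k i)
  | T_braid (k i : ℕ) (hi : i + 2 < k) :
      Rel (T k i * T k (i + 1) * T k i) (T k (i + 1) * T k i * T k (i + 1))
  | T_quad (k i : ℕ) (hi : i + 1 < k) :
      Rel ((T k i - e k) * (T k i + tc • e k)) 0
  | dM_dM_T (k : ℕ) : Rel (dM k * dM (k + 1) * T (k + 2) k) (dM k * dM (k + 1))
  | T_dM (k i : ℕ) (hi : i + 1 < k) : Rel (T k i * dM k) (dM k * T (k + 1) i)
  | T_dP_dP (k : ℕ) : Rel (T (k + 2) 0 * dP (k + 1) * dP k) (dP (k + 1) * dP k)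
  | dP_T (k i : ℕ) (hi : i + 1 < k) : Rel (dP k * T k i) (T (k + 1) (i + 1) * dP k)
  | dM_commP (k : ℕ) :
      Rel (dM (k + 1) * commP (k + 1) * T (k + 2) k) (tc • (commP k * dM (k + 1)))
  | commP_dP (k : ℕ) :
      Rel (T (k + 2) 0 * commP (k + 1) * dP (k + 1)) (tc • (dP (k + 1) * commP k))
  | T_dS_dS (k : ℕ) : Rel (T (k + 2) 0 * dS (k + 1) * dS k) (dS (k + 1) * dS k)
  | dS_T (k i : ℕ) (hi : i + 1 < k) : Rel (dS k * T k i) (T (k + 1) (i + 1) * dS k)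
  | dM_commS (k : ℕ) :
      Rel (tc • (dM (k + 1) * commS (k + 1))) (commS k * dM (k + 1) * T (k + 2) k)
  | commS_dS (k : ℕ) :
      Rel (tc • (commS (k + 1) * dS (k + 1))) (T (k + 2) 0 * dS (k + 1) * commS k)
  | dP_z (k i : ℕ) (hi : i < k) : Rel (dP (k + 1) * z k i) (z (k + 1) (i + 1) * dP (k + 1))
  | dS_y (k i : ℕ) (hi : i < k) : Rel (dS (k + 1) * y k i) (y (k + 1) (i + 1) * dS (k + 1))
  | z_dP (k : ℕ) : Rel (z k 0 * dP k) (-(qc * tc ^ (k + 1)) • (y k 0 * dS k))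

end FreeGen

/-- The double Dyck path algebra `𝔸_{t,q}`: the path algebra of the quiver modulo the relations.
As the quiver has infinitely many vertices, its path algebra has no unit; here a unit is adjoined,
so that modules over the path algebra are the unital modules over `DDPA`. -/
def DDPA : Type := RingQuot FreeGen.Rel

instance : Ring DDPA := inferInstanceAs (Ring (RingQuot FreeGen.Rel))

instance : Algebra QTQ DDPA := inferInstanceAs (Algebra QTQ (RingQuot FreeGen.Rel))

/-- The class of an element of the free algebra in the double Dyck path algebra. -/
def DDPA.mk : FreeGen →ₐ[QTQ] DDPA := RingQuot.mkAlgHom QTQ FreeGen.Rel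

/-! ### The space `𝒫_•` -/

/-- The total space `⨁_k 𝒫(k)^+` of `𝒫_•`. -/
abbrev PBullet : Type := DirectSum ℕ fun k => PSym k

/-- The inclusion of the `k`-th summand. -/
def PBullet.single (k : ℕ) : PSym k →ₗ[QTQ] PBullet := DirectSum.lof QTQ ℕ (fun k => PSym k) k

/-- The operator on `𝒫_•` which is `φ` on `𝒫(k)^+`, with values in `𝒫(l)^+`, and zero on the other
summands. -/
def PBullet.map {k l : ℕ} (φ : PSym k →ₗ[QTQ] PSym l) : Module.End QTQ PBullet :=
  PBullet.single l ∘ₗ φ ∘ₗ DirectSum.component QTQ ℕ (fun k => PSym k) k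

/-- The operator `Φ` on `𝒫_•` maps `𝒫(k)^+` to itself by the restriction of the global operator `f`
(which therefore preserves `𝒫(k)^+`), and is zero on the other summands. -/
def ActsGloballyBy (Φ : Module.End QTQ PBullet) (k : ℕ) (f : PInf → PInf) : Prop :=
  ∃ φ : PSym k →ₗ[QTQ] PSym k, (∀ F : PSym k, (φ F).1 = f F.1) ∧ Φ = PBullet.map φ

end StableDAHA

end

/-!
All operators are realised on `𝒫_∞^+` itself.  The space `𝒫(k+1)^+` is the polynomial ring
`𝒫(k)^+[x_{k+1}]`, and `∂^-` is the `𝒫(k)^+`-linear map sending `x_{k+1}^n` to the Hall–Littlewood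
function `Q_n[x_{k+1} + x_{k+2} + ⋯]`.  With this description the commutators become explicit:
`[∂, ∂^-]` is `(t - 1) T_1 ⋯ T_k x_{k+1}`, and `[∂^*, ∂^-]` is determined by its value on
`x_{k+1} F`, which gives the defining relations by induction on the degree in `x_{k+1}`.

On `𝒫(k+1)^+` the operator `Ỹ_i^{(m)}` equals `z_i` plus `t^m` times an operator independent of `m`,
built from `∂^* ∂^- - t ∂^- ∂^*`; hence the limit `𝒴_i` exists and coincides with `z_i`.

The operator `ℬ_0` is the shift `F ↦ F[x_2 + x_3 + ⋯]` followed by `∂^-`; writing `Q_n` in terms of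
partial fractions turns `ℬ_0 P_μ` into a sum over the choice of a distinguished variable, and the
eigenvalue `t^{ℓ(μ)}` appears as a residue sum.
-/

noncomputable section

namespace StableDAHA

open MvPolynomial Filter

/-! ### The field of parameters and `t`-adic convergence -/

theorem algebraMap_QTQ_injective :
    Function.Injective (algebraMap (MvPolynomial (Fin 2) ℚ) QTQ) :=
  IsFractionRing.injective _ _

theorem tc_ne_zero : tc ≠ 0 := by
  intro h
  have := algebraMap_QTQ_injective (h.trans (map_zero _).symm)
  exact X_ne_zero 0 this

theorem tc_pow_ne_one {n : ℕ} (hn : n ≠ 0) : tc ^ n ≠ 1 := by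
  intro h
  have hpow : (X 0 ^ n : MvPolynomial (Fin 2) ℚ) = 1 := by
    apply algebraMap_QTQ_injective
    rw [map_pow, map_one]
    exact h
  have hdegree := congrArg totalDegree hpow
  rw [totalDegree_X_pow, totalDegree_one] at hdegree
  exact hn hdegree

theorem one_sub_tc_ne_zero : 1 - tc ≠ 0 := by
  intro h
  exact tc_pow_ne_one one_ne_zero (by rw [pow_one]; exact (sub_eq_zero.mp h).symm)

theorem prime_X_zero : Prime (X 0 : MvPolynomial (Fin 2) ℚ) := MvPolynomial.X_prime

theorem OrdGE.add {M : ℕ} {c d : QTQ} (hc : OrdGE M c) (hd : OrdGE M d) : OrdGE M (c + d) := by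
  obtain ⟨A, B, hB, h⟩ := hc
  obtain ⟨A', B', hB', h'⟩ := hd
  refine ⟨A * B' + A' * B, B * B', prime_X_zero.not_dvd_mul hB hB', ?_⟩
  simp only [map_mul, map_add] at h h' ⊢
  linear_combination algebraMap _ QTQ B' * h + algebraMap _ QTQ B * h'

theorem OrdGE.zero (M : ℕ) : OrdGE M 0 :=
  ⟨0, 1, prime_X_zero.not_dvd_one, by simp⟩

theorem OrdGE.mono {M N : ℕ} (h : M ≤ N) {c : QTQ} (hc : OrdGE N c) : OrdGE M c := by
  obtain ⟨A, B, hB, e⟩ := hc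
  refine ⟨X 0 ^ (N - M) * A, B, hB, ?_⟩
  rw [e, ← mul_assoc, ← pow_add, Nat.add_sub_cancel' h]

theorem ordGE_tc_pow (M : ℕ) : OrdGE M (tc ^ M) :=
  ⟨1, 1, prime_X_zero.not_dvd_one, by simp [tc]⟩

theorem exists_ordGE_mul (d : QTQ) : ∃ N, ∀ M c, OrdGE (M + N) c → OrdGE M (d * c) := by
  obtain ⟨P, R, hR, rfl⟩ := IsFractionRing.div_surjective (A := MvPolynomial (Fin 2) ℚ) d
  have hR0 : R ≠ 0 := nonZeroDivisors.ne_zero hR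
  obtain ⟨N, B', hB', hRB⟩ := WfDvdMonoid.max_power_factor hR0 prime_X_zero.irreducible
  refine ⟨N, fun M c ⟨A, B, hB, h⟩ => ⟨P * A, B' * B, prime_X_zero.not_dvd_mul hB' hB, ?_⟩⟩
  have hR1 : algebraMap (MvPolynomial (Fin 2) ℚ) QTQ R ≠ 0 :=
    (map_ne_zero_iff _ algebraMap_QTQ_injective).mpr hR0
  rw [div_mul_eq_mul_div, div_mul_eq_mul_div, div_eq_iff hR1, hRB]
  simp only [map_mul, map_pow] at h ⊢
  rw [pow_add] at h
  linear_combination (algebraMap _ QTQ P * algebraMap _ QTQ B') * h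

theorem not_ordGE_one_one : ¬ OrdGE 1 1 := by
  rintro ⟨A, B, hB, h⟩
  rw [one_mul] at h
  exact hB ⟨A, by rw [algebraMap_QTQ_injective h, pow_one]⟩

theorem eq_zero_of_forall_ordGE {c : QTQ} (h : ∀ M, OrdGE M c) : c = 0 := by
  by_contra hc
  obtain ⟨N, hN⟩ := exists_ordGE_mul c⁻¹
  exact not_ordGE_one_one (inv_mul_cancel₀ hc ▸ hN 1 c (h (1 + N)))

theorem coeffTendsto_const (c : QTQ) : CoeffTendsto (fun _ => c) c :=
  fun M => Eventually.of_forall fun _ => by rw [sub_self]; exact OrdGE.zero M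

theorem CoeffTendsto.add {a a' : ℕ → QTQ} {b b' : QTQ} (h : CoeffTendsto a b)
    (h' : CoeffTendsto a' b') : CoeffTendsto (fun n => a n + a' n) (b + b') := fun M => by
  filter_upwards [h M, h' M] with n hf hg
  have := hf.add hg
  rwa [sub_add_sub_comm] at this

theorem CoeffTendsto.const_mul {a : ℕ → QTQ} {b : QTQ} (h : CoeffTendsto a b) (d : QTQ) :
    CoeffTendsto (fun n => d * a n) (d * b) := fun M => by
  obtain ⟨N, hN⟩ := exists_ordGE_mul d
  filter_upwards [h (M + N)] with n hn
  rw [← mul_sub]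
  exact hN M _ hn

theorem CoeffTendsto.sum {ι : Type*} (s : Finset ι) {a : ι → ℕ → QTQ} {b : ι → QTQ}
    (h : ∀ i, CoeffTendsto (a i) (b i)) :
    CoeffTendsto (fun n => ∑ i ∈ s, a i n) (∑ i ∈ s, b i) := by
  classical
  induction s using Finset.induction_on with
  | empty => simpa using coeffTendsto_const 0
  | insert i s hi ih =>
    simp only [Finset.sum_insert hi]
    exact (h i).add ih

theorem CoeffTendsto.congr' {a a' : ℕ → QTQ} {b : QTQ} (h : CoeffTendsto a b)
    (e : ∀ᶠ n in atTop, a n = a' n) : CoeffTendsto a' b := fun M => by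
  filter_upwards [h M, e] with n hn heq
  rwa [← heq]

theorem CoeffTendsto.unique {a : ℕ → QTQ} {b b' : QTQ} (h : CoeffTendsto a b)
    (h' : CoeffTendsto a b') : b = b' := by
  rw [← sub_eq_zero]
  apply eq_zero_of_forall_ordGE
  have hdiff := ((h.const_mul (-1)).add h')
  intro M
  obtain ⟨n, hn⟩ := (hdiff M).exists
  convert hn using 1
  ring

theorem coeffTendsto_tc_pow : CoeffTendsto (fun m => tc ^ m) 0 := fun M => by
  filter_upwards [eventually_ge_atTop M] with n hn
  rw [sub_zero]
  exact (ordGE_tc_pow n).mono hn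

/-! ### The ring `𝒫_∞^+` -/

theorem PInf.ext {F G : PInf} (h : ∀ m, proj F m = proj G m) : F = G :=
  Subtype.ext (funext h)

theorem PInf.ext_of_le (N : ℕ) {F G : PInf} (h : ∀ m, N ≤ m → proj F m = proj G m) : F = G :=
  PInf.ext fun m => by
    rw [← trunc_proj F (le_max_left m N), ← trunc_proj G (le_max_left m N), h _ (le_max_right m N)]

/-- `Π_m` as an algebra homomorphism. -/
def projHom (m : ℕ) : PInf →ₐ[QTQ] Poly where
  toFun F := proj F m
  map_one' := rfl
  map_mul' _ _ := rfl
  map_zero' := rfl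
  map_add' _ _ := rfl
  commutes' _ := rfl

@[simp] theorem proj_add (F G : PInf) (m : ℕ) : proj (F + G) m = proj F m + proj G m := rfl
@[simp] theorem proj_sub (F G : PInf) (m : ℕ) : proj (F - G) m = proj F m - proj G m := rfl
@[simp] theorem proj_mul (F G : PInf) (m : ℕ) : proj (F * G) m = proj F m * proj G m := rfl
@[simp] theorem proj_smul (c : QTQ) (F : PInf) (m : ℕ) : proj (c • F) m = c • proj F m := rfl
@[simp] theorem proj_zero (m : ℕ) : proj 0 m = 0 := rfl
@[simp] theorem proj_one (m : ℕ) : proj 1 m = 1 := rfl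
@[simp] theorem proj_pow (F : PInf) (n m : ℕ) : proj (F ^ n) m = proj F m ^ n :=
  map_pow (projHom m) F n
@[simp] theorem proj_sum {ι : Type*} (s : Finset ι) (F : ι → PInf) (m : ℕ) :
    proj (∑ i ∈ s, F i) m = ∑ i ∈ s, proj (F i) m :=
  map_sum (projHom m) F s

theorem proj_ofPoly (p : Poly) (m : ℕ) : proj (ofPoly p) m = trunc m p := rfl

theorem trunc_X_of_lt {j m : ℕ} (h : j < m) : trunc m (X j) = X j := by simp [trunc, h]

theorem trunc_X_of_le {j m : ℕ} (h : m ≤ j) : trunc m (X j) = 0 := by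
  simp [trunc, Nat.not_lt.mpr h]

/-- The variable `x_{j+1}` as an element of `𝒫_∞^+`. -/
def xInf (j : ℕ) : PInf := ofPoly (X j)

theorem proj_xInf_of_lt {j m : ℕ} (h : j < m) : proj (xInf j) m = X j := trunc_X_of_lt h

/-- The map `𝒫 → 𝒫_∞^+` as an algebra homomorphism. -/
def ofPolyHom : Poly →ₐ[QTQ] PInf where
  toFun := ofPoly
  map_one' := PInf.ext fun m => map_one (trunc m)
  map_mul' _ _ := PInf.ext fun m => map_mul (trunc m) _ _
  map_zero' := PInf.ext fun m => map_zero (trunc m)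
  map_add' _ _ := PInf.ext fun m => map_add (trunc m) _ _
  commutes' c := PInf.ext fun m => (trunc m).commutes c

instance : Nontrivial PInf :=
  ⟨0, 1, fun h => zero_ne_one (α := Poly) (congrArg (fun F => proj F 0) h)⟩

instance : NoZeroDivisors PInf where
  eq_zero_or_eq_zero_of_mul_eq_zero {F G} h := by
    by_contra! hne
    obtain ⟨hF, hG⟩ := hne
    have hne : ∃ m, proj F m ≠ 0 := by
      by_contra! h0
      exact hF (PInf.ext h0)
    obtain ⟨m, hm⟩ := hne
    apply hG
    apply PInf.ext_of_le m
    intro n hn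
    have hmul : proj F n * proj G n = 0 := congrArg (fun F => proj F n) h
    refine (mul_eq_zero.mp hmul).resolve_left fun hzero => hm ?_
    rw [← trunc_proj F hn, hzero, map_zero]

instance : IsDomain PInf := NoZeroDivisors.to_isDomain _

theorem xInf_injective : Function.Injective xInf := fun i j h => by
  have := congrArg (fun F => proj F (i + j + 1)) h
  beta_reduce at this
  rw [proj_xInf_of_lt (by omega), proj_xInf_of_lt (by omega)] at this
  exact X_injective this

theorem coeff_trunc (m : ℕ) (d : ℕ →₀ ℕ) (f : Poly) [Decidable (∀ i ∈ d.support, i < m)] :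
    coeff d (trunc m f) = if ∀ i ∈ d.support, i < m then coeff d f else 0 := by
  induction f using MvPolynomial.induction_on' with
  | add p r hp hr => rw [map_add, coeff_add, hp, hr, coeff_add]; split_ifs <;> simp
  | monomial e b =>
    by_cases he : ∀ i ∈ e.support, i < m
    · have hfix : trunc m (monomial e b) = monomial e b := by
        rw [trunc, aeval_monomial, monomial_eq, algebraMap_eq]
        congr 1
        exact Finset.prod_congr rfl fun i hi => by beta_reduce; rw [if_pos (he i hi)]
      rw [hfix, coeff_monomial]
      split_ifs with hed hd <;> first | rfl | exact absurd (hed ▸ he) hd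
    · obtain ⟨i, hi, hmi⟩ : ∃ i ∈ e.support, ¬ i < m := by simpa using he
      have hkill : trunc m (monomial e b) = 0 := by
        rw [trunc, aeval_monomial, Finsupp.prod, Finset.prod_eq_zero hi, mul_zero]
        rw [if_neg hmi, zero_pow (Finsupp.mem_support_iff.mp hi)]
      rw [hkill, coeff_zero, coeff_monomial]
      split_ifs with hd hed <;> first | rfl | exact absurd (hed ▸ hd) he

theorem coeff_proj_of_le (F : PInf) {m n : ℕ} (h : m ≤ n) {d : ℕ →₀ ℕ}
    (hd : ∀ i ∈ d.support, i < m) : coeff d (proj F n) = coeff d (proj F m) := by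
  classical
  rw [← trunc_proj F h, coeff_trunc, if_pos hd]

theorem coeff_proj_eq_zero (F : PInf) {m : ℕ} {d : ℕ →₀ ℕ} (hd : ¬ ∀ i ∈ d.support, i < m) :
    coeff d (proj F m) = 0 := by
  classical
  rw [← trunc_proj F le_rfl, coeff_trunc, if_neg hd]

/-! ### Uniqueness of limits -/

theorem HasStableLimit.coeffTendsto_coeff {f : ℕ → Poly} {F : PInf} (hF : HasStableLimit f F)
    {d : ℕ →₀ ℕ} {n : ℕ} (hd : ∀ i ∈ d.support, i < n) :
    CoeffTendsto (fun m => coeff d (f m)) (coeff d (proj F n)) := by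
  obtain ⟨N, h, g, a, b, -, hab, hf, rfl⟩ := hF
  have hlim := (coeffTendsto_const (coeff d (proj h n))).add
    (CoeffTendsto.sum Finset.univ fun i => (hab i).const_mul (coeff d (proj (g i) n)))
  have hcoeff : coeff d (proj (h + ∑ i, b i • g i) n) =
      coeff d (proj h n) + ∑ i, coeff d (proj (g i) n) * b i := by
    simp only [proj_add, proj_sum, proj_smul, coeff_add, coeff_sum, coeff_smul, smul_eq_mul,
      mul_comm]
  rw [hcoeff]
  refine hlim.congr' ?_
  filter_upwards [hf, eventually_ge_atTop n] with m hm hn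
  simp only [hm, coeff_add, coeff_sum, coeff_smul, smul_eq_mul, coeff_proj_of_le _ hn hd, mul_comm]

theorem HasStableLimit.unique {f : ℕ → Poly} {F G : PInf} (hF : HasStableLimit f F)
    (hG : HasStableLimit f G) : F = G := by
  refine PInf.ext fun m => MvPolynomial.ext _ _ fun d => ?_
  by_cases hd : ∀ i ∈ d.support, i < m
  · exact (hF.coeffTendsto_coeff hd).unique (hG.coeffTendsto_coeff hd)
  · rw [coeff_proj_eq_zero F hd, coeff_proj_eq_zero G hd]

theorem calY_eq {i : ℕ} {F G : PInf} (h : HasStableLimit (fun m => polyY m i (proj F m)) G) :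
    calY i F = G := by
  have hex : ∃ G, HasStableLimit (fun m => polyY m i (proj F m)) G := ⟨G, h⟩
  rw [calY, dif_pos hex]
  exact (Classical.choose_spec hex).unique h

/-! ### Substitutions in `𝒫_∞^+` -/

/-- The substitution `x_{j+1} ↦ φ j` makes sense on `𝒫_∞^+`: it does not raise degrees, and for some
`s` the image in `𝒫_m^+` only involves the first `m + s` variables. -/
structure Admissible (φ : ℕ → Poly) : Prop where
  totalDegree_le : ∀ j, (φ j).totalDegree ≤ 1
  exists_tail : ∃ s, ∀ m j, m + s ≤ j → trunc m (φ j) = 0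

theorem totalDegree_aeval_le {σ τ R : Type*} [CommSemiring R] {φ : σ → MvPolynomial τ R}
    (h : ∀ j, (φ j).totalDegree ≤ 1) (f : MvPolynomial σ R) :
    (aeval φ f).totalDegree ≤ f.totalDegree := by
  rw [aeval_def, eval₂_eq]
  refine (totalDegree_finsetSum _ _).trans (Finset.sup_le fun d hd => ?_)
  refine le_trans ?_ (le_totalDegree hd)
  refine (totalDegree_mul _ _).trans ?_
  rw [algebraMap_eq, totalDegree_C, zero_add, Finsupp.sum]
  refine (totalDegree_finsetProd _ _).trans (Finset.sum_le_sum fun j _ => ?_)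
  refine (totalDegree_pow _ _).trans ?_
  simpa using Nat.mul_le_mul_left (d j) (h j)

theorem trunc_aeval_trunc {φ : ℕ → Poly} {m n : ℕ} (h : ∀ j, n ≤ j → trunc m (φ j) = 0)
    (f : Poly) : trunc m (aeval φ (trunc n f)) = trunc m (aeval φ f) := by
  have : ((trunc m).comp (aeval φ)).comp (trunc n) = (trunc m).comp (aeval φ) := by
    apply MvPolynomial.algHom_ext
    intro j
    simp only [AlgHom.comp_apply, trunc, aeval_X]
    split_ifs with hj
    · rw [aeval_X]
    · have := h j (by omega)
      rw [trunc] at this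
      rw [map_zero, map_zero, this]
  exact congrArg (fun ψ => ψ f) this

/-- The substitution `x_{j+1} ↦ φ j` on `𝒫_∞^+`. -/
def subst (φ : ℕ → Poly) (h : Admissible φ) : PInf →ₐ[QTQ] PInf where
  toFun F := ⟨fun m => trunc m (aeval φ (proj F (m + h.exists_tail.choose))), fun m => by
      have hs := h.exists_tail.choose_spec
      beta_reduce
      rw [trunc_trunc, min_eq_left (Nat.le_succ m),
        ← trunc_aeval_trunc (n := m + h.exists_tail.choose) (hs m), trunc_proj F (by omega)], by
      obtain ⟨d, hd⟩ := F.2.2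
      exact ⟨d, fun m => (totalDegree_trunc_le _ _).trans
        ((totalDegree_aeval_le h.totalDegree_le _).trans (hd _))⟩⟩
  map_one' := PInf.ext fun m => by
    change trunc m (aeval φ (1 : Poly)) = 1
    rw [map_one, map_one]
  map_mul' F G := PInf.ext fun m => by
    change trunc m (aeval φ (_ * _)) = _
    rw [map_mul, map_mul]
    rfl
  map_zero' := PInf.ext fun m => by
    change trunc m (aeval φ (0 : Poly)) = 0
    rw [map_zero, map_zero]
  map_add' F G := PInf.ext fun m => by
    change trunc m (aeval φ (_ + _)) = _
    rw [map_add, map_add]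
    rfl
  commutes' c := PInf.ext fun m => ((trunc m).comp (aeval φ)).commutes c

theorem proj_subst {φ : ℕ → Poly} (h : Admissible φ) {m n : ℕ}
    (hn : ∀ j, n ≤ j → trunc m (φ j) = 0) (F : PInf) :
    proj (subst φ h F) m = trunc m (aeval φ (proj F n)) := by
  have hs := h.exists_tail.choose_spec m
  change trunc m (aeval φ (proj F (m + h.exists_tail.choose))) = _
  set s := m + h.exists_tail.choose
  rw [← trunc_proj F (le_max_left s n), ← trunc_proj F (le_max_right s n), trunc_aeval_trunc hs,
    trunc_aeval_trunc hn]

theorem proj_subst_self {φ : ℕ → Poly} (h : Admissible φ) {m : ℕ}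
    (hn : ∀ j, m ≤ j → trunc m (φ j) = 0) (hm : ∀ j, j < m → trunc m (φ j) = φ j) (F : PInf) :
    proj (subst φ h F) m = aeval φ (proj F m) := by
  rw [proj_subst h hn, ← trunc_proj F le_rfl]
  have : ((trunc m).comp (aeval φ)).comp (trunc m) = (aeval φ).comp (trunc m) := by
    apply MvPolynomial.algHom_ext
    intro j
    simp only [AlgHom.comp_apply]
    by_cases hj : j < m
    · rw [trunc_X_of_lt hj, aeval_X, hm j hj]
    · rw [trunc_X_of_le (by omega), map_zero, map_zero]
  exact congrArg (fun ψ => ψ (proj F m)) this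

theorem subst_ofPoly {φ : ℕ → Poly} (h : Admissible φ) (p : Poly) :
    subst φ h (ofPoly p) = ofPoly (aeval φ p) := by
  obtain ⟨s, hs⟩ := h.exists_tail
  refine PInf.ext fun m => ?_
  rw [proj_subst h (hs m), proj_ofPoly, trunc_aeval_trunc (hs m), proj_ofPoly]

theorem subst_xInf {φ : ℕ → Poly} (h : Admissible φ) (j : ℕ) :
    subst φ h (xInf j) = ofPoly (φ j) := by
  rw [xInf, subst_ofPoly, aeval_X]

theorem subst_subst {φ ψ χ : ℕ → Poly} (hφ : Admissible φ) (hψ : Admissible ψ)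
    (hχ : Admissible χ) (h : ∀ j, aeval φ (ψ j) = χ j) (F : PInf) :
    subst φ hφ (subst ψ hψ F) = subst χ hχ F := by
  obtain ⟨s, hs⟩ := hφ.exists_tail
  obtain ⟨s', hs'⟩ := hψ.exists_tail
  obtain ⟨s'', hs''⟩ := hχ.exists_tail
  refine PInf.ext fun m => ?_
  have e : (aeval φ : Poly →ₐ[QTQ] Poly).comp (aeval ψ) = aeval χ := by
    apply MvPolynomial.algHom_ext
    intro j
    rw [AlgHom.comp_apply, aeval_X, aeval_X, h]
  rw [proj_subst hφ (hs m), proj_subst (n := m + s + s' + s'') hψ (fun j hj => hs' _ j (by omega)),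
    trunc_aeval_trunc (hs m),
    proj_subst (n := m + s + s' + s'') hχ (fun j hj => hs'' _ j (by omega)), ← e, AlgHom.comp_apply]

theorem Admissible.comp {φ ψ : ℕ → Poly} (hφ : Admissible φ) (hψ : Admissible ψ) :
    Admissible fun j => aeval φ (ψ j) where
  totalDegree_le j := (totalDegree_aeval_le hφ.totalDegree_le _).trans (hψ.totalDegree_le j)
  exists_tail := by
    obtain ⟨s, hs⟩ := hφ.exists_tail
    obtain ⟨s', hs'⟩ := hψ.exists_tail
    refine ⟨s + s', fun m j hj => ?_⟩
    rw [← trunc_aeval_trunc (hs m), hs' _ _ (by omega), map_zero, map_zero]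

theorem subst_subst_comm {φ ψ φ' ψ' : ℕ → Poly} (hφ : Admissible φ) (hψ : Admissible ψ)
    (hφ' : Admissible φ') (hψ' : Admissible ψ')
    (h : ∀ j, aeval φ (ψ j) = aeval φ' (ψ' j)) (F : PInf) :
    subst φ hφ (subst ψ hψ F) = subst φ' hφ' (subst ψ' hψ' F) := by
  rw [subst_subst hφ hψ (hφ'.comp hψ') h, subst_subst hφ' hψ' (hφ'.comp hψ') fun _ => rfl]

theorem admissible_of_eventually_X {φ : ℕ → Poly} (s : ℕ) (hdeg : ∀ j, (φ j).totalDegree ≤ 1)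
    (htail : ∀ j, s ≤ j → ∃ i, j ≤ i + s ∧ φ j = X i) : Admissible φ where
  totalDegree_le := hdeg
  exists_tail := ⟨s, fun m j hj => by
    obtain ⟨i, hi, h⟩ := htail j (by omega)
    rw [h, trunc_X_of_le (by omega)]⟩

theorem admissible_X : Admissible (X : ℕ → Poly) :=
  admissible_of_eventually_X 0 (fun _ => (totalDegree_X _).le) fun j _ => ⟨j, le_rfl, rfl⟩

theorem subst_X (F : PInf) : subst X admissible_X F = F := by
  refine PInf.ext fun m => ?_
  rw [proj_subst (n := m) admissible_X fun j hj => trunc_X_of_le hj, aeval_X_left_apply,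
    trunc_proj F le_rfl]

/-! ### Permutations of the variables -/

theorem lt_swap_add_two (i j : ℕ) : j < Equiv.swap i (i + 1) j + 2 := by
  rw [Equiv.swap_apply_def]
  split_ifs <;> omega

theorem swap_lt {i j m : ℕ} (h : i + 1 < m) (hj : j < m) : Equiv.swap i (i + 1) j < m := by
  rw [Equiv.swap_apply_def]
  split_ifs <;> omega

theorem admissible_swap (i : ℕ) : Admissible (fun j => X (Equiv.swap i (i + 1) j)) :=
  admissible_of_eventually_X 1 (fun _ => (totalDegree_X _).le) fun j _ =>
    ⟨_, Nat.lt_succ_iff.mp (lt_swap_add_two i j), rfl⟩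

/-- The simple transposition exchanging `x_{i+1}` and `x_{i+2}` on `𝒫_∞^+`. -/
def swapInf (i : ℕ) : PInf →ₐ[QTQ] PInf := subst _ (admissible_swap i)

theorem swapVar_eq_aeval (i : ℕ) : swapVar i = aeval fun j => X (Equiv.swap i (i + 1) j) := by
  apply MvPolynomial.algHom_ext
  intro j
  rw [swapVar, rename_X, aeval_X]

theorem proj_swapInf {i m : ℕ} (h : i + 1 < m) (F : PInf) :
    proj (swapInf i F) m = swapVar i (proj F m) := by
  rw [swapInf, proj_subst_self, swapVar_eq_aeval]
  · intro j hj
    rw [Equiv.swap_apply_of_ne_of_ne (by omega) (by omega), trunc_X_of_le hj]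
  · intro j hj
    exact trunc_X_of_lt (swap_lt h hj)

theorem swapInf_xInf (i j : ℕ) :
    swapInf i (xInf j) = xInf (Equiv.swap i (i + 1) j) := subst_xInf _ _

@[simp] theorem swapInf_xInf_left (i : ℕ) : swapInf i (xInf i) = xInf (i + 1) := by
  rw [swapInf_xInf, Equiv.swap_apply_left]

@[simp] theorem swapInf_xInf_right (i : ℕ) : swapInf i (xInf (i + 1)) = xInf i := by
  rw [swapInf_xInf, Equiv.swap_apply_right]

theorem swapInf_xInf_of_ne {i j : ℕ} (hji : j ≠ i) (hji_succ : j ≠ i + 1) :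
    swapInf i (xInf j) = xInf j := by
  rw [swapInf_xInf, Equiv.swap_apply_of_ne_of_ne hji hji_succ]

theorem swapInf_swapInf (i : ℕ) (F : PInf) : swapInf i (swapInf i F) = F := by
  rw [swapInf, subst_subst _ _ admissible_X (fun j => ?_), subst_X]
  rw [aeval_X, Equiv.swap_apply_self]

theorem swapInf_comm {i j : ℕ} (h : i + 1 < j) (F : PInf) :
    swapInf i (swapInf j F) = swapInf j (swapInf i F) := by
  apply PInf.ext_of_le (j + 2)
  intro m hm
  rw [proj_swapInf (by omega), proj_swapInf (by omega), proj_swapInf (by omega),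
    proj_swapInf (by omega), swapVar, swapVar, rename_rename, rename_rename]
  congr 2
  funext a
  simp only [Function.comp, Equiv.swap_apply_def]
  grind

theorem swapInf_braid (i : ℕ) (F : PInf) :
    swapInf i (swapInf (i + 1) (swapInf i F)) =
      swapInf (i + 1) (swapInf i (swapInf (i + 1) F)) := by
  apply PInf.ext_of_le (i + 3)
  intro m hm
  simp only [proj_swapInf (show i + 1 < m by omega), proj_swapInf (show i + 1 + 1 < m by omega)]
  rw [swapVar, swapVar, rename_rename, rename_rename, rename_rename, rename_rename]
  congr 2
  funext a
  simp only [Function.comp, Equiv.swap_apply_def]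
  grind

/-! ### The Hecke operators on `𝒫_∞^+` -/

theorem xInf_sub_ne_zero {i j : ℕ} (h : i ≠ j) : xInf i - xInf j ≠ 0 :=
  sub_ne_zero.mpr fun e => h (xInf_injective e)

theorem calT_spec (i : ℕ) (F : PInf) :
    (xInf i - xInf (i + 1)) * calT i F =
      (tc • xInf i - xInf (i + 1)) * swapInf i F + (1 - tc) • (xInf i * F) := by
  apply PInf.ext_of_le (i + 2)
  intro m hm
  simp only [proj_mul, proj_sub, proj_add, proj_smul, proj_xInf_of_lt (show i < m by omega),
    proj_xInf_of_lt (show i + 1 < m by omega), proj_swapInf (show i + 1 < m by omega),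
    proj_calT (show i + 1 < m by omega)]
  have hpolyT : polyT i (proj F m) =
      swapVar i (proj F m) + (1 - tc) • (X i * divDiff i (proj F m)) := rfl
  rw [hpolyT]
  simp only [smul_eq_C_mul, C_sub, C_1]
  linear_combination (1 - C tc) * X i * X_sub_X_mul_divDiff i (proj F m)

theorem eq_calT {i : ℕ} {F G : PInf} (h : (xInf i - xInf (i + 1)) * G =
      (tc • xInf i - xInf (i + 1)) * swapInf i F + (1 - tc) • (xInf i * F)) : G = calT i F := by
  apply mul_left_cancel₀ (xInf_sub_ne_zero (show i ≠ i + 1 by omega))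
  rw [h, calT_spec]

theorem calT_mul_of_swapInf {i : ℕ} {c : PInf} (hc : swapInf i c = c) (F : PInf) :
    calT i (c * F) = c * calT i F := by
  symm
  apply eq_calT
  have := calT_spec i F
  rw [map_mul, hc]
  simp only [Algebra.smul_def] at *
  linear_combination c * this

theorem calT_eq_self_iff_swapInf (i : ℕ) (F : PInf) : calT i F = F ↔ swapInf i F = F := by
  rw [calT_eq_self_iff]
  constructor
  · intro h
    refine PInf.ext_of_le (i + 2) fun m hm => ?_
    rw [proj_swapInf (by omega), h m (by omega)]
  · intro h m hm
    rw [← proj_swapInf hm, h]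

theorem calT_xInf_succ_mul (i : ℕ) (F : PInf) :
    calT i (xInf (i + 1) * F) = xInf i * (calT i F + (tc - 1) • F) := by
  symm
  apply eq_calT
  have := calT_spec i F
  rw [map_mul, swapInf_xInf_right]
  simp only [Algebra.smul_def, map_sub, map_one] at *
  linear_combination xInf i * this

theorem calT_xInf_mul (i : ℕ) (F : PInf) :
    calT i (xInf i * F) = xInf (i + 1) * calT i F + (1 - tc) • (xInf i * F) := by
  symm
  apply eq_calT
  have := calT_spec i F
  rw [map_mul, swapInf_xInf_left]
  simp only [Algebra.smul_def, map_sub, map_one] at *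
  linear_combination xInf (i + 1) * this

theorem calT_xInf_mul_of_ne {i j : ℕ} (hji : j ≠ i) (hji_succ : j ≠ i + 1) (F : PInf) :
    calT i (xInf j * F) = xInf j * calT i F :=
  calT_mul_of_swapInf (swapInf_xInf_of_ne hji hji_succ) F

theorem swapInf_calT (i : ℕ) (F : PInf) :
    (xInf (i + 1) - xInf i) * swapInf i (calT i F) =
      (tc • xInf (i + 1) - xInf i) * F + (1 - tc) • (xInf (i + 1) * swapInf i F) := by
  have := congrArg (swapInf i) (calT_spec i F)
  simpa only [map_mul, map_sub, map_add, map_smul, swapInf_xInf_left, swapInf_xInf_right,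
    swapInf_swapInf] using this

theorem calT_quad (i : ℕ) (F : PInf) :
    calT i (calT i F) = (1 - tc) • calT i F + tc • F := by
  symm
  apply eq_calT
  apply mul_left_cancel₀ (xInf_sub_ne_zero (show i ≠ i + 1 by omega))
  have hF := calT_spec i F
  have hswap := swapInf_calT i F
  simp only [Algebra.smul_def, map_sub, map_one] at *
  set t := algebraMap QTQ PInf tc
  linear_combination (t * xInf i - xInf (i + 1)) * hswap +
    ((1 - t) * (xInf i - xInf (i + 1)) - (1 - t) * xInf i) * hF

theorem swapInf_calT_comm {i j : ℕ} (h : i + 1 < j ∨ j + 1 < i) (F : PInf) :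
    swapInf i (calT j F) = calT j (swapInf i F) := by
  apply eq_calT
  have := congrArg (swapInf i) (calT_spec j F)
  have e : swapInf i (swapInf j F) = swapInf j (swapInf i F) := by
    rcases h with h | h
    · exact swapInf_comm h F
    · exact (swapInf_comm h F).symm
  simpa only [map_mul, map_sub, map_add, map_smul, swapInf_xInf_of_ne (show j ≠ i by omega)
    (show j ≠ i + 1 by omega), swapInf_xInf_of_ne (show j + 1 ≠ i by omega)
    (show j + 1 ≠ i + 1 by omega), e] using this

theorem calT_comm {i j : ℕ} (h : i + 1 < j ∨ j + 1 < i) (F : PInf) :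
    calT i (calT j F) = calT j (calT i F) := by
  apply mul_left_cancel₀ (xInf_sub_ne_zero (show i ≠ i + 1 by omega))
  rw [← calT_mul_of_swapInf (i := j) (c := xInf i - xInf (i + 1)), calT_spec, calT_spec, map_add,
    map_smul, calT_mul_of_swapInf, calT_mul_of_swapInf, swapInf_calT_comm h]
  · exact swapInf_xInf_of_ne (by omega) (by omega)
  · rw [map_sub, map_smul, swapInf_xInf_of_ne (by omega) (by omega),
      swapInf_xInf_of_ne (by omega) (by omega)]
  · rw [map_sub, swapInf_xInf_of_ne (by omega) (by omega), swapInf_xInf_of_ne (by omega) (by omega)]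

theorem mul_calT_succ_calT (i : ℕ) (F : PInf) :
    (xInf i - xInf (i + 1)) * (xInf i - xInf (i + 2)) * (xInf (i + 1) - xInf (i + 2)) *
        calT (i + 1) (calT i F) =
      (tc • xInf (i + 1) - xInf (i + 2)) * (xInf i - xInf (i + 1)) *
          ((tc • xInf i - xInf (i + 2)) * swapInf (i + 1) (swapInf i F) +
            (1 - tc) • (xInf i * swapInf (i + 1) F)) +
        (1 - tc) • (xInf (i + 1) * (xInf i - xInf (i + 2)) *
          ((tc • xInf i - xInf (i + 1)) * swapInf i F + (1 - tc) • (xInf i * F))) := by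
  have hcalT := calT_spec i F
  have hswap := congrArg (swapInf (i + 1)) hcalT
  have hcalT₂ := calT_spec (i + 1) (calT i F)
  simp only [map_mul, map_sub, map_add, map_smul, swapInf_xInf_left,
    swapInf_xInf_of_ne (show i ≠ i + 1 by omega) (show i ≠ i + 1 + 1 by omega)] at hswap
  simp only [Algebra.smul_def, map_sub, map_one] at *
  set t := algebraMap QTQ PInf tc
  linear_combination (xInf i - xInf (i + 1)) * (xInf i - xInf (i + 2)) * hcalT₂ +
    (t * xInf (i + 1) - xInf (i + 2)) * (xInf i - xInf (i + 1)) * hswap +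
    (1 - t) * xInf (i + 1) * (xInf i - xInf (i + 2)) * hcalT

theorem mul_calT_calT_succ (i : ℕ) (F : PInf) :
    (xInf i - xInf (i + 1)) * (xInf i - xInf (i + 2)) * (xInf (i + 1) - xInf (i + 2)) *
        calT i (calT (i + 1) F) =
      (tc • xInf i - xInf (i + 1)) * (xInf (i + 1) - xInf (i + 2)) *
          ((tc • xInf i - xInf (i + 2)) * swapInf i (swapInf (i + 1) F) +
            (1 - tc) • (xInf i * swapInf i F)) +
        (1 - tc) • (xInf i * (xInf i - xInf (i + 2)) *
          ((tc • xInf (i + 1) - xInf (i + 2)) * swapInf (i + 1) F +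
            (1 - tc) • (xInf (i + 1) * F))) := by
  have hcalT := calT_spec (i + 1) F
  have hswap := congrArg (swapInf i) hcalT
  have hcalT₂ := calT_spec i (calT (i + 1) F)
  simp only [map_mul, map_sub, map_add, map_smul, swapInf_xInf_right,
    swapInf_xInf_of_ne (show i + 1 + 1 ≠ i by omega) (show i + 1 + 1 ≠ i + 1 by omega)] at hswap
  simp only [Algebra.smul_def, map_sub, map_one] at *
  set t := algebraMap QTQ PInf tc
  linear_combination (xInf (i + 1) - xInf (i + 2)) * (xInf i - xInf (i + 2)) * hcalT₂ +
    (t * xInf i - xInf (i + 1)) * (xInf (i + 1) - xInf (i + 2)) * hswap +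
    (1 - t) * xInf i * (xInf i - xInf (i + 2)) * hcalT

/-- Both sides, multiplied by `(x - y)² (x - z) (y - z)²`, expand to the same combination of the six
permutations of `F`. -/
theorem calT_braid (i : ℕ) (F : PInf) :
    calT i (calT (i + 1) (calT i F)) = calT (i + 1) (calT i (calT (i + 1) F)) := by
  have hleft := mul_calT_succ_calT i F
  have hright := mul_calT_calT_succ i F
  have hleft_swap := congrArg (swapInf i) hleft
  have hright_swap := congrArg (swapInf (i + 1)) hright
  have hleft_calT := calT_spec i (calT (i + 1) (calT i F))
  have hright_calT := calT_spec (i + 1) (calT i (calT (i + 1) F))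
  have hx : swapInf (i + 1) (xInf i) = xInf i := swapInf_xInf_of_ne (by omega) (by omega)
  have hz : swapInf i (xInf (i + 2)) = xInf (i + 2) := swapInf_xInf_of_ne (by omega) (by omega)
  have hy : swapInf (i + 1) (xInf (i + 1)) = xInf (i + 2) := swapInf_xInf_left _
  have hy' : swapInf (i + 1) (xInf (i + 2)) = xInf (i + 1) := swapInf_xInf_right _
  have hxy := xInf_sub_ne_zero (show i ≠ i + 1 by omega)
  have hyz := xInf_sub_ne_zero (show i + 1 ≠ i + 2 by omega)
  have hxz := xInf_sub_ne_zero (show i ≠ i + 2 by omega)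
  simp only [map_mul, map_sub, map_add, map_smul, swapInf_swapInf, hx, hy, hy', hz,
    swapInf_xInf_left, swapInf_xInf_right, swapInf_braid] at hleft_swap hright_swap
  simp only [Algebra.smul_def, map_sub, map_one] at *
  clear hx hy hy' hz
  set t := algebraMap QTQ PInf tc
  generalize xInf i = x, xInf (i + 1) = y, xInf (i + 2) = z at *
  apply mul_left_cancel₀ (mul_ne_zero (mul_ne_zero (pow_ne_zero 2 hxy) (pow_ne_zero 2 hyz)) hxz)
  linear_combination (x - y) * (y - z) ^ 2 * (x - z) * hleft_calT
    - (t * x - y) * (y - z) * hleft_swap + (1 - t) * x * (y - z) * hleft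
    - (x - y) ^ 2 * (y - z) * (x - z) * hright_calT
    + (t * y - z) * (x - y) * hright_swap - (1 - t) * y * (x - y) * hright

/-- `T_i⁻¹ = t⁻¹ (T_i + t - 1)` on `𝒫_∞^+`. -/
def calTInv (i : ℕ) : PInf →ₗ[QTQ] PInf := tc⁻¹ • (calT i + (tc - 1) • LinearMap.id)

theorem calTInv_apply (i : ℕ) (F : PInf) : calTInv i F = tc⁻¹ • (calT i F + (tc - 1) • F) := rfl

theorem calTInv_calT (i : ℕ) (F : PInf) : calTInv i (calT i F) = F := by
  rw [calTInv_apply, calT_quad, inv_smul_eq_iff₀ tc_ne_zero]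
  module

theorem calT_calTInv (i : ℕ) (F : PInf) : calT i (calTInv i F) = F := by
  rw [calTInv_apply, map_smul, map_add, map_smul, calT_quad, inv_smul_eq_iff₀ tc_ne_zero]
  module

theorem tc_smul_calTInv (i : ℕ) (F : PInf) : tc • calTInv i F = calT i F + (tc - 1) • F := by
  rw [calTInv_apply, smul_inv_smul₀ tc_ne_zero]

/-- `T_1 T_2 ⋯ T_n` on `𝒫_∞^+`. -/
def calTAsc : ℕ → (PInf →ₗ[QTQ] PInf)
  | 0 => LinearMap.id
  | n + 1 => calTAsc n ∘ₗ calT n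

/-- `T_n ⋯ T_2 T_1` on `𝒫_∞^+`. -/
def calTDesc : ℕ → (PInf →ₗ[QTQ] PInf)
  | 0 => LinearMap.id
  | n + 1 => calT n ∘ₗ calTDesc n

/-- `T_n⁻¹ ⋯ T_2⁻¹ T_1⁻¹` on `𝒫_∞^+`. -/
def calTInvDesc : ℕ → (PInf →ₗ[QTQ] PInf)
  | 0 => LinearMap.id
  | n + 1 => calTInv n ∘ₗ calTInvDesc n

theorem calTAsc_succ (n : ℕ) (F : PInf) : calTAsc (n + 1) F = calTAsc n (calT n F) := rfl
theorem calTDesc_succ (n : ℕ) (F : PInf) : calTDesc (n + 1) F = calT n (calTDesc n F) := rfl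
theorem calTInvDesc_succ (n : ℕ) (F : PInf) :
    calTInvDesc (n + 1) F = calTInv n (calTInvDesc n F) := rfl

theorem calTInvDesc_calTAsc (n : ℕ) (F : PInf) : calTInvDesc n (calTAsc n F) = F := by
  induction n generalizing F with
  | zero => rfl
  | succ n ih => rw [calTAsc_succ, calTInvDesc_succ, ih, calTInv_calT]

theorem calTAsc_calTInvDesc (n : ℕ) (F : PInf) : calTAsc n (calTInvDesc n F) = F := by
  induction n generalizing F with
  | zero => rfl
  | succ n ih => rw [calTAsc_succ, calTInvDesc_succ, calT_calTInv, ih]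

theorem calTAsc_mul {n : ℕ} {c : PInf} (hc : ∀ i, i < n → swapInf i c = c) (F : PInf) :
    calTAsc n (c * F) = c * calTAsc n F := by
  induction n generalizing F with
  | zero => rfl
  | succ n ih =>
    rw [calTAsc_succ, calT_mul_of_swapInf (hc n (by omega)), ih fun i hi => hc i (by omega)]
    rfl

theorem calTAsc_xInf_mul {n j : ℕ} (h : n < j) (F : PInf) :
    calTAsc n (xInf j * F) = xInf j * calTAsc n F :=
  calTAsc_mul (fun i hi => swapInf_xInf_of_ne (by omega) (by omega)) F

theorem calTAsc_calT_of_lt {n i : ℕ} (h : n < i) (F : PInf) :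
    calTAsc n (calT i F) = calT i (calTAsc n F) := by
  induction n generalizing F with
  | zero => rfl
  | succ n ih => rw [calTAsc_succ, calT_comm (Or.inl (by omega)), ih (by omega), calTAsc_succ]

theorem calTAsc_calT {n i : ℕ} (h : i + 1 < n) (F : PInf) :
    calTAsc n (calT i F) = calT (i + 1) (calTAsc n F) := by
  induction n generalizing F with
  | zero => omega
  | succ n ih =>
    rw [calTAsc_succ, calTAsc_succ]
    rcases Nat.lt_or_ge (i + 1) n with hi | hi
    · rw [calT_comm (Or.inr hi), ih hi]
    · obtain rfl : n = i + 1 := by omega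
      rw [calTAsc_succ, calTAsc_succ, calT_braid, calTAsc_calT_of_lt (Nat.lt_succ_self i)]

theorem calT_calTAsc_calTAsc (k : ℕ) (F : PInf) :
    calT 0 (calTAsc (k + 1) (calTAsc k F)) = calTAsc (k + 1) (calTAsc k (calT k F)) := by
  induction k generalizing F with
  | zero => rfl
  | succ k ih =>
    have hc : ∀ G, calT (k + 1) (calTAsc k G) = calTAsc k (calT (k + 1) G) :=
      fun G => (calTAsc_calT_of_lt (Nat.lt_succ_self k) G).symm
    rw [calTAsc_succ (k + 1), calTAsc_succ (k + 1), calTAsc_succ k F,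
      calTAsc_succ k (calT (k + 1) F), hc, hc, ih, calT_braid]

theorem calTAsc_xInf_calTDesc (n : ℕ) (F : PInf) :
    calTAsc n (xInf n * calTDesc n F) = tc ^ n • (xInf 0 * F) := by
  induction n generalizing F with
  | zero => simp [calTAsc, calTDesc]
  | succ n ih =>
    rw [calTAsc_succ, calTDesc_succ, calT_xInf_succ_mul, calT_quad]
    have : (1 - tc) • calT n (calTDesc n F) + tc • calTDesc n F +
        (tc - 1) • calT n (calTDesc n F) = tc • calTDesc n F := by module
    rw [this, mul_smul_comm, map_smul, ih, smul_smul, pow_succ']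

/-! ### The spaces `𝒫(k)^+` -/

theorem mem_PSym_iff {k : ℕ} {F : PInf} : F ∈ PSym k ↔ ∀ i, k ≤ i → swapInf i F = F :=
  forall₂_congr fun i _ => calT_eq_self_iff_swapInf i F

theorem swapInf_of_mem {k i : ℕ} {F : PInf} (hF : F ∈ PSym k) (hi : k ≤ i) : swapInf i F = F :=
  mem_PSym_iff.mp hF i hi

theorem calT_of_mem {k i : ℕ} {F : PInf} (hF : F ∈ PSym k) (hi : k ≤ i) : calT i F = F := hF i hi

theorem PSym_mono {k l : ℕ} (h : k ≤ l) : PSym k ≤ PSym l :=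
  fun _ hF i hi => hF i (h.trans hi)

theorem mem_PSym_succ {k : ℕ} {F : PInf} (hF : F ∈ PSym k) : F ∈ PSym (k + 1) := PSym_le_succ k hF

theorem xInf_mem {j k : ℕ} (h : j < k) : xInf j ∈ PSym k :=
  mem_PSym_iff.mpr fun i hi => swapInf_xInf_of_ne (by omega) (by omega)

theorem calT_mem {i k : ℕ} (h : i + 1 < k) {F : PInf} (hF : F ∈ PSym k) : calT i F ∈ PSym k :=
  fun j hj => by rw [calT_comm (Or.inr (by omega)), hF j hj]

theorem calTInv_mem {i k : ℕ} (h : i + 1 < k) {F : PInf} (hF : F ∈ PSym k) :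
    calTInv i F ∈ PSym k :=
  (PSym k).smul_mem ((PSym k).add_mem (calT_mem h hF) ((PSym k).smul_mem hF _)) _

theorem calTAsc_mem {n k : ℕ} (h : n < k) {F : PInf} (hF : F ∈ PSym k) :
    calTAsc n F ∈ PSym k := by
  induction n generalizing F with
  | zero => exact hF
  | succ n ih => exact ih (by omega) (calT_mem h hF)

theorem calTInvDesc_mem {n k : ℕ} (h : n < k) {F : PInf} (hF : F ∈ PSym k) :
    calTInvDesc n F ∈ PSym k := by
  induction n with
  | zero => exact hF
  | succ n ih => exact calTInv_mem h (ih (by omega))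

/-! ### The cyclic shift -/

/-- The images of the variables under `ω_k⁻¹`. -/
def omegaVar (k j : ℕ) : Poly :=
  if j + 1 < k then X (j + 1) else if j + 1 = k then qc • X 0 else X j

theorem omegaVar_of_lt {k j : ℕ} (h : j + 1 < k) : omegaVar k j = X (j + 1) := if_pos h

theorem omegaVar_last (k : ℕ) : omegaVar (k + 1) k = qc • X 0 := by simp [omegaVar]

theorem omegaVar_of_le {k j : ℕ} (h : k ≤ j) : omegaVar k j = X j := by
  rw [omegaVar, if_neg (by omega), if_neg (by omega)]

theorem admissible_omegaVar (k : ℕ) : Admissible (omegaVar k) :=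
  admissible_of_eventually_X k
    (fun j => by
      rw [omegaVar]
      split_ifs
      exacts [(totalDegree_X _).le, (totalDegree_smul_le _ _).trans (totalDegree_X _).le,
        (totalDegree_X _).le])
    fun j hj => ⟨j, Nat.le_add_right _ _, omegaVar_of_le hj⟩

/-- The substitution `ω_k⁻¹ : (x_1, …, x_k) ↦ (x_2, …, x_k, q x_1)` on `𝒫_∞^+`. -/
def omegaInf (k : ℕ) : PInf →ₐ[QTQ] PInf := subst _ (admissible_omegaVar k)

theorem proj_omegaInf {k m : ℕ} (h : k ≤ m) (F : PInf) :
    proj (omegaInf k F) m = omegaInv k (proj F m) := by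
  rw [omegaInf, proj_subst_self]
  · rfl
  · intro j hj
    rw [omegaVar_of_le (h.trans hj), trunc_X_of_le hj]
  · intro j hj
    rw [omegaVar]
    split_ifs
    · exact trunc_X_of_lt (by omega)
    · rw [map_smul, trunc_X_of_lt (by omega)]
    · exact trunc_X_of_lt hj

theorem omegaInf_xInf_of_lt {j k : ℕ} (h : j + 1 < k) :
    omegaInf k (xInf j) = xInf (j + 1) := by
  rw [omegaInf, subst_xInf, omegaVar_of_lt h, xInf]

theorem omegaInf_xInf_last (k : ℕ) : omegaInf (k + 1) (xInf k) = qc • xInf 0 := by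
  rw [omegaInf, subst_xInf, omegaVar_last]
  exact map_smul ofPolyHom _ _

theorem swapInf_omegaInf_of_le {k i : ℕ} (h : k ≤ i) (F : PInf) :
    swapInf i (omegaInf k F) = omegaInf k (swapInf i F) := by
  refine subst_subst_comm _ _ _ _ (fun j => ?_) F
  simp only [omegaVar, aeval_X, Equiv.swap_apply_def]
  split_ifs <;> simp <;> grind

theorem omegaInf_swapInf {k i : ℕ} (h : i + 2 < k) (F : PInf) :
    omegaInf k (swapInf i F) = swapInf (i + 1) (omegaInf k F) := by
  refine subst_subst_comm _ _ _ _ (fun j => ?_) F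
  simp only [omegaVar, aeval_X, Equiv.swap_apply_def]
  split_ifs <;> simp <;> grind

theorem omegaInf_succ_eq (k : ℕ) (F : PInf) :
    omegaInf (k + 2) F = omegaInf (k + 1) (swapInf k F) := by
  rw [omegaInf, omegaInf, swapInf, subst_subst _ _ (admissible_omegaVar (k + 2)) fun j => ?_]
  simp only [omegaVar, aeval_X, Equiv.swap_apply_def]
  grind

theorem aeval_omegaVar_omegaVar (k j : ℕ) :
    aeval (omegaVar (k + 2)) (omegaVar (k + 1) j) =
      if j < k then X (j + 2) else if j = k then qc • X 1 else if j = k + 1 then qc • X 0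
      else X j := by
  rcases lt_trichotomy j k with h | rfl | h
  · rw [omegaVar_of_lt (by omega), aeval_X, omegaVar_of_lt (by omega), if_pos h]
  · rw [omegaVar_last, map_smul, aeval_X, omegaVar_of_lt (by omega), if_neg (lt_irrefl _),
      if_pos rfl]
  · rw [omegaVar_of_le (by omega), aeval_X, if_neg (by omega), if_neg (by omega), omegaVar]
    grind

theorem swapInf_omegaInf_omegaInf (k : ℕ) (F : PInf) :
    swapInf 0 (omegaInf (k + 2) (omegaInf (k + 1) F)) =
      omegaInf (k + 2) (omegaInf (k + 1) (swapInf k F)) := by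
  have hcomp := (admissible_omegaVar (k + 2)).comp (admissible_omegaVar (k + 1))
  have homega₂ : ∀ F, omegaInf (k + 2) (omegaInf (k + 1) F) = subst _ hcomp F :=
    fun F => subst_subst _ _ hcomp (fun _ => rfl) F
  rw [homega₂, homega₂]
  refine subst_subst_comm _ _ _ _ (fun j => ?_) F
  simp only [aeval_omegaVar_omegaVar, aeval_X, Equiv.swap_apply_def]
  split_ifs <;> simp <;> grind

theorem omegaInf_mem {k : ℕ} {F : PInf} (hF : F ∈ PSym k) : omegaInf k F ∈ PSym k :=
  mem_PSym_iff.mpr fun i hi => by rw [swapInf_omegaInf_of_le hi, swapInf_of_mem hF hi]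

theorem omegaInf_succ_mem {k : ℕ} {F : PInf} (hF : F ∈ PSym k) :
    omegaInf (k + 1) F ∈ PSym (k + 1) :=
  omegaInf_mem (mem_PSym_succ hF)

theorem omegaInf_add_two_eq {k : ℕ} {F : PInf} (hF : F ∈ PSym k) :
    omegaInf (k + 2) F = omegaInf (k + 1) F := by
  rw [omegaInf_succ_eq, swapInf_of_mem hF le_rfl]

theorem omegaInf_eq_of_le {k m : ℕ} (h : k + 1 ≤ m) {F : PInf} (hF : F ∈ PSym k) :
    omegaInf m F = omegaInf (k + 1) F := by
  induction m, h using Nat.le_induction with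
  | base => rfl
  | succ m hm ih =>
    obtain ⟨n, rfl⟩ : ∃ n, m = n + 1 := ⟨m - 1, by omega⟩
    rw [omegaInf_add_two_eq (PSym_mono (by omega) hF), ih]

theorem omegaInf_calT {k i : ℕ} (h : i + 2 < k) (F : PInf) :
    omegaInf k (calT i F) = calT (i + 1) (omegaInf k F) := by
  apply eq_calT
  have := congrArg (omegaInf k) (calT_spec i F)
  simpa only [map_mul, map_sub, map_add, map_smul, omegaInf_xInf_of_lt (show i + 1 < k by omega),
    omegaInf_xInf_of_lt (show i + 1 + 1 < k by omega), omegaInf_swapInf h] using this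

/-! ### `𝒫(k+1)^+` is a polynomial ring over `𝒫(k)^+` -/

/-- `F` has degree at most `d`. -/
def HasDegreeLE (d : ℕ) (F : PInf) : Prop := ∀ m, (proj F m).totalDegree ≤ d

theorem exists_hasDegreeLE (F : PInf) : ∃ d, HasDegreeLE d F := F.2.2

theorem HasDegreeLE.of_forall_ge {d : ℕ} (N : ℕ) {F : PInf}
    (h : ∀ m, N ≤ m → (proj F m).totalDegree ≤ d) : HasDegreeLE d F := fun m => by
  rw [← trunc_proj F (le_max_left m N)]
  exact (totalDegree_trunc_le _ _).trans (h _ (le_max_right m N))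

theorem HasDegreeLE.sub {d : ℕ} {F G : PInf} (hF : HasDegreeLE d F) (hG : HasDegreeLE d G) :
    HasDegreeLE d (F - G) := fun m => by
  rw [proj_sub]
  exact (totalDegree_sub _ _).trans (max_le (hF m) (hG m))

theorem HasDegreeLE.subst {φ : ℕ → Poly} (h : Admissible φ) {d : ℕ} {F : PInf}
    (hF : HasDegreeLE d F) : HasDegreeLE d (subst φ h F) := fun _ =>
  (totalDegree_trunc_le _ _).trans ((totalDegree_aeval_le h.totalDegree_le _).trans (hF _))

theorem xInf_ne_zero (k : ℕ) : xInf k ≠ 0 := fun h => by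
  have hproj := congrArg (fun F => proj F (k + 1)) h
  beta_reduce at hproj
  rw [proj_xInf_of_lt (by omega)] at hproj
  exact X_ne_zero k hproj

theorem totalDegree_X_mul {σ R : Type*} [CommRing R] [IsDomain R] (i : σ)
    {f : MvPolynomial σ R} (hf : f ≠ 0) : (X i * f).totalDegree = f.totalDegree + 1 := by
  rw [totalDegree_mul_of_isDomain (X_ne_zero i) hf, totalDegree_X, add_comm]

theorem HasDegreeLE.of_xInf_mul {k d : ℕ} {F : PInf} (h : HasDegreeLE (d + 1) (xInf k * F)) :
    HasDegreeLE d F :=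
  HasDegreeLE.of_forall_ge (k + 1) fun m hm => by
    by_cases hF : proj F m = 0
    · simp [hF]
    · have hdeg := h m
      rw [proj_mul, proj_xInf_of_lt (by omega), totalDegree_X_mul k hF] at hdeg
      omega

theorem HasDegreeLE.eq_zero_of_xInf_mul {k : ℕ} {F : PInf} (h : HasDegreeLE 0 (xInf k * F)) :
    F = 0 :=
  PInf.ext_of_le (k + 1) fun m hm => by
    by_contra hF
    have hdeg := h m
    rw [proj_mul, proj_xInf_of_lt (by omega), totalDegree_X_mul k hF] at hdeg
    omega

/-- The images of the variables under the substitution `contract k`. -/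
def contractVar (k j : ℕ) : Poly := if j < k then X j else if j = k then 0 else X (j - 1)

theorem contractVar_of_lt {j k : ℕ} (h : j < k) : contractVar k j = X j := if_pos h

theorem contractVar_of_gt {j k : ℕ} (h : k < j) : contractVar k j = X (j - 1) := by
  rw [contractVar, if_neg (by omega), if_neg (by omega)]

theorem admissible_contractVar (k : ℕ) : Admissible (contractVar k) :=
  admissible_of_eventually_X (k + 1)
    (fun j => by rw [contractVar]; split_ifs <;> simp)
    fun j hj => ⟨j - 1, by omega, contractVar_of_gt (by omega)⟩

/-- The substitution `F ↦ F(x_1, …, x_k, 0, x_{k+1}, x_{k+2}, …)`. -/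
def contract (k : ℕ) : PInf →ₐ[QTQ] PInf := subst _ (admissible_contractVar k)

theorem swapInf_contract {k i : ℕ} (h : k ≤ i) (F : PInf) :
    swapInf i (contract k F) = contract k (swapInf (i + 1) F) := by
  refine subst_subst_comm _ _ _ _ (fun j => ?_) F
  simp only [contractVar, aeval_X, Equiv.swap_apply_def]
  split_ifs <;> simp <;> grind

theorem contract_mem {k : ℕ} {F : PInf} (hF : F ∈ PSym (k + 1)) : contract k F ∈ PSym k :=
  mem_PSym_iff.mpr fun i hi => by rw [swapInf_contract hi, swapInf_of_mem hF (by omega)]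

theorem contract_succ_swapInf (k : ℕ) (F : PInf) :
    contract (k + 1) (swapInf k F) = contract k F := by
  rw [contract, contract, swapInf, subst_subst _ _ (admissible_contractVar k) fun j => ?_]
  simp only [contractVar, aeval_X, Equiv.swap_apply_def]
  grind

theorem contract_add_of_mem {k : ℕ} {F : PInf} (hF : F ∈ PSym k) (n : ℕ) :
    contract (k + n) F = contract k F := by
  induction n with
  | zero => rfl
  | succ n ih =>
    have hswap := contract_succ_swapInf (k + n) F
    rw [swapInf_of_mem hF (by omega)] at hswap
    exact hswap.trans ih

theorem proj_contract_of_le {k m : ℕ} (h : m ≤ k) (F : PInf) :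
    proj (contract k F) m = proj F m := by
  have htail : ∀ j, m ≤ j → trunc m (contractVar k j) = 0 := by
    intro j hj
    rw [contractVar]
    split_ifs
    · exact trunc_X_of_le hj
    · exact map_zero _
    · exact trunc_X_of_le (by omega)
  have htrunc : ((trunc m).comp (aeval (contractVar k))).comp (trunc m) = trunc m := by
    refine MvPolynomial.algHom_ext fun j => ?_
    simp only [AlgHom.comp_apply]
    by_cases hj : j < m
    · rw [trunc_X_of_lt hj, aeval_X, contractVar_of_lt (by omega), trunc_X_of_lt hj]
    · rw [trunc_X_of_le (by omega), map_zero, map_zero]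
  rw [contract, proj_subst _ htail, ← trunc_proj F le_rfl]
  exact DFunLike.congr_fun htrunc (proj F m)

theorem contract_of_mem {k : ℕ} {F : PInf} (hF : F ∈ PSym k) : contract k F = F :=
  PInf.ext fun m => by
    rw [← contract_add_of_mem hF m, proj_contract_of_le (Nat.le_add_left m k)]

theorem admissible_update_X_zero (k : ℕ) : Admissible (Function.update X k 0) :=
  admissible_of_eventually_X (k + 1)
    (fun j => by rw [Function.update_apply]; split_ifs <;> simp)
    fun j hj => ⟨j, by omega, Function.update_of_ne (by omega) _ _⟩

/-- The substitution `x_{k+1} ↦ 0`. -/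
def substZero (k : ℕ) : PInf →ₐ[QTQ] PInf := subst _ (admissible_update_X_zero k)

theorem proj_substZero (k m : ℕ) (F : PInf) :
    proj (substZero k F) m = aeval (Function.update X k 0) (proj F m) := by
  rw [substZero, proj_subst_self]
  all_goals
    intro j hj
    rw [Function.update_apply]
    split_ifs
  exacts [map_zero _, trunc_X_of_le hj, map_zero _, trunc_X_of_lt hj]

theorem substZero_contract {k : ℕ} {F : PInf} (hF : F ∈ PSym (k + 1)) :
    substZero k (contract k F) = substZero k F := by
  conv_rhs => rw [← contract_of_mem hF]
  refine subst_subst_comm _ _ _ _ (fun j => ?_) F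
  simp only [contractVar]
  split_ifs <;> simp [Function.update_apply] <;> grind

theorem X_dvd_sub_aeval_update_zero {σ R : Type*} [CommRing R] [DecidableEq σ] (k : σ)
    (f : MvPolynomial σ R) : X k ∣ f - aeval (Function.update X k 0) f := by
  rw [← Ideal.mem_span_singleton, ← Ideal.Quotient.eq]
  have hmk : Ideal.Quotient.mkₐ R (Ideal.span {(X k : MvPolynomial σ R)}) =
      (Ideal.Quotient.mkₐ R (Ideal.span {(X k : MvPolynomial σ R)})).comp
        (aeval (Function.update X k 0)) := by
    refine MvPolynomial.algHom_ext fun j => ?_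
    rw [AlgHom.comp_apply, aeval_X, Function.update_apply]
    split_ifs with hj
    · rw [map_zero, hj]
      exact Ideal.Quotient.eq_zero_iff_mem.mpr (Ideal.mem_span_singleton_self _)
    · rfl
  exact DFunLike.congr_fun hmk f

theorem exists_eq_xInf_mul {k : ℕ} {G : PInf} (hG : substZero k G = 0) :
    ∃ H, G = xInf k * H := by
  have hdvd : ∀ m, ∃ f, proj G (m + k + 1) = X k * f := by
    intro m
    have hsub := X_dvd_sub_aeval_update_zero k (proj G (m + k + 1))
    rwa [← proj_substZero, hG, proj_zero, sub_zero] at hsub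
  choose f hf using hdvd
  have htrunc : ∀ m, trunc (m + k + 1) (f (m + 1)) = f m := by
    intro m
    apply mul_left_cancel₀ (X_ne_zero (R := QTQ) k)
    rw [← hf m, ← trunc_proj G (show m + k + 1 ≤ m + 1 + k + 1 by omega), hf (m + 1), map_mul,
      trunc_X_of_lt (by omega)]
  obtain ⟨d, hd⟩ := exists_hasDegreeLE G
  have hdeg : ∀ m, (f m).totalDegree ≤ d := by
    intro m
    by_cases hfm : f m = 0
    · simp [hfm]
    · have hle := hd (m + k + 1)
      rw [hf m, totalDegree_X_mul k hfm] at hle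
      omega
  let H : PInf := ⟨fun m => trunc m (f m), fun m => by
    beta_reduce
    rw [trunc_trunc, min_eq_left (Nat.le_succ m), ← htrunc m, trunc_trunc,
      min_eq_left (by omega)], d, fun m => (totalDegree_trunc_le _ _).trans (hdeg m)⟩
  refine ⟨H, PInf.ext fun m => ?_⟩
  rw [← trunc_proj G (show m ≤ m + k + 1 by omega), hf m, map_mul, proj_mul]
  rfl

theorem exists_eq_contract_add_xInf_mul {k : ℕ} {F : PInf} (hF : F ∈ PSym (k + 1)) :
    ∃ G ∈ PSym (k + 1), F = contract k F + xInf k * G := by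
  obtain ⟨G, hG⟩ : ∃ G, F - contract k F = xInf k * G :=
    exists_eq_xInf_mul (by rw [map_sub, substZero_contract hF, sub_self])
  refine ⟨G, mem_PSym_iff.mpr fun i hi => mul_left_cancel₀ (xInf_ne_zero k) ?_, by rw [← hG]; ring⟩
  have hswap : swapInf i (xInf k) = xInf k := swapInf_xInf_of_ne (by omega) (by omega)
  conv_lhs => rw [← hswap, ← map_mul, ← hG]
  rw [map_sub, swapInf_of_mem hF hi, swapInf_of_mem (contract_mem hF) (by omega), hG]

theorem PSym_induction {k : ℕ} {p : PInf → Prop} (base : ∀ c ∈ PSym k, p c)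
    (add : ∀ F ∈ PSym (k + 1), ∀ G ∈ PSym (k + 1), p F → p G → p (F + G))
    (step : ∀ F ∈ PSym (k + 1), p F → p (xInf k * F)) {F : PInf} (hF : F ∈ PSym (k + 1)) :
    p F := by
  obtain ⟨d, hd⟩ := exists_hasDegreeLE F
  induction d generalizing F with
  | zero =>
    obtain ⟨G, -, hFG⟩ := exists_eq_contract_add_xInf_mul hF
    have hxG : HasDegreeLE 0 (xInf k * G) := by
      rw [← sub_eq_iff_eq_add'.mpr hFG]
      exact hd.sub (hd.subst _)
    rw [hFG, hxG.eq_zero_of_xInf_mul, mul_zero, add_zero]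
    exact base _ (contract_mem hF)
  | succ d ih =>
    obtain ⟨G, hG, hFG⟩ := exists_eq_contract_add_xInf_mul hF
    have hxG : HasDegreeLE (d + 1) (xInf k * G) := by
      rw [← sub_eq_iff_eq_add'.mpr hFG]
      exact hd.sub (hd.subst _)
    have hconst := contract_mem hF
    rw [hFG]
    exact add _ (mem_PSym_succ hconst) _ (mul_mem (xInf_mem (Nat.lt_succ_self k)) hG)
      (base _ hconst) (step _ hG (ih hG hxG.of_xInf_mul))

/-- Evaluation of polynomials over `𝒫(k)^+` at `x_{k+1}`. -/
def evalLast (k : ℕ) : Polynomial (PSym k) →ₗ[QTQ] PInf :=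
  ((Polynomial.aeval (xInf k) : Polynomial (PSym k) →ₐ[PSym k] PInf).restrictScalars
    QTQ).toLinearMap

theorem evalLast_apply (k : ℕ) (f : Polynomial (PSym k)) :
    evalLast k f = Polynomial.eval₂ (PSym k).val.toRingHom (xInf k) f := rfl

/-- A root `x_{k+1}` of a polynomial with coefficients in `𝒫(k)^+` yields by symmetry the infinitely
many roots `x_{k+1}, x_{k+2}, …`. -/
theorem evalLast_injective (k : ℕ) : Function.Injective (evalLast k) := by
  rw [← LinearMap.ker_eq_bot, LinearMap.ker_eq_bot']
  intro f hf
  rw [evalLast_apply] at hf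
  have hroot : ∀ n, Polynomial.eval₂ (PSym k).val.toRingHom (xInf (k + n)) f = 0 := by
    intro n
    induction n with
    | zero => exact hf
    | succ n ih =>
      have hfix : (swapInf (k + n)).toRingHom.comp (PSym k).val.toRingHom =
          (PSym k).val.toRingHom :=
        RingHom.ext fun c => swapInf_of_mem c.2 (by omega)
      have hswap := congrArg (swapInf (k + n)).toRingHom ih
      rw [Polynomial.hom_eval₂, map_zero, hfix] at hswap
      rw [← hswap]
      congr 1
      exact (swapInf_xInf_left (k + n)).symm
  have hmap : f.map (PSym k).val.toRingHom = 0 := by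
    apply Polynomial.eq_zero_of_infinite_isRoot
    refine Set.infinite_of_injective_forall_mem (f := fun n => xInf (k + n))
      (fun a b h => by have := xInf_injective h; omega) fun n => ?_
    rw [Set.mem_ofPred_eq, Polynomial.IsRoot, Polynomial.eval_map]
    exact hroot n
  exact (Polynomial.map_eq_zero_iff (f := (PSym k).val.toRingHom) Subtype.val_injective).mp hmap

/-! ### The symmetric functions `Q_n` -/

theorem one_sub_C_mul_X_mul_mk_pow {R : Type*} [CommRing R] (a : R) :
    (1 - PowerSeries.C a * PowerSeries.X) * PowerSeries.mk (fun n => a ^ n) = 1 := by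
  have hgeom := congrArg (PowerSeries.rescale a) (PowerSeries.mk_one_mul_one_sub_eq_one R)
  rw [map_mul, PowerSeries.rescale_mk, map_sub, map_one, PowerSeries.rescale_X, mul_comm] at hgeom
  simpa only [Pi.one_apply, mul_one] using hgeom

theorem one_sub_C_mul_X_mul_mk_ite {R : Type*} [CommRing R] (t a : R) :
    (1 - PowerSeries.C a * PowerSeries.X) *
        PowerSeries.mk (fun n => if n = 0 then 1 else (1 - t) * a ^ n) =
      1 - PowerSeries.C (t * a) * PowerSeries.X := by
  have hmk : PowerSeries.mk (fun n => if n = 0 then 1 else (1 - t) * a ^ n) =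
      PowerSeries.C t + PowerSeries.C (1 - t) * PowerSeries.mk (fun n => a ^ n) := by
    ext1 n
    rw [map_add, PowerSeries.coeff_C_mul, PowerSeries.coeff_C, PowerSeries.coeff_mk,
      PowerSeries.coeff_mk]
    split_ifs with h
    · rw [h, pow_zero]
      ring
    · ring
  rw [hmk]
  simp only [map_sub, map_mul, map_one]
  linear_combination (1 - PowerSeries.C t) * one_sub_C_mul_X_mul_mk_pow a

/-- The power series `(1 - t x u) / (1 - x u)` in `u`, for the variable `x = x_{i+1}`. -/
def hlQFactor (i : ℕ) : PowerSeries Poly :=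
  PowerSeries.mk fun n => if n = 0 then 1 else (1 - tc) • X i ^ n

/-- The product of the series `(1 - t x_{i+1} u) / (1 - x_{i+1} u)` over `k ≤ i < m`. -/
def hlQSeries (k m : ℕ) : PowerSeries Poly := ∏ i ∈ Finset.Ico k m, hlQFactor i

theorem hlQFactor_spec (i : ℕ) :
    (1 - PowerSeries.C (X i) * PowerSeries.X) * hlQFactor i =
      1 - PowerSeries.C (C tc * X i) * PowerSeries.X := by
  rw [← one_sub_C_mul_X_mul_mk_ite (C tc : Poly) (X i)]
  simp only [hlQFactor, smul_eq_C_mul, map_sub, map_one]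

theorem map_hlQFactor (φ : Poly →ₐ[QTQ] Poly) {i j : ℕ} (h : φ (X i) = X j) :
    PowerSeries.map φ.toRingHom (hlQFactor i) = hlQFactor j := by
  ext1 n
  rw [PowerSeries.coeff_map, hlQFactor, hlQFactor, PowerSeries.coeff_mk, PowerSeries.coeff_mk]
  split_ifs
  · exact map_one _
  · change φ _ = _
    rw [map_smul, map_pow, h]

theorem map_hlQFactor_eq_one (φ : Poly →ₐ[QTQ] Poly) {i : ℕ} (h : φ (X i) = 0) :
    PowerSeries.map φ.toRingHom (hlQFactor i) = 1 := by
  ext1 n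
  rw [PowerSeries.coeff_map, hlQFactor, PowerSeries.coeff_mk, PowerSeries.coeff_one]
  split_ifs with hn
  · exact map_one _
  · change φ _ = _
    rw [map_smul, map_pow, h, zero_pow hn, smul_zero]

theorem totalDegree_coeff_hlQSeries_le (k m n : ℕ) :
    (PowerSeries.coeff n (hlQSeries k m)).totalDegree ≤ n := by
  rw [hlQSeries]
  induction Finset.Ico k m using Finset.induction_on generalizing n with
  | empty =>
    rw [Finset.prod_empty, PowerSeries.coeff_one]
    split_ifs <;> simp
  | insert i s hi ih =>
    rw [Finset.prod_insert hi, PowerSeries.coeff_mul]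
    refine (totalDegree_finsetSum _ _).trans (Finset.sup_le fun p hp => ?_)
    rw [Finset.HasAntidiagonal.mem_antidiagonal] at hp
    refine (totalDegree_mul _ _).trans ?_
    have hprod := ih p.2
    have hfactor : (PowerSeries.coeff p.1 (hlQFactor i)).totalDegree ≤ p.1 := by
      rw [hlQFactor, PowerSeries.coeff_mk]
      split_ifs
      · simp
      · exact (totalDegree_smul_le _ _).trans (totalDegree_X_pow _ _).le
    omega

/-- The symmetric function `Q_n[x_{k+1} + x_{k+2} + ⋯]`, where
`∑ Q_n u^n = ∏ (1 - t x u) / (1 - x u)`. -/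
def hlQ (k n : ℕ) : PInf :=
  ⟨fun m => PowerSeries.coeff n (hlQSeries k m), fun m => by
    beta_reduce
    change (trunc m).toRingHom _ = _
    rw [← PowerSeries.coeff_map, hlQSeries, hlQSeries, map_prod]
    rcases Nat.lt_or_ge m k with h | h
    · rw [Finset.Ico_eq_empty (by omega), Finset.Ico_eq_empty (by omega)]
      simp
    · rw [Finset.prod_Ico_succ_top h, map_hlQFactor_eq_one _ (trunc_X_of_le le_rfl), mul_one]
      congr 1
      refine Finset.prod_congr rfl fun i hi => map_hlQFactor _ (trunc_X_of_lt ?_)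
      exact (Finset.mem_Ico.mp hi).2, n, fun m => totalDegree_coeff_hlQSeries_le k m n⟩

theorem proj_hlQ (k n m : ℕ) : proj (hlQ k n) m = PowerSeries.coeff n (hlQSeries k m) := rfl

theorem hlQ_zero (k : ℕ) : hlQ k 0 = 1 := by
  refine PInf.ext fun m => ?_
  rw [proj_hlQ, hlQSeries, PowerSeries.coeff_zero_eq_constantCoeff_apply, map_prod, proj_one]
  refine Finset.prod_eq_one fun i _ => ?_
  rw [← PowerSeries.coeff_zero_eq_constantCoeff_apply, hlQFactor, PowerSeries.coeff_mk, if_pos rfl]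

theorem hlQ_succ_sub (k n : ℕ) :
    hlQ k (n + 1) - xInf k * hlQ k n = hlQ (k + 1) (n + 1) - tc • (xInf k * hlQ (k + 1) n) := by
  apply PInf.ext_of_le (k + 1)
  intro m hm
  simp only [proj_sub, proj_mul, proj_smul, proj_xInf_of_lt (show k < m by omega), proj_hlQ]
  have hseries : (1 - PowerSeries.C (X k) * PowerSeries.X) * hlQSeries k m =
      (1 - PowerSeries.C (C tc * X k) * PowerSeries.X) * hlQSeries (k + 1) m := by
    rw [hlQSeries, Finset.prod_eq_prod_Ico_succ_bot (by omega), ← mul_assoc, hlQFactor_spec]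
    rfl
  have hcoeff := congrArg (PowerSeries.coeff (n + 1)) hseries
  simp only [sub_mul, one_mul, mul_assoc, map_sub, PowerSeries.coeff_C_mul,
    PowerSeries.coeff_succ_X_mul] at hcoeff
  rw [hcoeff, smul_eq_C_mul]

theorem hlQ_mem (k n : ℕ) : hlQ k n ∈ PSym k := by
  refine mem_PSym_iff.mpr fun i hi => PInf.ext_of_le (i + 2) fun m hm => ?_
  rw [proj_swapInf (by omega), proj_hlQ]
  change (swapVar i).toRingHom _ = _
  rw [← PowerSeries.coeff_map, hlQSeries, map_prod]
  congr 1
  refine Finset.prod_equiv (Equiv.swap i (i + 1)) (fun j => ?_) fun j _ => ?_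
  · simp only [Finset.mem_Ico, Equiv.swap_apply_def]
    grind
  · exact map_hlQFactor _ (by rw [swapVar, rename_X])

theorem swapInf_hlQ_of_lt {i k : ℕ} (h : i + 1 < k) (n : ℕ) : swapInf i (hlQ k n) = hlQ k n := by
  refine PInf.ext_of_le (i + 2) fun m hm => ?_
  rw [proj_swapInf (by omega), proj_hlQ]
  change (swapVar i).toRingHom _ = _
  rw [← PowerSeries.coeff_map, hlQSeries, map_prod]
  congr 1
  refine Finset.prod_congr rfl fun j hj => map_hlQFactor _ ?_
  have := (Finset.mem_Ico.mp hj).1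
  rw [swapVar, rename_X, Equiv.swap_apply_of_ne_of_ne (by omega) (by omega)]

theorem proj_hlQ_self (m n : ℕ) (hn : n ≠ 0) : proj (hlQ m n) m = 0 := by
  rw [proj_hlQ, hlQSeries, Finset.Ico_self, Finset.prod_empty, PowerSeries.coeff_one, if_neg hn]

theorem proj_hlQ_succ (m n : ℕ) (hn : n ≠ 0) :
    proj (hlQ m n) (m + 1) = (1 - tc) • X m ^ n := by
  rw [proj_hlQ, hlQSeries, Nat.Ico_succ_singleton, Finset.prod_singleton, hlQFactor,
    PowerSeries.coeff_mk, if_neg hn]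

/-! ### The operators `∂^-` -/

/-- The `𝒫(k)^+`-linear map `x_{k+1}^n ↦ Q_n[x_{k+1} + x_{k+2} + ⋯]`. -/
def evalHLQ (k : ℕ) : Polynomial (PSym k) →ₗ[QTQ] PInf where
  toFun f := f.sum fun n c => c.1 * hlQ k n
  map_add' f g := Polynomial.sum_add_index _ _ _ (fun _ => zero_mul _) fun _ _ _ => add_mul _ _ _
  map_smul' r f := by
    rw [Polynomial.sum_smul_index' _ _ _ (fun _ => zero_mul _), Polynomial.sum_def,
      Polynomial.sum_def, RingHom.id_apply, Finset.smul_sum]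
    exact Finset.sum_congr rfl fun n _ => smul_mul_assoc _ _ _

/-- An operator on `𝒫_∞^+` extending `∂^-_{k+1} : 𝒫(k+1)^+ → 𝒫(k)^+`. -/
def partialMinus (k : ℕ) : PInf →ₗ[QTQ] PInf :=
  evalHLQ k ∘ₗ (LinearMap.exists_leftInverse_of_injective (evalLast k)
    (LinearMap.ker_eq_bot.mpr (evalLast_injective k))).choose

theorem partialMinus_evalLast (k : ℕ) (f : Polynomial (PSym k)) :
    partialMinus k (evalLast k f) = evalHLQ k f := by
  have h := (LinearMap.exists_leftInverse_of_injective (evalLast k)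
    (LinearMap.ker_eq_bot.mpr (evalLast_injective k))).choose_spec
  rw [partialMinus, LinearMap.comp_apply]
  congr 1
  exact congrArg (fun φ => φ f) h

theorem partialMinus_mul_pow {k : ℕ} {c : PInf} (hc : c ∈ PSym k) (n : ℕ) :
    partialMinus k (c * xInf k ^ n) = c * hlQ k n := by
  have h := partialMinus_evalLast k (Polynomial.monomial n (⟨c, hc⟩ : PSym k))
  rw [evalLast_apply, Polynomial.eval₂_monomial] at h
  refine h.trans ?_
  exact Polynomial.sum_monomial_index _ (fun n (c : PSym k) => c.1 * hlQ k n) (zero_mul _)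

theorem partialMinus_of_mem {k : ℕ} {c : PInf} (hc : c ∈ PSym k) : partialMinus k c = c := by
  have := partialMinus_mul_pow hc 0
  rwa [pow_zero, mul_one, hlQ_zero, mul_one] at this

theorem PSym_monomial_induction {k : ℕ} {p : PInf → Prop} (base : ∀ c ∈ PSym k, ∀ n,
    p (c * xInf k ^ n))
    (add : ∀ F ∈ PSym (k + 1), ∀ G ∈ PSym (k + 1), p F → p G → p (F + G))
    {F : PInf} (hF : F ∈ PSym (k + 1)) : p F := by
  suffices h : ∀ n, p (F * xInf k ^ n) by simpa using h 0
  refine PSym_induction (p := fun F => ∀ n, p (F * xInf k ^ n)) base ?_ ?_ hF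
  · intro F hF G hG ihF ihG n
    rw [add_mul]
    have hx : xInf k ^ n ∈ PSym (k + 1) := pow_mem (xInf_mem (Nat.lt_succ_self k)) n
    exact add _ (mul_mem hF hx) _ (mul_mem hG hx) (ihF n) (ihG n)
  · intro F _ h n
    have hstep := h (n + 1)
    rwa [pow_succ', ← mul_assoc, mul_comm F] at hstep

theorem partialMinus_mem {k : ℕ} {F : PInf} (hF : F ∈ PSym (k + 1)) :
    partialMinus k F ∈ PSym k := by
  refine PSym_monomial_induction (p := fun F => partialMinus k F ∈ PSym k) (fun c hc n => ?_)
    (fun F _ G _ ihF ihG => ?_) hF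
  · rw [partialMinus_mul_pow hc]
    exact mul_mem hc (hlQ_mem k n)
  · rw [map_add]
    exact add_mem ihF ihG

theorem partialMinus_mul {k : ℕ} {c F : PInf} (hc : c ∈ PSym k) (hF : F ∈ PSym (k + 1)) :
    partialMinus k (c * F) = c * partialMinus k F := by
  refine PSym_monomial_induction (p := fun F => partialMinus k (c * F) =
    c * partialMinus k F) (fun c' hc' n => ?_)
    (fun F _ G _ ihF ihG => ?_) hF
  · rw [← mul_assoc, partialMinus_mul_pow (mul_mem hc hc'), partialMinus_mul_pow hc', mul_assoc]
  · rw [mul_add, map_add, map_add, ihF, ihG, mul_add]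

theorem partialMinus_calT {k i : ℕ} (h : i + 1 < k) {F : PInf} (hF : F ∈ PSym (k + 1)) :
    partialMinus k (calT i F) = calT i (partialMinus k F) := by
  refine PSym_monomial_induction (p := fun F => partialMinus k (calT i F) =
    calT i (partialMinus k F)) (fun c hc n => ?_)
    (fun F _ G _ ihF ihG => ?_) hF
  · have hx : swapInf i (xInf k ^ n) = xInf k ^ n := by
      rw [map_pow, swapInf_xInf_of_ne (by omega) (by omega)]
    rw [partialMinus_mul_pow hc, mul_comm c, calT_mul_of_swapInf hx, mul_comm,
      partialMinus_mul_pow (calT_mem h hc), mul_comm c, calT_mul_of_swapInf (swapInf_hlQ_of_lt h n),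
      mul_comm]
  · rw [map_add, map_add, map_add, map_add, ihF, ihG]

/-! ### Properties of `∂^-` -/

theorem omegaInf_hlQ (k n : ℕ) : omegaInf k (hlQ k n) = hlQ k n := by
  refine PInf.ext_of_le k fun m hm => ?_
  rw [proj_omegaInf hm, proj_hlQ]
  change (aeval (omegaVar k) : Poly →ₐ[QTQ] Poly).toRingHom _ = _
  rw [← PowerSeries.coeff_map, hlQSeries, map_prod]
  congr 1
  refine Finset.prod_congr rfl fun j hj => map_hlQFactor _ ?_
  rw [aeval_X, omegaVar_of_le (Finset.mem_Ico.mp hj).1]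

theorem omegaInf_hlQ_succ (k n : ℕ) :
    omegaInf (k + 1) (hlQ k (n + 1)) - qc • (xInf 0 * omegaInf (k + 1) (hlQ k n)) =
      hlQ (k + 1) (n + 1) - tc • (qc • (xInf 0 * hlQ (k + 1) n)) := by
  have := congrArg (omegaInf (k + 1)) (hlQ_succ_sub k n)
  simpa only [map_sub, map_mul, map_smul, omegaInf_xInf_last, omegaInf_hlQ,
    smul_mul_assoc] using this

theorem calT_xInf_pow (k n : ℕ) : calT k (xInf k ^ n) =
    xInf (k + 1) ^ n + (1 - tc) • ∑ j ∈ Finset.range n, xInf k ^ (n - j) * xInf (k + 1) ^ j := by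
  induction n with
  | zero =>
    rw [pow_zero, pow_zero, Finset.sum_range_zero, smul_zero, add_zero]
    exact calT_of_mem (PSym k).one_mem le_rfl
  | succ n ih =>
    have hsum : ∑ j ∈ Finset.range (n + 1), xInf k ^ (n + 1 - j) * xInf (k + 1) ^ j =
        xInf (k + 1) * ∑ j ∈ Finset.range n, xInf k ^ (n - j) * xInf (k + 1) ^ j +
          xInf k * xInf k ^ n := by
      rw [Finset.sum_range_succ', Finset.mul_sum, pow_zero, mul_one, Nat.sub_zero, pow_succ']
      congr 1
      refine Finset.sum_congr rfl fun j _ => ?_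
      rw [Nat.add_sub_add_right]
      ring
    rw [pow_succ', calT_xInf_mul, ih, hsum]
    simp only [Algebra.smul_def]
    ring

theorem hlQ_eq_sum (k n : ℕ) : hlQ k n =
    hlQ (k + 1) n + (1 - tc) • ∑ j ∈ Finset.range n, xInf k ^ (n - j) * hlQ (k + 1) j := by
  induction n with
  | zero => simp [hlQ_zero]
  | succ n ih =>
    have h := hlQ_succ_sub k n
    have hsum : ∑ j ∈ Finset.range n, xInf k ^ (n + 1 - j) * hlQ (k + 1) j =
        xInf k * ∑ j ∈ Finset.range n, xInf k ^ (n - j) * hlQ (k + 1) j := by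
      rw [Finset.mul_sum]
      refine Finset.sum_congr rfl fun j hj => ?_
      rw [Nat.succ_sub (Finset.mem_range.mp hj).le, pow_succ']
      ring
    rw [Finset.sum_range_succ, hsum, Nat.add_sub_cancel_left, pow_one]
    simp only [Algebra.smul_def, map_sub, map_one] at *
    linear_combination h + xInf k * ih

theorem partialMinus_succ_calT {k : ℕ} {F : PInf} (hF : F ∈ PSym (k + 1)) :
    partialMinus (k + 1) (calT k F) = partialMinus k F := by
  refine PSym_monomial_induction (p := fun F => partialMinus (k + 1) (calT k F) = partialMinus k F)
    (fun c hc n => ?_) (fun F _ G _ ihF ihG => ?_) hF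
  · have hterm : ∀ j ∈ Finset.range n,
        partialMinus (k + 1) (c * (xInf k ^ (n - j) * xInf (k + 1) ^ j)) =
          c * (xInf k ^ (n - j) * hlQ (k + 1) j) := fun j _ => by
      rw [← mul_assoc, partialMinus_mul_pow, mul_assoc]
      exact mul_mem (mem_PSym_succ hc) (pow_mem (xInf_mem (by omega)) _)
    rw [calT_mul_of_swapInf (swapInf_of_mem hc le_rfl), partialMinus_mul_pow hc, calT_xInf_pow,
      mul_add, map_add, partialMinus_mul_pow (mem_PSym_succ hc), mul_smul_comm, map_smul,
      Finset.mul_sum, map_sum, Finset.sum_congr rfl hterm, hlQ_eq_sum k, mul_add, mul_smul_comm,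
      Finset.mul_sum]
  · rw [map_add, map_add, map_add, ihF, ihG]

theorem partialMinus_calTAsc {n k : ℕ} (h : n < k) {F : PInf} (hF : F ∈ PSym (k + 1)) :
    partialMinus k (calTAsc n F) = calTAsc n (partialMinus k F) := by
  induction n generalizing F with
  | zero => rfl
  | succ n ih =>
    rw [calTAsc_succ, ih (by omega) (calT_mem (by omega) hF), partialMinus_calT h hF]
    rfl

theorem PSym_monomial_induction₂ {k : ℕ} {p : PInf → Prop}
    (base : ∀ c ∈ PSym k, ∀ a b, p (c * xInf k ^ a * xInf (k + 1) ^ b))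
    (add : ∀ F G, p F → p G → p (F + G)) {F : PInf} (hF : F ∈ PSym (k + 2)) : p F := by
  refine PSym_monomial_induction (fun c hc b => ?_) (fun F _ G _ => add F G) hF
  refine PSym_monomial_induction (p := fun c => p (c * xInf (k + 1) ^ b))
    (fun c hc a => base c hc a b) (fun F _ G _ hF hG => ?_) hc
  rw [add_mul]
  exact add _ _ hF hG

theorem swapInf_monomial {k : ℕ} {c : PInf} (hc : c ∈ PSym k) (a b : ℕ) :
    swapInf k (c * xInf k ^ a * xInf (k + 1) ^ b) = c * xInf k ^ b * xInf (k + 1) ^ a := by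
  rw [map_mul, map_mul, map_pow, map_pow, swapInf_of_mem hc le_rfl, swapInf_xInf_left,
    swapInf_xInf_right, mul_right_comm]

theorem xInf_sub_dvd_sub_swapInf {k : ℕ} {F : PInf} (hF : F ∈ PSym (k + 2)) :
    (xInf k - xInf (k + 1)) ∣ F - swapInf k F := by
  refine PSym_monomial_induction₂
    (p := fun F => (xInf k - xInf (k + 1)) ∣ F - swapInf k F) (fun c hc a b => ?_)
    (fun F G hF hG => ?_) hF
  · have hmonomial : c * xInf k ^ a * xInf (k + 1) ^ b - c * xInf k ^ b * xInf (k + 1) ^ a =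
        c * xInf k ^ b * (xInf k ^ a - xInf (k + 1) ^ a) -
          c * xInf k ^ a * (xInf k ^ b - xInf (k + 1) ^ b) := by ring
    rw [swapInf_monomial hc, hmonomial]
    exact dvd_sub ((sub_dvd_pow_sub_pow _ _ a).mul_left _) ((sub_dvd_pow_sub_pow _ _ b).mul_left _)
  · rw [map_add, add_sub_add_comm]
    exact dvd_add hF hG

theorem exists_calT_sub_eq {k : ℕ} {F : PInf} (hF : F ∈ PSym (k + 2)) :
    ∃ G ∈ PSym (k + 2), swapInf k G = G ∧ calT k F - F = (xInf (k + 1) - tc • xInf k) * G := by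
  obtain ⟨G, hG⟩ := xInf_sub_dvd_sub_swapInf hF
  have hne := xInf_sub_ne_zero (show k ≠ k + 1 by omega)
  refine ⟨G, mem_PSym_iff.mpr fun i hi => ?_, ?_, ?_⟩ <;> apply mul_left_cancel₀ hne
  · have hswap := congrArg (swapInf i) hG
    rw [map_mul, map_sub, map_sub, ← swapInf_comm (show k + 1 < i by omega), swapInf_of_mem hF hi,
      swapInf_xInf_of_ne (by omega) (by omega), swapInf_xInf_of_ne (by omega) (by omega),
      hG] at hswap
    exact hswap.symm
  · have hswap := congrArg (swapInf k) hG
    rw [map_mul, map_sub, map_sub, swapInf_swapInf, swapInf_xInf_left, swapInf_xInf_right] at hswap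
    linear_combination hswap + hG
  · have hT := calT_spec k F
    simp only [Algebra.smul_def, map_sub, map_one] at *
    linear_combination hT + (xInf (k + 1) - algebraMap QTQ PInf tc * xInf k) * hG

theorem partialMinus_partialMinus_monomial {k : ℕ} {c : PInf} (hc : c ∈ PSym k) (a b : ℕ) :
    partialMinus k (partialMinus (k + 1)
      ((xInf (k + 1) - tc • xInf k) * (c * xInf k ^ a * xInf (k + 1) ^ b))) =
        c * (hlQ k a * hlQ k (b + 1) - hlQ k (a + 1) * hlQ k b) := by
  have hmem : ∀ a, c * xInf k ^ a ∈ PSym (k + 1) := fun a =>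
    mul_mem (mem_PSym_succ hc) (pow_mem (xInf_mem (by omega)) _)
  have hexpand : (xInf (k + 1) - tc • xInf k) * (c * xInf k ^ a * xInf (k + 1) ^ b) =
      c * xInf k ^ a * xInf (k + 1) ^ (b + 1) -
        tc • (c * xInf k ^ (a + 1) * xInf (k + 1) ^ b) := by
    simp only [Algebra.smul_def]
    ring
  have hcollect : c * xInf k ^ a * hlQ (k + 1) (b + 1) -
      tc • (c * xInf k ^ (a + 1) * hlQ (k + 1) b) =
        c * hlQ k (b + 1) * xInf k ^ a - c * hlQ k b * xInf k ^ (a + 1) := by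
    have hQ := hlQ_succ_sub k b
    simp only [Algebra.smul_def] at *
    linear_combination - c * xInf k ^ a * hQ
  rw [hexpand, map_sub, map_smul, partialMinus_mul_pow (hmem a),
    partialMinus_mul_pow (hmem (a + 1)), hcollect, map_sub,
    partialMinus_mul_pow (mul_mem hc (hlQ_mem _ _)),
    partialMinus_mul_pow (mul_mem hc (hlQ_mem _ _))]
  ring

theorem partialMinus_partialMinus_swapInf {k : ℕ} {G : PInf} (hG : G ∈ PSym (k + 2)) :
    partialMinus k (partialMinus (k + 1) ((xInf (k + 1) - tc • xInf k) * swapInf k G)) =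
      - partialMinus k (partialMinus (k + 1) ((xInf (k + 1) - tc • xInf k) * G)) := by
  refine PSym_monomial_induction₂ (p := fun G =>
    partialMinus k (partialMinus (k + 1) ((xInf (k + 1) - tc • xInf k) * swapInf k G)) =
      - partialMinus k (partialMinus (k + 1) ((xInf (k + 1) - tc • xInf k) * G)))
    (fun c hc a b => ?_) (fun F G hF hG => ?_) hG
  · rw [swapInf_monomial hc, partialMinus_partialMinus_monomial hc,
      partialMinus_partialMinus_monomial hc]
    ring
  · simp only [mul_add, map_add, hF, hG, neg_add]

theorem partialMinus_partialMinus_calT {k : ℕ} {F : PInf} (hF : F ∈ PSym (k + 2)) :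
    partialMinus k (partialMinus (k + 1) (calT k F)) =
      partialMinus k (partialMinus (k + 1) F) := by
  obtain ⟨G, hG, hsymm, hfactor⟩ := exists_calT_sub_eq hF
  have hneg := partialMinus_partialMinus_swapInf hG
  rw [hsymm, ← hfactor, map_sub, map_sub] at hneg
  have : CharZero QTQ := charZero_of_injective_algebraMap algebraMap_QTQ_injective
  have htwo : (2 : QTQ) • (partialMinus k (partialMinus (k + 1) (calT k F)) -
      partialMinus k (partialMinus (k + 1) F)) = 0 :=
    (two_smul QTQ _).trans (add_eq_zero_iff_eq_neg.mpr hneg)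
  exact sub_eq_zero.mp ((smul_eq_zero.mp htwo).resolve_left two_ne_zero)

/-! ### The commutators -/

/-- `[∂^*, ∂^-]` on `𝒫(k+1)^+`. -/
def commStar (k : ℕ) : PInf →ₗ[QTQ] PInf :=
  (omegaInf (k + 1)).toLinearMap ∘ₗ partialMinus k -
    partialMinus (k + 1) ∘ₗ (omegaInf (k + 2)).toLinearMap

theorem commStar_apply (k : ℕ) (F : PInf) :
    commStar k F =
      omegaInf (k + 1) (partialMinus k F) - partialMinus (k + 1) (omegaInf (k + 2) F) := rfl

theorem commStar_mem {k : ℕ} {F : PInf} (hF : F ∈ PSym (k + 1)) : commStar k F ∈ PSym (k + 1) :=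
  sub_mem (omegaInf_succ_mem (partialMinus_mem hF)) (partialMinus_mem (omegaInf_succ_mem hF))

theorem commStar_of_mem {k : ℕ} {c : PInf} (hc : c ∈ PSym k) : commStar k c = 0 := by
  rw [commStar_apply, partialMinus_of_mem hc, omegaInf_add_two_eq hc,
    partialMinus_of_mem (omegaInf_succ_mem hc), sub_self]

theorem commStar_mul {k : ℕ} {c F : PInf} (hc : c ∈ PSym k) (hF : F ∈ PSym (k + 1)) :
    commStar k (c * F) = omegaInf (k + 1) c * commStar k F := by
  rw [commStar_apply, partialMinus_mul hc hF, map_mul, map_mul, omegaInf_add_two_eq hc,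
    partialMinus_mul (omegaInf_succ_mem hc) (omegaInf_succ_mem hF), commStar_apply]
  ring

theorem commStar_calT {k i : ℕ} (h : i + 1 < k) {F : PInf} (hF : F ∈ PSym (k + 1)) :
    commStar k (calT i F) = calT (i + 1) (commStar k F) := by
  rw [commStar_apply, partialMinus_calT h hF, omegaInf_calT (by omega), omegaInf_calT (by omega),
    partialMinus_calT (by omega) (omegaInf_succ_mem hF), commStar_apply, map_sub]

theorem commStar_xInf_mul {k : ℕ} {F : PInf} (hF : F ∈ PSym (k + 1)) :
    commStar k (xInf k * F) =
      qc • (xInf 0 * (omegaInf (k + 1) (partialMinus k F) -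
        tc • partialMinus (k + 1) (omegaInf (k + 2) F))) := by
  refine PSym_monomial_induction (p := fun F => commStar k (xInf k * F) =
      qc • (xInf 0 * (omegaInf (k + 1) (partialMinus k F) -
        tc • partialMinus (k + 1) (omegaInf (k + 2) F))))
    (fun c hc n => ?_) (fun F _ G _ ihF ihG => ?_) hF
  · have homega (n : ℕ) :
        omegaInf (k + 2) (c * xInf k ^ n) = omegaInf (k + 1) c * xInf (k + 1) ^ n := by
      rw [map_mul, map_pow, omegaInf_add_two_eq hc, omegaInf_xInf_of_lt (by omega)]
    have hpow : xInf k * (c * xInf k ^ n) = c * xInf k ^ (n + 1) := by ring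
    rw [hpow, commStar_apply, homega, homega, partialMinus_mul_pow hc, partialMinus_mul_pow hc,
      partialMinus_mul_pow (omegaInf_succ_mem hc), partialMinus_mul_pow (omegaInf_succ_mem hc),
      map_mul, map_mul]
    have hQ := omegaInf_hlQ_succ k n
    simp only [Algebra.smul_def] at *
    linear_combination omegaInf (k + 1) c * hQ
  · simp only [mul_add, map_add, ihF, ihG, smul_add, mul_sub, smul_sub]
    abel

theorem partialMinus_commStar {k : ℕ} {F : PInf} (hF : F ∈ PSym (k + 2)) :
    tc • partialMinus (k + 1) (commStar (k + 1) F) =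
      commStar k (partialMinus (k + 1) (calT k F)) := by
  refine PSym_induction (p := fun F => tc • partialMinus (k + 1) (commStar (k + 1) F) =
    commStar k (partialMinus (k + 1) (calT k F))) (fun F hF => ?_) (fun F _ G _ ihF ihG => ?_)
    (fun F hF h => ?_) hF
  · rw [commStar_of_mem hF, map_zero, smul_zero, partialMinus_succ_calT hF,
      commStar_of_mem (partialMinus_mem hF)]
  · simp only [map_add, smul_add, ihF, ihG]
  · have hTF : calT k F ∈ PSym (k + 2) := calT_mem (by omega) hF
    have hDF := partialMinus_mem hF
    have hDTF := partialMinus_mem hTF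
    have hH : calT k F + (tc - 1) • F ∈ PSym (k + 2) :=
      add_mem hTF ((PSym (k + 2)).smul_mem hF _)
    have homegaD : omegaInf (k + 2) (partialMinus (k + 1) F) ∈ PSym (k + 2) := omegaInf_succ_mem hDF
    have hDomega : partialMinus (k + 2) (omegaInf (k + 3) F) ∈ PSym (k + 2) :=
      partialMinus_mem (omegaInf_succ_mem hF)
    have htComm : omegaInf (k + 2) (partialMinus (k + 1) F) -
        tc • partialMinus (k + 2) (omegaInf (k + 3) F) ∈ PSym (k + 2) :=
      sub_mem homegaD ((PSym (k + 2)).smul_mem hDomega _)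
    rw [commStar_xInf_mul hF, calT_xInf_succ_mul, partialMinus_mul (xInf_mem (by omega)) hH,
      commStar_xInf_mul (partialMinus_mem hH), map_smul,
      partialMinus_mul (xInf_mem (by omega)) htComm]
    simp only [map_add, map_sub, map_smul, partialMinus_partialMinus_calT hF]
    rw [commStar_apply, commStar_apply, map_sub, partialMinus_partialMinus_calT hF] at h
    simp only [Algebra.smul_def, map_sub, map_one] at *
    linear_combination algebraMap QTQ PInf qc * xInf 0 * algebraMap QTQ PInf tc * h

theorem calT_zero_omegaInf_omegaInf {k : ℕ} {F : PInf} (hF : F ∈ PSym k) :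
    calT 0 (omegaInf (k + 2) (omegaInf (k + 1) F)) = omegaInf (k + 2) (omegaInf (k + 1) F) := by
  rw [calT_eq_self_iff_swapInf, swapInf_omegaInf_omegaInf, swapInf_of_mem hF le_rfl]

theorem commStar_omegaInf {k : ℕ} {F : PInf} (hF : F ∈ PSym (k + 1)) :
    tc • commStar (k + 1) (omegaInf (k + 2) F) = calT 0 (omegaInf (k + 2) (commStar k F)) := by
  refine PSym_induction (p := fun F => tc • commStar (k + 1) (omegaInf (k + 2) F) =
    calT 0 (omegaInf (k + 2) (commStar k F))) (fun F hF => ?_) (fun F _ G _ ihF ihG => ?_)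
    (fun F hF h => ?_) hF
  · rw [omegaInf_add_two_eq hF, commStar_of_mem (omegaInf_succ_mem hF), commStar_of_mem hF,
      map_zero, map_zero, smul_zero]
  · simp only [map_add, smul_add, ihF, ihG]
  · rw [map_mul, omegaInf_xInf_of_lt (by omega), commStar_xInf_mul (omegaInf_succ_mem hF),
      commStar_xInf_mul hF, map_smul, map_mul, omegaInf_xInf_of_lt (by omega), map_smul,
      calT_xInf_succ_mul]
    simp only [map_sub, map_smul, calT_zero_omegaInf_omegaInf (partialMinus_mem hF)]
    rw [commStar_apply, commStar_apply, map_sub, map_sub,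
      calT_zero_omegaInf_omegaInf (partialMinus_mem hF)] at h
    simp only [Algebra.smul_def, map_sub, map_one] at *
    linear_combination algebraMap QTQ PInf qc * xInf 0 * algebraMap QTQ PInf tc * h

theorem commStar_succ_calT {k : ℕ} {F : PInf} (hF : F ∈ PSym (k + 1)) :
    commStar (k + 1) (calT k F) = commStar k F := by
  rw [commStar_apply, partialMinus_succ_calT hF, omegaInf_add_two_eq (partialMinus_mem hF),
    omegaInf_calT (by omega), omegaInf_add_two_eq hF, partialMinus_succ_calT (omegaInf_succ_mem hF),
    commStar_apply]

/-- The operator `∂_k = -T_1 ⋯ T_k x_{k+1}`. -/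
def partialPlus (k : ℕ) : PInf →ₗ[QTQ] PInf := -(calTAsc k ∘ₗ calX k)

theorem partialPlus_apply (k : ℕ) (F : PInf) : partialPlus k F = -calTAsc k (xInf k * F) := rfl

theorem partialPlus_mem {k : ℕ} {F : PInf} (hF : F ∈ PSym k) : partialPlus k F ∈ PSym (k + 1) :=
  neg_mem (calTAsc_mem (Nat.lt_succ_self k)
    (mul_mem (xInf_mem (Nat.lt_succ_self k)) (mem_PSym_succ hF)))

theorem partialPlus_calT {k i : ℕ} (h : i + 1 < k) (F : PInf) :
    partialPlus k (calT i F) = calT (i + 1) (partialPlus k F) := by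
  rw [partialPlus_apply, ← calT_xInf_mul_of_ne (by omega) (by omega), calTAsc_calT h,
    partialPlus_apply, map_neg]

theorem calT_partialPlus_partialPlus {k : ℕ} {F : PInf} (hF : F ∈ PSym k) :
    calT 0 (partialPlus (k + 1) (partialPlus k F)) = partialPlus (k + 1) (partialPlus k F) := by
  have hcomp : partialPlus (k + 1) (partialPlus k F) =
      calTAsc (k + 1) (calTAsc k (xInf (k + 1) * xInf k * F)) := by
    rw [partialPlus_apply, partialPlus_apply, mul_neg, map_neg, neg_neg,
      ← calTAsc_xInf_mul (by omega), mul_assoc]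
  have hsymm : calT k (xInf (k + 1) * xInf k * F) = xInf (k + 1) * xInf k * F := by
    rw [calT_eq_self_iff_swapInf, map_mul, map_mul, swapInf_xInf_left, swapInf_xInf_right,
      swapInf_of_mem hF le_rfl, mul_comm (xInf k)]
  rw [hcomp, calT_calTAsc_calTAsc, hsymm]

/-- `[∂, ∂^-]` on `𝒫(k+1)^+`. -/
def commPlus (k : ℕ) : PInf →ₗ[QTQ] PInf :=
  partialPlus k ∘ₗ partialMinus k - partialMinus (k + 1) ∘ₗ partialPlus (k + 1)

theorem commPlus_apply (k : ℕ) (F : PInf) : commPlus k F =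
    partialPlus k (partialMinus k F) - partialMinus (k + 1) (partialPlus (k + 1) F) := rfl

theorem commPlus_eq {k : ℕ} {F : PInf} (hF : F ∈ PSym (k + 1)) :
    commPlus k F = (tc - 1) • calTAsc k (xInf k * F) := by
  have hxF : xInf (k + 1) * F ∈ PSym (k + 2) :=
    mul_mem (xInf_mem (by omega)) (mem_PSym_succ hF)
  have hT : calT k F + (tc - 1) • F ∈ PSym (k + 2) :=
    add_mem (calT_mem (by omega) (mem_PSym_succ hF))
      ((PSym (k + 2)).smul_mem (mem_PSym_succ hF) _)
  rw [commPlus_apply, partialPlus_apply, partialPlus_apply, map_neg, calTAsc_succ,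
    partialMinus_calTAsc (by omega) (calT_mem (by omega) hxF), calT_xInf_succ_mul,
    partialMinus_mul (xInf_mem (by omega)) hT, map_add, map_smul, partialMinus_succ_calT hF,
    partialMinus_of_mem hF, mul_add, map_add, mul_smul_comm, map_smul]
  abel

theorem partialMinus_commPlus {k : ℕ} {F : PInf} (hF : F ∈ PSym (k + 2)) :
    partialMinus (k + 1) (commPlus (k + 1) (calT k F)) =
      tc • commPlus k (partialMinus (k + 1) F) := by
  have hcomm : calTAsc (k + 1) (xInf (k + 1) * calT k F) = tc • calTAsc k (xInf k * F) := by
    have hquad : (1 - tc) • calT k F + tc • F + (tc - 1) • calT k F = tc • F := by module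
    rw [calTAsc_succ, calT_xInf_succ_mul, calT_quad, hquad, mul_smul_comm, map_smul]
  rw [commPlus_eq (calT_mem (by omega) hF), commPlus_eq (partialMinus_mem hF), hcomm, map_smul,
    map_smul, partialMinus_calTAsc (by omega) (mul_mem (xInf_mem (by omega)) hF),
    partialMinus_mul (xInf_mem (by omega)) hF, smul_comm]

theorem commPlus_partialPlus {k : ℕ} {F : PInf} (hF : F ∈ PSym (k + 1)) :
    calT 0 (commPlus (k + 1) (partialPlus (k + 1) F)) =
      tc • partialPlus (k + 1) (commPlus k F) := by
  have hpush : xInf (k + 1) * calTAsc (k + 1) (xInf (k + 1) * F) =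
      calTAsc k (xInf (k + 1) * calT k (xInf (k + 1) * F)) := by
    rw [calTAsc_succ, calTAsc_xInf_mul (by omega)]
  have hcancel : calT k (xInf (k + 1) * calT k (xInf (k + 1) * F)) =
      tc • (xInf (k + 1) * (xInf k * F)) := by
    have hquad : (1 - tc) • calT k (xInf (k + 1) * F) + tc • (xInf (k + 1) * F) +
        (tc - 1) • calT k (xInf (k + 1) * F) = tc • (xInf (k + 1) * F) := by module
    rw [calT_xInf_succ_mul, calT_quad, hquad, mul_smul_comm, mul_left_comm]
  rw [commPlus_eq (partialPlus_mem hF), commPlus_eq hF, partialPlus_apply, partialPlus_apply,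
    mul_neg, hpush, map_neg, smul_neg, map_neg, map_smul, calT_calTAsc_calTAsc, hcancel, map_smul,
    map_smul, calTAsc_xInf_mul (by omega), mul_smul_comm, map_smul, smul_neg, smul_comm]

/-! ### The operators `z_i` -/

/-- The operator by which `z_{i+1}` acts on `𝒫(k+1)^+`. -/
def zOp (k : ℕ) : ℕ → (PInf →ₗ[QTQ] PInf)
  | 0 => (tc ^ (k + 1) / (1 - tc)) • (commStar k ∘ₗ calTInvDesc k)
  | i + 1 => tc⁻¹ • (calT i ∘ₗ zOp k i ∘ₗ calT i)

theorem zOp_zero (k : ℕ) (F : PInf) :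
    zOp k 0 F = (tc ^ (k + 1) / (1 - tc)) • commStar k (calTInvDesc k F) := rfl

theorem zOp_succ (k i : ℕ) (F : PInf) :
    zOp k (i + 1) F = tc⁻¹ • calT i (zOp k i (calT i F)) := rfl

theorem zOp_mem {k i : ℕ} (hi : i ≤ k) {F : PInf} (hF : F ∈ PSym (k + 1)) :
    zOp k i F ∈ PSym (k + 1) := by
  induction i generalizing F with
  | zero =>
    rw [zOp_zero]
    exact (PSym (k + 1)).smul_mem (commStar_mem (calTInvDesc_mem (by omega) hF)) _
  | succ i ih =>
    rw [zOp_succ]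
    exact (PSym (k + 1)).smul_mem (calT_mem (by omega) (ih (by omega) (calT_mem (by omega) hF))) _

theorem calT_commStar_calTAsc {k n : ℕ} (h : n < k) {F : PInf} (hF : F ∈ PSym (k + 1)) :
    calT 0 (commStar k (calTAsc n F)) = calTAsc (n + 1) (commStar k F) := by
  induction n generalizing F with
  | zero => rfl
  | succ n ih =>
    rw [calTAsc_succ, ih (by omega) (calT_mem (by omega) hF), commStar_calT h hF]
    rfl

theorem partialPlus_zOp {k i : ℕ} (hi : i ≤ k) {F : PInf} (hF : F ∈ PSym (k + 1)) :
    partialPlus (k + 1) (zOp k i F) = zOp (k + 1) (i + 1) (partialPlus (k + 1) F) := by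
  induction i generalizing F with
  | zero =>
    obtain ⟨G, rfl, hG⟩ : ∃ G, F = calTAsc k G ∧ G ∈ PSym (k + 1) :=
      ⟨_, (calTAsc_calTInvDesc k F).symm, calTInvDesc_mem (by omega) hF⟩
    have hT : calT k G + (tc - 1) • G ∈ PSym (k + 2) :=
      add_mem (calT_mem (by omega) (mem_PSym_succ hG))
        ((PSym (k + 2)).smul_mem (mem_PSym_succ hG) _)
    have hx : xInf k * (calT k G + (tc - 1) • G) ∈ PSym (k + 2) :=
      mul_mem (xInf_mem (by omega)) hT
    have hcomm : commStar (k + 1) (xInf k * (calT k G + (tc - 1) • G)) =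
        xInf (k + 1) * commStar k G := by
      rw [commStar_mul (xInf_mem (by omega)) hT, omegaInf_xInf_of_lt (by omega), map_add, map_smul,
        commStar_of_mem hG, smul_zero, add_zero, commStar_succ_calT hG]
    rw [zOp_succ, zOp_zero, zOp_zero, calTInvDesc_calTAsc, partialPlus_apply (k + 1) (calTAsc k G),
      ← calTAsc_xInf_mul (by omega), map_neg, calT_calTAsc_calTAsc, map_neg, calTInvDesc_calTAsc,
      calT_xInf_succ_mul, map_neg, smul_neg, map_neg, map_smul (calT 0),
      calT_commStar_calTAsc (by omega) hx, hcomm, map_smul, partialPlus_apply, smul_neg, smul_neg,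
      smul_smul]
    congr 2
    rw [pow_succ tc (k + 1)]
    field_simp [tc_ne_zero]
  | succ i ih =>
    rw [zOp_succ, map_smul, partialPlus_calT (by omega), ih (by omega) (calT_mem (by omega) hF),
      partialPlus_calT (by omega), zOp_succ (k + 1) (i + 1)]

theorem zOp_partialPlus {k : ℕ} {F : PInf} (hF : F ∈ PSym k) :
    zOp k 0 (partialPlus k F) = -(qc * tc ^ (k + 1)) • (xInf 0 * omegaInf (k + 1) F) := by
  rw [zOp_zero, partialPlus_apply, map_neg, calTInvDesc_calTAsc, map_neg,
    commStar_xInf_mul (mem_PSym_succ hF), partialMinus_of_mem hF, omegaInf_add_two_eq hF,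
    partialMinus_of_mem (omegaInf_succ_mem hF)]
  have hfactor : omegaInf (k + 1) F - tc • omegaInf (k + 1) F =
      (1 - tc) • omegaInf (k + 1) F := by module
  rw [hfactor, mul_smul_comm, smul_neg, smul_smul, smul_smul, neg_smul]
  congr 2
  field_simp [one_sub_tc_ne_zero]

/-! ### The limit of the Cherednik operators -/

/-- The operator `∂^* ∂^- - t ∂^- ∂^*` on `𝒫(k+1)^+`. -/
def tCommStar (k : ℕ) : PInf →ₗ[QTQ] PInf :=
  (omegaInf (k + 1)).toLinearMap ∘ₗ partialMinus k -
    tc • (partialMinus (k + 1) ∘ₗ (omegaInf (k + 2)).toLinearMap)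

theorem tCommStar_apply (k : ℕ) (F : PInf) :
    tCommStar k F =
      omegaInf (k + 1) (partialMinus k F) - tc • partialMinus (k + 1) (omegaInf (k + 2) F) := rfl

theorem tCommStar_succ_calT {k : ℕ} {F : PInf} (hF : F ∈ PSym (k + 1)) :
    tCommStar (k + 1) (calT k F) = tCommStar k F := by
  rw [tCommStar_apply, partialMinus_succ_calT hF, omegaInf_add_two_eq (partialMinus_mem hF),
    omegaInf_calT (by omega), omegaInf_add_two_eq hF, partialMinus_succ_calT (omegaInf_succ_mem hF),
    tCommStar_apply]

theorem proj_tCommStar {n : ℕ} {H : PInf} (hH : H ∈ PSym (n + 1)) :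
    proj (tCommStar n H) (n + 1) = (1 - tc) • proj (omegaInf (n + 1) H) (n + 1) := by
  refine PSym_monomial_induction (p := fun H => proj (tCommStar n H) (n + 1) =
    (1 - tc) • proj (omegaInf (n + 1) H) (n + 1)) (fun c hc a => ?_) (fun F _ G _ ihF ihG => ?_) hH
  · have hQ : proj (omegaInf (n + 1) (hlQ n a)) (n + 1) - tc • proj (hlQ (n + 1) a) (n + 1) =
        (1 - tc) • proj ((qc • xInf 0) ^ a) (n + 1) := by
      rcases eq_or_ne a 0 with rfl | ha
      · rw [hlQ_zero, hlQ_zero, map_one, pow_zero, proj_one]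
        module
      · rw [proj_omegaInf le_rfl, proj_hlQ_succ n a ha, proj_hlQ_self (n + 1) a ha, smul_zero,
          sub_zero, map_smul, proj_pow, proj_smul, proj_xInf_of_lt (by omega)]
        congr 1
        change aeval (omegaVar (n + 1)) (X n ^ a) = _
        rw [map_pow, aeval_X, omegaVar_last]
    rw [tCommStar_apply, partialMinus_mul_pow hc, map_mul, map_mul (omegaInf (n + 2)), map_pow,
      omegaInf_add_two_eq hc, omegaInf_xInf_of_lt (by omega),
      partialMinus_mul_pow (omegaInf_succ_mem hc), map_mul, map_pow, omegaInf_xInf_last]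
    simp only [proj_sub, proj_smul, proj_mul, smul_eq_C_mul] at hQ ⊢
    linear_combination proj (omegaInf (n + 1) c) (n + 1) * hQ
  · rw [map_add, map_add, proj_add, proj_add, ihF, ihG, smul_add]

/-- `T_{k+r} ⋯ T_{k+2} T_{k+1}`. -/
def calTChain (k : ℕ) : ℕ → (PInf →ₗ[QTQ] PInf)
  | 0 => LinearMap.id
  | r + 1 => calT (k + r) ∘ₗ calTChain k r

/-- `T_{k+r}⁻¹ ⋯ T_{k+2}⁻¹ T_{k+1}⁻¹`. -/
def calTInvChain (k : ℕ) : ℕ → (PInf →ₗ[QTQ] PInf)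
  | 0 => LinearMap.id
  | r + 1 => calTInv (k + r) ∘ₗ calTInvChain k r

theorem calTChain_succ (k r : ℕ) (F : PInf) :
    calTChain k (r + 1) F = calT (k + r) (calTChain k r F) := rfl

theorem calTInvChain_succ (k r : ℕ) (F : PInf) :
    calTInvChain k (r + 1) F = calTInv (k + r) (calTInvChain k r F) := rfl

theorem calTChain_mem {k : ℕ} (r : ℕ) {F : PInf} (hF : F ∈ PSym (k + 1)) :
    calTChain k r F ∈ PSym (k + r + 1) := by
  induction r with
  | zero => exact hF
  | succ r ih =>
    rw [calTChain_succ]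
    exact calT_mem (by omega) (mem_PSym_succ ih)

theorem tCommStar_calTChain {k : ℕ} (r : ℕ) {F : PInf} (hF : F ∈ PSym (k + 1)) :
    tCommStar (k + r) (calTChain k r F) = tCommStar k F := by
  induction r with
  | zero => rfl
  | succ r ih =>
    rw [calTChain_succ, ← ih]
    exact tCommStar_succ_calT (calTChain_mem r hF)

theorem calTInvChain_of_mem {k : ℕ} (r : ℕ) {c : PInf} (hc : c ∈ PSym k) :
    calTInvChain k r c = c := by
  induction r with
  | zero => rfl
  | succ r ih =>
    rw [calTInvChain_succ, ih, calTInv_apply, calT_of_mem hc (by omega),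
      inv_smul_eq_iff₀ tc_ne_zero]
    module

theorem calTInvChain_xInf_mul (k r : ℕ) (F : PInf) :
    tc ^ r • calTInvChain k r (xInf k * F) = xInf (k + r) * calTChain k r F := by
  induction r with
  | zero => simp [calTInvChain, calTChain]
  | succ r ih =>
    rw [calTInvChain_succ, pow_succ', mul_smul, ← map_smul (calTInv (k + r)), ih, tc_smul_calTInv,
      calT_xInf_mul, calTChain_succ, add_assoc]
    have hcancel : (1 - tc) • (xInf (k + r) * calTChain k r F) +
      (tc - 1) • (xInf (k + r) * calTChain k r F) = 0 := by module
    rw [hcancel, add_zero]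
    rfl

theorem calTInvDesc_add (k r : ℕ) (F : PInf) :
    calTInvDesc (k + r) F = calTInvChain k r (calTInvDesc k F) := by
  induction r with
  | zero => rfl
  | succ r ih =>
    rw [calTInvChain_succ, ← ih]
    rfl

theorem polyTInvDesc_proj {n m : ℕ} (h : n < m) (F : PInf) :
    polyTInvDesc n (proj F m) = proj (calTInvDesc n F) m := by
  induction n with
  | zero => rfl
  | succ n ih =>
    rw [polyTInvDesc, LinearMap.comp_apply, ih (by omega), calTInvDesc_succ, calTInv_apply,
      proj_smul, proj_add, proj_calT h]
    rfl

theorem swapInf_substZero {i k : ℕ} (h : k < i) (F : PInf) :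
    swapInf i (substZero k F) = substZero k (swapInf i F) := by
  refine subst_subst_comm _ _ _ _ (fun j => ?_) F
  simp only [aeval_X, Function.update_apply, Equiv.swap_apply_def]
  split_ifs <;> simp <;> grind

theorem substZero_mem {i k : ℕ} (h : i < k) {F : PInf} (hF : F ∈ PSym k) :
    substZero i F ∈ PSym k :=
  mem_PSym_iff.mpr fun j hj => by rw [swapInf_substZero (by omega), swapInf_of_mem hF hj]

theorem prFirst_proj (F : PInf) (m : ℕ) : prFirst (proj F m) = proj (F - substZero 0 F) m := by
  have hupdate : (fun j => if j = 0 then 0 else X j : ℕ → Poly) = Function.update X 0 0 :=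
    funext fun j => (Function.update_apply X 0 0 j).symm
  rw [proj_sub, proj_substZero, prFirst, hupdate]
  rfl

theorem substZero_xInf (k : ℕ) : substZero k (xInf k) = 0 := by
  rw [substZero, subst_xInf, Function.update_self]
  exact map_zero ofPolyHom

theorem omegaInf_calTInvChain {k : ℕ} (r : ℕ) {c G : PInf} (hc : c ∈ PSym k) :
    tc ^ r • omegaInf (k + r + 1) (calTInvChain k r (c + xInf k * G)) =
      tc ^ r • omegaInf (k + 1) c +
        qc • (xInf 0 * omegaInf (k + r + 1) (calTChain k r G)) := by
  rw [map_add, map_add, smul_add, calTInvChain_of_mem r hc, omegaInf_eq_of_le (by omega) hc,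
    ← map_smul (omegaInf (k + r + 1)) (tc ^ r) (calTInvChain k r (xInf k * G)),
    calTInvChain_xInf_mul, map_mul, omegaInf_xInf_last, smul_mul_assoc]

theorem polyY_zero_proj_eq_prFirst (k r : ℕ) (F : PInf) :
    polyY (k + r + 1) 0 (proj F (k + r + 1)) = tc ^ (k + 1) • tc ^ r •
      prFirst (proj (omegaInf (k + r + 1) (calTInvChain k r (calTInvDesc k F))) (k + r + 1)) := by
  rw [polyY, LinearMap.smul_apply, LinearMap.comp_apply, Nat.add_sub_cancel,
    polyTInvDesc_proj (by omega), varpi, LinearMap.comp_apply, proj_omegaInf le_rfl,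
    calTInvDesc_add, smul_smul, ← pow_add, add_right_comm k 1 r]

theorem polyY_zero_proj {k : ℕ} {F : PInf} (hF : F ∈ PSym (k + 1)) :
    ∃ g ∈ PSym (k + 1), ∀ m, k + 1 ≤ m →
      polyY m 0 (proj F m) = proj (zOp k 0 F) m + tc ^ m • proj g m := by
  have hTF : calTInvDesc k F ∈ PSym (k + 1) := calTInvDesc_mem (by omega) hF
  obtain ⟨G, hG, hdecomp⟩ := exists_eq_contract_add_xInf_mul hTF
  have hc := contract_mem hTF
  generalize contract k (calTInvDesc k F) = c at hc hdecomp
  have homega : omegaInf (k + 1) c ∈ PSym (k + 1) := omegaInf_succ_mem hc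
  refine ⟨omegaInf (k + 1) c - substZero 0 (omegaInf (k + 1) c),
    sub_mem homega (substZero_mem (by omega) homega), fun m hm => ?_⟩
  obtain ⟨r, rfl⟩ : ∃ r, m = k + r + 1 := ⟨m - k - 1, by omega⟩
  have hz : zOp k 0 F = (tc ^ (k + 1) / (1 - tc)) • qc • (xInf 0 * tCommStar k G) := by
    rw [zOp_zero, hdecomp, map_add, commStar_of_mem hc, zero_add, commStar_xInf_mul hG,
      tCommStar_apply]
  have hchain : proj (omegaInf (k + r + 1) (calTChain k r G)) (k + r + 1) =
      (1 - tc)⁻¹ • proj (tCommStar k G) (k + r + 1) := by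
    rw [← tCommStar_calTChain r hG, proj_tCommStar (calTChain_mem r hG),
      inv_smul_smul₀ one_sub_tc_ne_zero]
  rw [polyY_zero_proj_eq_prFirst, hdecomp, ← map_smul prFirst, ← proj_smul,
    omegaInf_calTInvChain r hc, prFirst_proj, hz]
  simp only [map_add, map_smul, map_mul, substZero_xInf, zero_mul, smul_zero, add_zero, proj_sub,
    proj_add, proj_smul, proj_mul, hchain, smul_eq_C_mul, mul_comm]
  have hpow : tc ^ (k + r + 1) = tc ^ (k + 1) * tc ^ r := by rw [← pow_add, add_right_comm]
  rw [hpow, div_eq_mul_inv, C_mul, C_mul]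
  ring

theorem polyY_proj {k i : ℕ} (hi : i ≤ k) {F : PInf} (hF : F ∈ PSym (k + 1)) :
    ∃ g ∈ PSym (k + 1), ∀ m, k + 1 ≤ m →
      polyY m i (proj F m) = proj (zOp k i F) m + tc ^ m • proj g m := by
  induction i generalizing F with
  | zero => exact polyY_zero_proj hF
  | succ i ih =>
    obtain ⟨g, hg, h⟩ := ih (by omega) (calT_mem (show i + 1 < k + 1 by omega) hF)
    refine ⟨tc⁻¹ • calT i g, (PSym (k + 1)).smul_mem (calT_mem (by omega) hg) _, fun m hm => ?_⟩
    rw [polyY, LinearMap.smul_apply, LinearMap.comp_apply, LinearMap.comp_apply,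
      ← proj_calT (by omega), h m hm, map_add, map_smul, ← proj_calT (by omega),
      ← proj_calT (by omega), zOp_succ, proj_smul, proj_smul, smul_add, smul_comm]

theorem hasStableLimit_polyY {k i : ℕ} (hi : i ≤ k) {F : PInf} (hF : F ∈ PSym (k + 1)) :
    HasStableLimit (fun m => polyY m i (proj F m)) (zOp k i F) := by
  obtain ⟨g, hg, h⟩ := polyY_proj hi hF
  refine ⟨1, zOp k i F, fun _ => g, fun _ m => tc ^ m, fun _ => 0, fun _ => ⟨_, hg⟩,
    fun _ => coeffTendsto_tc_pow, ?_, by simp⟩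
  filter_upwards [eventually_ge_atTop (k + 1)] with m hm
  rw [h m hm, Fin.sum_univ_one]

theorem calY_of_mem {k i : ℕ} (hi : i ≤ k) {F : PInf} (hF : F ∈ PSym (k + 1)) :
    calY i F = zOp k i F :=
  calY_eq (hasStableLimit_polyY hi hF)

theorem hasStableLimit_calY (i : ℕ) {F : PInf} (hF : F ∈ PAs) :
    HasStableLimit (fun m => polyY m i (proj F m)) (calY i F) ∧ calY i F ∈ PAs := by
  obtain ⟨k, hk⟩ := hF
  have hFmax : F ∈ PSym (max k i + 1) := PSym_mono (by omega) hk
  rw [calY_of_mem (le_max_right k i) hFmax]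
  exact ⟨hasStableLimit_polyY (le_max_right k i) hFmax, _, zOp_mem (le_max_right k i) hFmax⟩

/-! ### A partial fraction identity -/

section PartialFractions

theorem natDegree_one_sub_C_mul_X_le {R : Type*} [CommRing R] (a : R) :
    (1 - Polynomial.C a * Polynomial.X).natDegree ≤ 1 :=
  Polynomial.natDegree_sub_le_of_le (Polynomial.natDegree_one.trans_le zero_le_one)
    ((Polynomial.natDegree_C_mul_le _ _).trans Polynomial.natDegree_X_le)

theorem natDegree_prod_one_sub_C_mul_X_le {R : Type*} [CommRing R] {ι : Type*} (s : Finset ι)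
    (a : ι → R) : (∏ i ∈ s, (1 - Polynomial.C (a i) * Polynomial.X)).natDegree ≤ s.card := by
  refine (Polynomial.natDegree_prod_le _ _).trans ?_
  simpa using Finset.sum_le_sum fun i (_ : i ∈ s) => natDegree_one_sub_C_mul_X_le (a i)

theorem coeff_card_prod_one_sub_C_mul_X {R : Type*} [CommRing R] {ι : Type*} (s : Finset ι)
    (a : ι → R) :
    (∏ i ∈ s, (1 - Polynomial.C (a i) * Polynomial.X)).coeff s.card = ∏ i ∈ s, (-a i) := by
  have hcoeff := Polynomial.coeff_prod_of_natDegree_le s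
    (fun i => 1 - Polynomial.C (a i) * Polynomial.X) 1 fun i _ => natDegree_one_sub_C_mul_X_le (a i)
  rw [mul_one] at hcoeff
  rw [hcoeff]
  exact Finset.prod_congr rfl fun i _ => by simp [Polynomial.coeff_one]

variable {L : Type*} [Field L] {ι : Type*}

theorem eval_inv_prod_one_sub_C_mul_X {s : Finset ι} {x : ι → L} {j : ι} (hj : j ∈ s)
    (h0 : x j ≠ 0) :
    (∏ i ∈ s, (1 - Polynomial.C (x i) * Polynomial.X)).eval (x j)⁻¹ = 0 := by
  rw [Polynomial.eval_prod]
  exact Finset.prod_eq_zero hj (by simp [h0])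

variable [DecidableEq ι]

/-- The residue coefficient `∏_{i ∈ s, i ≠ j} (t x_i - x_j) / (x_i - x_j)` at the pole `z = x_j⁻¹`
of `∏_{i ∈ s} (1 - t x_i z) / (1 - x_i z)`, up to the factor `1 - t`. -/
def partialFracCoeff (t : L) (x : ι → L) (s : Finset ι) (j : ι) : L :=
  ∏ i ∈ s.erase j, (t * x i - x j) / (x i - x j)

theorem partialFracCoeff_mul_eval {x : ι → L} (hx : Function.Injective x) (t : L) {j : ι}
    (h0 : x j ≠ 0) (s : Finset ι) :
    partialFracCoeff t x s j *
        (∏ i ∈ s.erase j, (1 - Polynomial.C (x i) * Polynomial.X)).eval (x j)⁻¹ =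
      (∏ i ∈ s.erase j, (1 - Polynomial.C (t * x i) * Polynomial.X)).eval (x j)⁻¹ := by
  rw [partialFracCoeff, Polynomial.eval_prod, Polynomial.eval_prod, ← Finset.prod_mul_distrib]
  refine Finset.prod_congr rfl fun i hi => ?_
  have hij : x i - x j ≠ 0 := sub_ne_zero.mpr (hx.ne (Finset.ne_of_mem_erase hi))
  simp only [Polynomial.eval_sub, Polynomial.eval_one, Polynomial.eval_mul, Polynomial.eval_C,
    Polynomial.eval_X]
  field_simp
  ring

/-- Both sides have degree at most `#s`, the same coefficient in degree `#s`, and the same values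
at the `#s` points `(x j)⁻¹`. -/
theorem prod_one_sub_eq_sum (t : L) {x : ι → L} (hx : Function.Injective x) (h0 : ∀ i, x i ≠ 0)
    (s : Finset ι) :
    ∏ i ∈ s, (1 - Polynomial.C (t * x i) * Polynomial.X) =
      Polynomial.C (t ^ s.card) * ∏ i ∈ s, (1 - Polynomial.C (x i) * Polynomial.X) +
      ∑ j ∈ s, Polynomial.C ((1 - t) * partialFracCoeff t x s j) *
        ∏ i ∈ s.erase j, (1 - Polynomial.C (x i) * Polynomial.X) := by
  refine Polynomial.eq_of_degree_sub_lt_of_eval_index_eq (v := fun i => (x i)⁻¹) s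
    (inv_injective.comp hx).injOn ((Polynomial.degree_lt_iff_coeff_zero _ _).mpr fun m hm => ?_)
    fun j hj => ?_
  · have hsum : ∀ j ∈ s, (Polynomial.C ((1 - t) * partialFracCoeff t x s j) *
        ∏ i ∈ s.erase j, (1 - Polynomial.C (x i) * Polynomial.X)).coeff m = 0 := fun j hj => by
      rw [Polynomial.coeff_C_mul, Polynomial.coeff_eq_zero_of_natDegree_lt, mul_zero]
      exact (natDegree_prod_one_sub_C_mul_X_le _ _).trans_lt
        ((Finset.card_erase_lt_of_mem hj).trans_le hm)
    rw [Polynomial.coeff_sub, Polynomial.coeff_add, Polynomial.finsetSum_coeff,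
      Finset.sum_eq_zero hsum, add_zero, Polynomial.coeff_C_mul]
    rcases hm.eq_or_lt with rfl | hlt
    · rw [coeff_card_prod_one_sub_C_mul_X, coeff_card_prod_one_sub_C_mul_X, ← Finset.prod_const,
        ← Finset.prod_mul_distrib, sub_eq_zero]
      exact Finset.prod_congr rfl fun i _ => by ring
    · have hcoeff (a : ι → L) : (∏ i ∈ s, (1 - Polynomial.C (a i) * Polynomial.X)).coeff m = 0 :=
        Polynomial.coeff_eq_zero_of_natDegree_lt
          ((natDegree_prod_one_sub_C_mul_X_le s a).trans_lt hlt)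
      rw [hcoeff, hcoeff, mul_zero, sub_zero]
  · have hvanish : ∀ i ∈ s, i ≠ j →
        (Polynomial.C ((1 - t) * partialFracCoeff t x s i) *
          ∏ l ∈ s.erase i, (1 - Polynomial.C (x l) * Polynomial.X)).eval (x j)⁻¹ = 0 :=
      fun i _ hij => by
        rw [Polynomial.eval_mul, eval_inv_prod_one_sub_C_mul_X
          (Finset.mem_erase.mpr ⟨hij.symm, hj⟩) (h0 j), mul_zero]
    have hfactor : (1 - Polynomial.C (t * x j) * Polynomial.X).eval (x j)⁻¹ = 1 - t := by
      simp [h0 j]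
    rw [← Finset.mul_prod_erase s (fun i => 1 - Polynomial.C (t * x i) * Polynomial.X) hj,
      Polynomial.eval_mul, hfactor, ← partialFracCoeff_mul_eval hx t (h0 j) s, Polynomial.eval_add,
      Polynomial.eval_mul, eval_inv_prod_one_sub_C_mul_X hj (h0 j), mul_zero, zero_add,
      Polynomial.eval_finsetSum, Finset.sum_eq_single_of_mem j hj hvanish, Polynomial.eval_mul,
      Polynomial.eval_C, mul_assoc]

theorem prod_mk_ite_eq_sum (t : L) {x : ι → L} (hx : Function.Injective x) (h0 : ∀ i, x i ≠ 0)
    (s : Finset ι) :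
    ∏ i ∈ s, PowerSeries.mk (fun n => if n = 0 then 1 else (1 - t) * x i ^ n) =
      PowerSeries.C (t ^ s.card) + ∑ j ∈ s, PowerSeries.C ((1 - t) * partialFracCoeff t x s j) *
        PowerSeries.mk (fun n => x j ^ n) := by
  have hne : ∏ i ∈ s, (1 - PowerSeries.C (x i) * PowerSeries.X) ≠ 0 :=
    Finset.prod_ne_zero_iff.mpr fun i _ =>
      left_ne_zero_of_mul_eq_one (one_sub_C_mul_X_mul_mk_pow (x i))
  apply mul_left_cancel₀ hne
  rw [← Finset.prod_mul_distrib,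
    Finset.prod_congr rfl fun i _ => one_sub_C_mul_X_mul_mk_ite t (x i)]
  have hpoly := congrArg (Polynomial.coeToPowerSeries.ringHom (R := L))
    (prod_one_sub_eq_sum t hx h0 s)
  simp only [map_prod, map_sub, map_mul, map_one, map_add, map_sum, map_pow,
    Polynomial.coeToPowerSeries.ringHom_apply, Polynomial.coe_C, Polynomial.coe_X] at hpoly ⊢
  rw [hpoly, mul_add, mul_comm (PowerSeries.C t ^ _), Finset.mul_sum]
  congr 1
  refine Finset.sum_congr rfl fun j hj => ?_
  rw [← Finset.mul_prod_erase s (fun i => 1 - PowerSeries.C (x i) * PowerSeries.X) hj]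
  linear_combination (-(1 - PowerSeries.C t) * PowerSeries.C (partialFracCoeff t x s j) *
    ∏ i ∈ s.erase j, (1 - PowerSeries.C (x i) * PowerSeries.X)) * one_sub_C_mul_X_mul_mk_pow (x j)

theorem coeff_prod_mk_ite (t : L) {x : ι → L} (hx : Function.Injective x) (h0 : ∀ i, x i ≠ 0)
    (s : Finset ι) (n : ℕ) :
    PowerSeries.coeff n
        (∏ i ∈ s, PowerSeries.mk fun n => if n = 0 then 1 else (1 - t) * x i ^ n) =
      (if n = 0 then t ^ s.card else 0) +
      (1 - t) * ∑ j ∈ s, x j ^ n * partialFracCoeff t x s j := by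
  rw [prod_mk_ite_eq_sum t hx h0, map_add, PowerSeries.coeff_C, map_sum, Finset.mul_sum]
  congr 1
  refine Finset.sum_congr rfl fun j _ => ?_
  rw [PowerSeries.coeff_C_mul, PowerSeries.coeff_mk]
  ring

end PartialFractions

/-! ### Hall–Littlewood sums -/

section HallLittlewood

variable {L : Type*} [Field L]

/-- The product `∏_{i<j} (y_i - s y_j)`. -/
def pairProd (s : L) {n : ℕ} (y : Fin n → L) : L :=
  ∏ i : Fin n, ∏ j ∈ Finset.Ioi i, (y i - s * y j)

theorem pairProd_eq (s : L) {n : ℕ} (y : Fin n → L) :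
    pairProd s y = ∏ i, ∏ j, if i < j then y i - s * y j else 1 := by
  refine Finset.prod_congr rfl fun i _ => ?_
  rw [← Finset.prod_filter]
  refine Finset.prod_congr ?_ fun _ _ => rfl
  ext j
  simp

theorem pairProd_succ (s : L) {n : ℕ} (y : Fin (n + 1) → L) :
    pairProd s y = pairProd s (fun i : Fin n => y i.castSucc) *
      ∏ i : Fin n, (y i.castSucc - s * y (Fin.last n)) := by
  rw [pairProd_eq, pairProd_eq, Fin.prod_univ_castSucc]
  have hlast : (∏ j, if Fin.last n < j then y (Fin.last n) - s * y j else 1) = 1 :=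
    Finset.prod_eq_one fun j _ => if_neg (Fin.le_last j).not_gt
  rw [hlast, mul_one, ← Finset.prod_mul_distrib]
  refine Finset.prod_congr rfl fun i _ => ?_
  rw [Fin.prod_univ_castSucc]
  simp [Fin.castSucc_lt_last]

theorem pairProd_one_ne_zero {n : ℕ} {y : Fin n → L} (hy : Function.Injective y) :
    pairProd 1 y ≠ 0 := by
  refine Finset.prod_ne_zero_iff.mpr fun i _ => Finset.prod_ne_zero_iff.mpr fun j hj => ?_
  rw [one_mul, sub_ne_zero]
  exact fun h => (Finset.mem_Ioi.mp hj).ne (hy h)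

theorem pairProd_one_comp {n : ℕ} (y : Fin n → L) (w : Equiv.Perm (Fin n)) :
    pairProd 1 (y ∘ w) = ((Equiv.Perm.sign w : ℤ) : L) * pairProd 1 y := by
  have hdet (y : Fin n → L) : pairProd 1 y =
      (∏ i : Fin n, ∏ j ∈ Finset.Ioi i, (-1)) * (Matrix.vandermonde y).det := by
    rw [Matrix.det_vandermonde, ← Finset.prod_mul_distrib]
    refine Finset.prod_congr rfl fun i _ => ?_
    rw [← Finset.prod_mul_distrib]
    exact Finset.prod_congr rfl fun j _ => by ring
  have hperm : Matrix.vandermonde (y ∘ w) = (Matrix.vandermonde y).submatrix w id := rfl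
  rw [hdet, hdet, hperm, Matrix.det_permute]
  ring

/-- The summand `y^μ ∏_{i<j} (y_i - s y_j) / (y_i - y_j)`. -/
def hlTerm (s : L) (μ : ℕ → ℕ) {n : ℕ} (y : Fin n → L) : L :=
  (∏ i : Fin n, y i ^ μ i) * pairProd s y / pairProd 1 y

theorem hlTerm_succ (s : L) {μ : ℕ → ℕ} {n : ℕ} (hμ : μ n = 0) (y : Fin (n + 1) → L) :
    hlTerm s μ y = hlTerm s μ (fun i : Fin n => y i.castSucc) *
      ∏ i : Fin n, (y i.castSucc - s * y (Fin.last n)) / (y i.castSucc - y (Fin.last n)) := by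
  rw [hlTerm, hlTerm, pairProd_succ, pairProd_succ, Fin.prod_univ_castSucc, Finset.prod_div_distrib,
    Fin.val_last, hμ, pow_zero, mul_one, div_mul_div_comm]
  simp only [one_mul, Fin.val_castSucc]
  congr 1
  ring

theorem sum_sign_eq (s : L) (μ : ℕ → ℕ) {n : ℕ} {y : Fin n → L} (hy : Function.Injective y) :
    ∑ w : Equiv.Perm (Fin n), ((Equiv.Perm.sign w : ℤ) : L) *
      ((∏ i : Fin n, y (w i) ^ μ i) * pairProd s (y ∘ w)) =
    (∑ w : Equiv.Perm (Fin n), hlTerm s μ (y ∘ w)) * pairProd 1 y := by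
  rw [Finset.sum_mul]
  refine Finset.sum_congr rfl fun w _ => ?_
  have hne := pairProd_one_ne_zero hy
  have hsq : ((Equiv.Perm.sign w : ℤ) : L) * ((Equiv.Perm.sign w : ℤ) : L) = 1 := by
    rw [← Int.cast_mul, ← Units.val_mul, Int.units_mul_self, Units.val_one, Int.cast_one]
  have hs0 : ((Equiv.Perm.sign w : ℤ) : L) ≠ 0 := left_ne_zero_of_mul_eq_one hsq
  rw [hlTerm, pairProd_one_comp, div_mul_eq_mul_div, eq_div_iff (mul_ne_zero hs0 hne)]
  simp only [Function.comp]
  linear_combination ((∏ i : Fin n, y (w i) ^ μ i) * pairProd s (y ∘ w) * pairProd 1 y) * hsq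

theorem sum_hlTerm_succ (s : L) {μ : ℕ → ℕ} {n : ℕ} (hμ : μ n = 0) (x : Fin (n + 1) → L) :
    ∑ w : Equiv.Perm (Fin (n + 1)), hlTerm s μ (x ∘ w) =
      ∑ j : Fin (n + 1), (∑ w : Equiv.Perm (Fin n),
        hlTerm s μ ((fun i : Fin n => x (Equiv.swap 0 j i.succ)) ∘ w)) *
        ∏ i : Fin n, (x (Equiv.swap 0 j i.succ) - s * x j) / (x (Equiv.swap 0 j i.succ) - x j) := by
  rw [← Equiv.sum_comp (Equiv.mulRight (finRotate (n + 1))),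
    ← Equiv.sum_comp Equiv.Perm.decomposeFin.symm, Fintype.sum_prod_type]
  refine Finset.sum_congr rfl fun j _ => ?_
  rw [Finset.sum_mul]
  refine Finset.sum_congr rfl fun w _ => ?_
  rw [hlTerm_succ s hμ]
  have hcast (i : Fin n) :
      (Equiv.mulRight (finRotate (n + 1)) (Equiv.Perm.decomposeFin.symm (j, w))) i.castSucc =
        Equiv.swap 0 j (w i).succ := by
    rw [Equiv.coe_mulRight, Equiv.Perm.mul_apply, finRotate_apply, Fin.coeSucc_eq_succ,
      Equiv.Perm.decomposeFin_symm_apply_succ]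
  have hlast : (Equiv.mulRight (finRotate (n + 1)) (Equiv.Perm.decomposeFin.symm (j, w)))
      (Fin.last n) = j := by
    rw [Equiv.coe_mulRight, Equiv.Perm.mul_apply, finRotate_last,
      Equiv.Perm.decomposeFin_symm_apply_zero]
  simp only [Function.comp, hcast, hlast]
  congr 1
  exact Equiv.prod_comp w fun i =>
    (x (Equiv.swap 0 j i.succ) - s * x j) / (x (Equiv.swap 0 j i.succ) - x j)

theorem prod_erase_eq_prod_swap {n : ℕ} (j : Fin (n + 1)) (f : Fin (n + 1) → L) :
    ∏ i ∈ Finset.univ.erase j, f i = ∏ i : Fin n, f (Equiv.swap 0 j i.succ) := by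
  have hswap : ∏ i ∈ Finset.univ.erase j, f i =
      ∏ i ∈ Finset.univ.erase 0, f (Equiv.swap 0 j i) := by
    refine Finset.prod_equiv (Equiv.swap 0 j) (fun i => ?_) fun i _ => ?_
    · simp only [Finset.mem_erase, Finset.mem_univ, and_true, Equiv.swap_apply_def]
      grind
    · rw [Equiv.swap_apply_self]
  rw [hswap, Fin.univ_succ, Finset.erase_cons, Finset.prod_map]
  rfl

end HallLittlewood

/-! ### The normalization of Hall–Littlewood functions -/

theorem sum_inv_tc_pow_ne_zero (i : ℕ) : ∑ j ∈ Finset.range (i + 1), tc⁻¹ ^ j ≠ 0 := by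
  intro hsum
  have hgeom := geom_sum_mul tc⁻¹ (i + 1)
  rw [hsum, zero_mul, eq_comm, sub_eq_zero, inv_pow, inv_eq_one] at hgeom
  exact tc_pow_ne_one (by omega) hgeom

theorem vFact_ne_zero (m : ℕ) : vFact tc⁻¹ m ≠ 0 :=
  Finset.prod_ne_zero_iff.mpr fun i _ => sum_inv_tc_pow_ne_zero i

/-- The factor `v_μ(s)` in `n` variables. -/
def hlNorm (s : QTQ) (μ : ℕ → ℕ) (n : ℕ) : QTQ :=
  ∏ a ∈ (Finset.range n).image μ, vFact s ((Finset.range n).filter (fun i => μ i = a)).card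

theorem card_filter_eq_of_ne_zero {μ : ℕ → ℕ} {ℓ : ℕ} (hμ : ∀ i, μ i = 0 ↔ ℓ ≤ i) {n : ℕ}
    (hn : ℓ ≤ n) {a : ℕ} (ha : a ≠ 0) :
    ((Finset.range n).filter (fun i => μ i = a)).card =
      ((Finset.range ℓ).filter (fun i => μ i = a)).card := by
  congr 1
  ext i
  simp only [Finset.mem_filter, Finset.mem_range, and_congr_left_iff]
  rintro rfl
  have hi := (hμ i).not.mp ha
  omega

theorem card_filter_eq_zero {μ : ℕ → ℕ} {ℓ : ℕ} (hμ : ∀ i, μ i = 0 ↔ ℓ ≤ i) (n : ℕ) :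
    ((Finset.range n).filter (fun i => μ i = 0)).card = n - ℓ := by
  have hIco : (Finset.range n).filter (fun i => μ i = 0) = Finset.Ico ℓ n := by
    ext i
    simp only [Finset.mem_filter, Finset.mem_range, Finset.mem_Ico, hμ, and_comm]
  rw [hIco, Nat.card_Ico]

theorem image_range_eq_insert {μ : ℕ → ℕ} {ℓ : ℕ} (hμ : ∀ i, μ i = 0 ↔ ℓ ≤ i) {n : ℕ}
    (hn : ℓ < n) : (Finset.range n).image μ = insert 0 ((Finset.range ℓ).image μ) := by
  ext a
  simp only [Finset.mem_image, Finset.mem_range, Finset.mem_insert]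
  constructor
  · rintro ⟨i, -, rfl⟩
    exact (le_or_gt ℓ i).imp (hμ i).mpr fun hi => ⟨i, hi, rfl⟩
  · rintro (rfl | ⟨i, hi, rfl⟩)
    exacts [⟨ℓ, hn, (hμ ℓ).mpr le_rfl⟩, ⟨i, hi.trans hn, rfl⟩]

theorem hlNorm_eq (s : QTQ) {μ : ℕ → ℕ} {ℓ : ℕ} (hμ : ∀ i, μ i = 0 ↔ ℓ ≤ i) {n : ℕ} (hn : ℓ ≤ n) :
    hlNorm s μ n = vFact s (n - ℓ) * hlNorm s μ ℓ := by
  rcases hn.eq_or_lt with rfl | hlt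
  · simp [vFact]
  have hzero : 0 ∉ (Finset.range ℓ).image μ := by
    simp only [Finset.mem_image, Finset.mem_range, not_exists, not_and, hμ, not_le, imp_self,
      implies_true]
  rw [hlNorm, image_range_eq_insert hμ hlt, Finset.prod_insert hzero, card_filter_eq_zero hμ,
    Finset.prod_congr rfl fun a ha => congrArg (vFact s)
      (card_filter_eq_of_ne_zero hμ hn (ne_of_mem_of_not_mem ha hzero))]
  rfl

theorem hlNorm_ne_zero (μ : ℕ → ℕ) (n : ℕ) : hlNorm tc⁻¹ μ n ≠ 0 :=
  Finset.prod_ne_zero_iff.mpr fun _ _ => vFact_ne_zero _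

theorem hlNorm_succ (s : QTQ) {μ : ℕ → ℕ} {ℓ : ℕ} (hμ : ∀ i, μ i = 0 ↔ ℓ ≤ i) {n : ℕ}
    (hn : ℓ ≤ n) :
    hlNorm s μ (n + 1) = (∑ j ∈ Finset.range (n - ℓ + 1), s ^ j) * hlNorm s μ n := by
  rw [hlNorm_eq s hμ hn, hlNorm_eq s hμ (show ℓ ≤ n + 1 by omega), Nat.succ_sub hn, vFact,
    Finset.prod_range_succ, vFact]
  ring

theorem tc_pow_add_sum {ℓ n : ℕ} (hn : ℓ ≤ n) :
    tc ^ (n + 1) + (1 - tc) * (tc ^ n * ∑ j ∈ Finset.range (n - ℓ + 1), tc⁻¹ ^ j) = tc ^ ℓ := by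
  obtain ⟨r, rfl⟩ := Nat.exists_eq_add_of_le hn
  rw [Nat.add_sub_cancel_left]
  have ht := tc_ne_zero
  induction r with
  | zero => simp; ring
  | succ r ih =>
    have hpow : tc ^ (ℓ + (r + 1)) * tc⁻¹ ^ (r + 1) = tc ^ ℓ := by
      rw [pow_add, inv_pow, mul_inv_cancel_right₀ (pow_ne_zero _ ht)]
    rw [Finset.sum_range_succ]
    linear_combination tc * ih (by omega) + (1 - tc) * hpow

/-! ### Shifts of the alphabet -/

theorem admissible_shift (k : ℕ) : Admissible (fun j => X (j + k)) :=
  admissible_of_eventually_X 0 (fun _ => (totalDegree_X _).le) fun j _ => ⟨j + k, by omega, rfl⟩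

/-- The alphabet shift `x_j ↦ x_{j+k}` as an algebra homomorphism. -/
def shiftHom (k : ℕ) : PInf →ₐ[QTQ] PInf := subst _ (admissible_shift k)

theorem shift_eq_shiftHom (k : ℕ) (F : PInf) : shift k F = shiftHom k F := by
  refine PInf.ext fun m => ?_
  rw [shiftHom, proj_subst (n := m - k) _ fun j hj => trunc_X_of_le (by omega),
    ← trunc_proj (shift k F) le_rfl]
  congr 1
  have haeval : (rename (fun j => j + k) : Poly →ₐ[QTQ] Poly) = aeval fun j => X (j + k) :=
    MvPolynomial.algHom_ext fun j => by rw [rename_X, aeval_X]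
  rw [← haeval]
  rfl

theorem proj_shiftHom (k m : ℕ) (F : PInf) :
    proj (shiftHom k F) m = rename (fun j => j + k) (proj F (m - k)) := by
  rw [← shift_eq_shiftHom]
  rfl

theorem shiftHom_xInf (k j : ℕ) : shiftHom k (xInf j) = xInf (j + k) := subst_xInf _ _

theorem shiftHom_shiftHom (k l : ℕ) (F : PInf) : shiftHom k (shiftHom l F) = shiftHom (l + k) F :=
  subst_subst _ _ _ (fun j => by rw [aeval_X, add_assoc]) F

theorem swapInf_shiftHom (i k : ℕ) (F : PInf) :
    swapInf (i + k) (shiftHom k F) = shiftHom k (swapInf i F) := by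
  refine subst_subst_comm _ _ _ _ (fun j => ?_) F
  simp only [aeval_X, Equiv.swap_apply_def]
  grind

theorem swapInf_shiftHom_of_lt {i k : ℕ} (h : i + 1 < k) (F : PInf) :
    swapInf i (shiftHom k F) = shiftHom k F :=
  subst_subst _ _ _ (fun j => by
    rw [aeval_X, Equiv.swap_apply_of_ne_of_ne (by omega) (by omega)]) F

theorem omegaInf_shiftHom (k : ℕ) (F : PInf) : omegaInf k (shiftHom k F) = shiftHom k F :=
  subst_subst _ _ _ (fun j => by rw [aeval_X, omegaVar_of_le (Nat.le_add_left k j)]) F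

theorem shiftHom_mem {l : ℕ} (k : ℕ) {F : PInf} (hF : F ∈ PSym l) : shiftHom k F ∈ PSym (l + k) :=
  mem_PSym_iff.mpr fun i hi => by
    obtain ⟨j, rfl⟩ : ∃ j, i = j + k := ⟨i - k, by omega⟩
    rw [swapInf_shiftHom, swapInf_of_mem hF (by omega)]

theorem shiftHom_hlQ (k n : ℕ) : shiftHom k (hlQ 0 n) = hlQ k n := by
  refine PInf.ext_of_le k fun m hm => ?_
  rw [proj_shiftHom, proj_hlQ, proj_hlQ]
  change (rename (R := QTQ) fun j : ℕ => j + k).toRingHom _ = _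
  rw [← PowerSeries.coeff_map, hlQSeries, map_prod, hlQSeries,
    Finset.prod_congr rfl fun i _ => map_hlQFactor (rename fun j => j + k) (rename_X _ i),
    Finset.prod_Ico_add' (fun i => hlQFactor i) 0 (m - k) k, zero_add, Nat.sub_add_cancel hm]

theorem partialMinus_shiftHom (k : ℕ) {F : PInf} (hF : F ∈ PSym 1) :
    partialMinus k (shiftHom k F) = shiftHom k (partialMinus 0 F) := by
  refine PSym_monomial_induction (k := 0) (p := fun F => partialMinus k (shiftHom k F) =
    shiftHom k (partialMinus 0 F))
    (fun c hc n => ?_) (fun F _ G _ hF hG => ?_) hF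
  · have hc' : shiftHom k c ∈ PSym k := by
      simpa only [zero_add] using shiftHom_mem k hc
    have hshift : shiftHom k (c * xInf 0 ^ n) = shiftHom k c * xInf k ^ n := by
      rw [map_mul, map_pow, shiftHom_xInf, zero_add]
    rw [hshift, partialMinus_mul_pow hc', partialMinus_mul_pow hc, map_mul, shiftHom_hlQ]
  · rw [map_add, map_add, map_add, map_add, hF, hG]

theorem shiftHom_one_mem {F : PInf} (hF : F ∈ PSym 0) : shiftHom 1 F ∈ PSym 1 := shiftHom_mem 1 hF

/-! ### The operators `ℬ_n` -/

/-- The operator `ℬ_0`: the composite of the shift of the alphabet with `∂^-_1`. -/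
def opB0 : Module.End QTQ SymFn where
  toFun F := ⟨partialMinus 0 (shiftHom 1 F.1), partialMinus_mem (shiftHom_one_mem F.2)⟩
  map_add' F G := Subtype.ext (by
    change partialMinus 0 (shiftHom 1 (F.1 + G.1)) = _
    rw [map_add, map_add]
    rfl)
  map_smul' c F := Subtype.ext (by
    change partialMinus 0 (shiftHom 1 (c • F.1)) = _
    rw [map_smul, map_smul]
    rfl)

theorem shiftHom_e1 : shiftHom 1 e1.1 = e1.1 - xInf 0 := by
  refine PInf.ext_of_le 1 fun m hm => ?_
  obtain ⟨n, rfl⟩ := Nat.exists_eq_add_of_le' hm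
  rw [proj_shiftHom, proj_sub, proj_xInf_of_lt hm]
  change rename _ (∑ i ∈ Finset.range n, X i) = ∑ i ∈ Finset.range (n + 1), X i - X 0
  rw [map_sum, Finset.sum_range_succ', add_sub_cancel_right]
  exact Finset.sum_congr rfl fun i _ => rename_X _ _

theorem hlOp_apply (n : ℕ) (F : SymFn) :
    (hlOp opB0 n F).1 = partialMinus 0 (xInf 0 ^ n * shiftHom 1 F.1) := by
  induction n generalizing F with
  | zero => rw [pow_zero, one_mul]; rfl
  | succ n ih =>
    have hx : xInf 0 ^ n * shiftHom 1 F.1 ∈ PSym 1 :=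
      (PSym 1).mul_mem ((PSym 1).pow_mem (xInf_mem (by omega)) n) (shiftHom_one_mem F.2)
    have hcomm : (hlOp opB0 (n + 1) F).1 =
        e1.1 * (hlOp opB0 n F).1 - (hlOp opB0 n (e1 * F)).1 := rfl
    have hshift : xInf 0 ^ n * shiftHom 1 (e1 * F).1 =
        e1.1 * (xInf 0 ^ n * shiftHom 1 F.1) - xInf 0 ^ (n + 1) * shiftHom 1 F.1 := by
      change xInf 0 ^ n * shiftHom 1 (e1.1 * F.1) = _
      rw [map_mul, shiftHom_e1]
      ring
    rw [hcomm, ih, ih, hshift, map_sub, partialMinus_mul e1.2 hx]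
    ring

theorem ofPoly_mem {k : ℕ} {p : Poly} (hp : p ∈ PolyLT k) : ofPoly p ∈ PSym k := by
  have hle : PolyLT k ≤ (PSym k).comap ofPolyHom := by
    rw [PolyLT, supported_eq_adjoin_X]
    refine Algebra.adjoin_le ?_
    rintro _ ⟨j, hj, rfl⟩
    exact xInf_mem hj
  exact hle hp

theorem partialMinus_ofPoly_mul {k : ℕ} {p : Poly} (hp : p ∈ PolyLT k) (n : ℕ) (G : SymFn) :
    partialMinus k (ofPoly p * xInf k ^ n * shift (k + 1) G.1) =
      ofPoly p * shift k (hlOp opB0 n G).1 := by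
  have hx : xInf 0 ^ n * shiftHom 1 G.1 ∈ PSym 1 :=
    (PSym 1).mul_mem ((PSym 1).pow_mem (xInf_mem (by omega)) n) (shiftHom_one_mem G.2)
  have hshift : xInf k ^ n * shiftHom (k + 1) G.1 = shiftHom k (xInf 0 ^ n * shiftHom 1 G.1) := by
    rw [map_mul, map_pow, shiftHom_xInf, zero_add, shiftHom_shiftHom, add_comm 1 k]
  have hm : shiftHom k (xInf 0 ^ n * shiftHom 1 G.1) ∈ PSym (k + 1) := by
    rw [add_comm]
    exact shiftHom_mem k hx
  rw [shift_eq_shiftHom, shift_eq_shiftHom, mul_assoc, hshift, partialMinus_mul (ofPoly_mem hp) hm,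
    partialMinus_shiftHom k hx, hlOp_apply]

theorem omegaInf_ofPoly_mul (k : ℕ) (p : Poly) (G : PInf) :
    omegaInf k (ofPoly p * shift k G) = ofPoly (omegaInv k p) * shift k G := by
  rw [shift_eq_shiftHom, map_mul, omegaInf_shiftHom, omegaInf, subst_ofPoly]
  rfl

theorem calT_ofPoly (i : ℕ) (p : Poly) : calT i (ofPoly p) = ofPoly (polyT i p) := by
  refine PInf.ext_of_le (i + 2) fun m hm => ?_
  rw [proj_calT (by omega), proj_ofPoly, proj_ofPoly, trunc_polyT (by omega)]

theorem calTAsc_ofPoly (n : ℕ) (p : Poly) : calTAsc n (ofPoly p) = ofPoly (polyTAsc n p) := by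
  induction n generalizing p with
  | zero => rfl
  | succ n ih =>
    rw [calTAsc_succ, calT_ofPoly, ih]
    rfl

theorem calTAsc_ofPoly_mul (k : ℕ) (p : Poly) (G : PInf) :
    calTAsc k (xInf k * (ofPoly p * shift (k + 1) G)) =
      ofPoly (omegaTildeInv (k + 1) p) * shift (k + 1) G := by
  have hmul : ofPoly (X k * p) = xInf k * ofPoly p := map_mul ofPolyHom _ _
  have hcomm : xInf k * (ofPoly p * shiftHom (k + 1) G) =
      shiftHom (k + 1) G * ofPoly (X k * p) := by
    rw [hmul]
    ring
  rw [shift_eq_shiftHom, hcomm, calTAsc_mul fun i hi => swapInf_shiftHom_of_lt (by omega) G,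
    calTAsc_ofPoly, mul_comm]
  rfl

/-! ### The eigenvalues of `ℬ_0` -/

theorem contract_shiftHom (F : PInf) : contract 0 (shiftHom 1 F) = F := by
  rw [contract, shiftHom, subst_subst _ _ admissible_X fun j => ?_, subst_X]
  rw [aeval_X, contractVar_of_gt (by omega), Nat.add_sub_cancel]

theorem contract_xInf (k : ℕ) : contract k (xInf k) = 0 := by
  rw [contract, subst_xInf, contractVar, if_neg (lt_irrefl k), if_pos rfl]
  exact map_zero ofPolyHom

theorem rename_swap_proj {c : PInf} (hc : c ∈ PSym 0) {j m : ℕ} (hj : j < m) :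
    rename (Equiv.swap 0 j) (proj c m) = proj c m := by
  have hadj {i : ℕ} (hi : i + 1 < m) : rename (Equiv.swap i (i + 1)) (proj c m) = proj c m := by
    change swapVar i _ = _
    rw [← proj_swapInf hi, swapInf_of_mem hc (Nat.zero_le i)]
  induction j with
  | zero => rw [Equiv.swap_self, Equiv.coe_refl, rename_id_apply]
  | succ j ih =>
    rcases Nat.eq_zero_or_pos j with rfl | h0
    · exact hadj hj
    · have hconj : (Equiv.swap 0 (j + 1) : ℕ → ℕ) =
          Equiv.swap j (j + 1) ∘ Equiv.swap 0 j ∘ Equiv.swap j (j + 1) := by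
        funext a
        simp only [Function.comp, Equiv.swap_apply_def]
        grind
      rw [hconj, ← rename_rename, ← rename_rename, hadj hj, ih (by omega), hadj hj]

/-- The embedding of the polynomials into their field of fractions. -/
abbrev toFrac : Poly →+* FractionRing Poly := algebraMap Poly (FractionRing Poly)

theorem toFrac_injective : Function.Injective toFrac :=
  IsFractionRing.injective Poly (FractionRing Poly)

/-- The variable `x_{i+1}` in the field of rational functions. -/
def xFrac (n : ℕ) (i : Fin n) : FractionRing Poly := toFrac (X (i : ℕ))

theorem xFrac_injective (n : ℕ) : Function.Injective (xFrac n) := fun _ _ h =>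
  Fin.ext (X_injective (toFrac_injective h))

theorem xFrac_ne_zero (n : ℕ) (i : Fin n) : xFrac n i ≠ 0 :=
  (map_ne_zero_iff toFrac toFrac_injective).mpr (X_ne_zero _)

theorem map_hlQFactor_toFrac (m : ℕ) (i : Fin m) :
    PowerSeries.map toFrac (hlQFactor i) =
      PowerSeries.mk fun n => if n = 0 then 1 else (1 - toFrac (C tc)) * xFrac m i ^ n := by
  ext1 r
  rw [PowerSeries.coeff_map, hlQFactor, PowerSeries.coeff_mk, PowerSeries.coeff_mk]
  split_ifs
  · exact map_one _
  · rw [smul_eq_C_mul, map_mul, map_pow, C_sub, C_1, map_sub, map_one, xFrac]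

theorem toFrac_proj_hlQ (m n : ℕ) :
    toFrac (proj (hlQ 0 n) m) = (if n = 0 then toFrac (C tc) ^ m else 0) +
      (1 - toFrac (C tc)) * ∑ j : Fin m,
        xFrac m j ^ n * partialFracCoeff (toFrac (C tc)) (xFrac m) Finset.univ j := by
  have hcoeff := coeff_prod_mk_ite (toFrac (C tc)) (xFrac_injective m) (xFrac_ne_zero m)
    Finset.univ n
  rw [Finset.card_univ, Fintype.card_fin] at hcoeff
  rw [← hcoeff, proj_hlQ, ← PowerSeries.coeff_map, hlQSeries, map_prod, Nat.Ico_zero_eq_range,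
    Finset.prod_range]
  congr 1
  exact Finset.prod_congr rfl fun i _ => map_hlQFactor_toFrac m i

theorem rename_swap_proj_mul_xInf_pow {c : PInf} (hc : c ∈ PSym 0) (n : ℕ) {j m : ℕ} (hj : j < m) :
    rename (Equiv.swap 0 j) (proj (c * xInf 0 ^ n) m) = proj c m * X j ^ n := by
  rw [proj_mul, proj_pow, proj_xInf_of_lt (by omega), map_mul, map_pow, rename_X,
    Equiv.swap_apply_left, rename_swap_proj hc hj]

theorem toFrac_proj_partialMinus (m : ℕ) {F : PInf} (hF : F ∈ PSym 1) :
    toFrac (proj (partialMinus 0 F) m) =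
      toFrac (C tc) ^ m * toFrac (proj (contract 0 F) m) +
      (1 - toFrac (C tc)) * ∑ j : Fin m, toFrac (rename (Equiv.swap 0 (j : ℕ)) (proj F m)) *
        partialFracCoeff (toFrac (C tc)) (xFrac m) Finset.univ j := by
  refine PSym_monomial_induction (k := 0) (p := fun F => toFrac (proj (partialMinus 0 F) m) =
      toFrac (C tc) ^ m * toFrac (proj (contract 0 F) m) +
      (1 - toFrac (C tc)) * ∑ j : Fin m, toFrac (rename (Equiv.swap 0 (j : ℕ)) (proj F m)) *
        partialFracCoeff (toFrac (C tc)) (xFrac m) Finset.univ j)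
    (fun c hc n => ?_) (fun F _ G _ hF hG => ?_) hF
  · have hcontract : toFrac (proj (contract 0 (c * xInf 0 ^ n)) m) =
        if n = 0 then toFrac (proj c m) else 0 := by
      rw [map_mul, map_pow, contract_xInf, contract_of_mem hc]
      split_ifs with hn
      · rw [hn, pow_zero, mul_one]
      · rw [zero_pow hn, mul_zero, proj_zero, map_zero]
    rw [partialMinus_mul_pow hc, proj_mul, map_mul, toFrac_proj_hlQ, hcontract]
    simp only [rename_swap_proj_mul_xInf_pow hc n (Fin.is_lt _), map_mul, map_pow, mul_assoc,
      ← Finset.mul_sum, xFrac]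
    split_ifs <;> ring
  · simp only [map_add, proj_add, hF, hG, add_mul, Finset.sum_add_distrib]
    ring

theorem IsHallLittlewood.sum_hlTerm {s : QTQ} {μ : ℕ → ℕ} {ℓ : ℕ} {F : SymFn}
    (hF : IsHallLittlewood s μ ℓ F) {n : ℕ} (hn : ℓ ≤ n) {L : Type*} [Field L] (φ : Poly →+* L)
    {y : Fin n → L} (hy : ∀ i : Fin n, φ (X (i : ℕ)) = y i) (hinj : Function.Injective y) :
    φ (C (hlNorm s μ n)) * φ (proj F.1 n) =
      ∑ w : Equiv.Perm (Fin n), hlTerm (φ (C s)) μ (y ∘ w) := by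
  have hdef := congrArg φ (hF n hn)
  apply mul_right_cancel₀ (pairProd_one_ne_zero hinj)
  rw [← sum_sign_eq _ _ hinj]
  rw [smul_eq_C_mul] at hdef
  simp only [map_mul, map_prod, map_sum, map_sub, map_pow, map_intCast, hy] at hdef
  rw [← mul_assoc] at hdef
  simp only [pairProd, one_mul, hlNorm, Function.comp]
  rw [← hdef]
  simp only [map_prod]

theorem val_swap_succ {m : ℕ} (j : Fin (m + 1)) (i : Fin m) :
    ((Equiv.swap 0 j i.succ : Fin (m + 1)) : ℕ) = Equiv.swap 0 (j : ℕ) ((i : ℕ) + 1) := by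
  simp only [Equiv.swap_apply_def, Fin.ext_iff]
  split_ifs <;> simp_all

theorem IsHallLittlewood.sum_hlTerm_swap {s : QTQ} {μ : ℕ → ℕ} {ℓ : ℕ} {F : SymFn}
    (hF : IsHallLittlewood s μ ℓ F) {n : ℕ} (hn : ℓ ≤ n) (j : Fin (n + 1)) :
    toFrac (C (hlNorm s μ n)) *
        toFrac (rename (Equiv.swap 0 (j : ℕ)) (proj (shiftHom 1 F.1) (n + 1))) =
      ∑ w : Equiv.Perm (Fin n),
        hlTerm (toFrac (C s)) μ ((fun i => xFrac (n + 1) (Equiv.swap 0 j i.succ)) ∘ w) := by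
  let ρ : Poly →ₐ[QTQ] Poly := rename fun i => Equiv.swap 0 (j : ℕ) (i + 1)
  have hC (c : QTQ) : toFrac (ρ (C c)) = toFrac (C c) := congrArg toFrac (rename_C _ _)
  have hsum := hF.sum_hlTerm hn (toFrac.comp ρ.toRingHom)
    (y := fun i => xFrac (n + 1) (Equiv.swap 0 j i.succ))
    (fun i => by
      rw [xFrac, val_swap_succ]
      exact congrArg toFrac (rename_X _ _))
    ((xFrac_injective _).comp ((Equiv.swap 0 j).injective.comp (Fin.succ_injective _)))
  change toFrac (ρ (C _)) * toFrac (ρ _) = ∑ w, hlTerm (toFrac (ρ (C s))) μ _ at hsum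
  rw [hC, hC] at hsum
  rw [proj_shiftHom, rename_rename]
  exact hsum

theorem partialFracCoeff_eq_pow_mul_prod {L : Type*} [Field L] {t s : L} (hts : t * s = 1) {n : ℕ}
    (x : Fin (n + 1) → L) (j : Fin (n + 1)) :
    partialFracCoeff t x Finset.univ j = t ^ n * ∏ i : Fin n,
      (x (Equiv.swap 0 j i.succ) - s * x j) / (x (Equiv.swap 0 j i.succ) - x j) := by
  have hpow : t ^ n = ∏ _i : Fin n, t := by
    rw [Finset.prod_const, Finset.card_univ, Fintype.card_fin]
  rw [partialFracCoeff, prod_erase_eq_prod_swap, hpow, ← Finset.prod_mul_distrib]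
  refine Finset.prod_congr rfl fun i _ => ?_
  rw [← mul_div_assoc]
  congr 1
  linear_combination x j * hts

theorem toFrac_C_tc_mul_inv : toFrac (C tc) * toFrac (C tc⁻¹) = 1 := by
  rw [← map_mul, ← C_mul, mul_inv_cancel₀ tc_ne_zero, C_1, map_one]

theorem IsHallLittlewood.sum_partialFracCoeff {μ : ℕ → ℕ} {ℓ : ℕ} {F : SymFn}
    (hF : IsHallLittlewood tc⁻¹ μ ℓ F) {n : ℕ} (hn : ℓ ≤ n) (hμ : μ n = 0) :
    toFrac (C (hlNorm tc⁻¹ μ n)) * ∑ j : Fin (n + 1),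
      toFrac (rename (Equiv.swap 0 (j : ℕ)) (proj (shiftHom 1 F.1) (n + 1))) *
        partialFracCoeff (toFrac (C tc)) (xFrac (n + 1)) Finset.univ j =
      toFrac (C tc) ^ n *
        (toFrac (C (hlNorm tc⁻¹ μ (n + 1))) * toFrac (proj F.1 (n + 1))) := by
  rw [hF.sum_hlTerm (Nat.le_succ_of_le hn) toFrac (y := xFrac (n + 1)) (fun _ => rfl)
    (xFrac_injective _), sum_hlTerm_succ _ hμ, Finset.mul_sum, Finset.mul_sum]
  refine Finset.sum_congr rfl fun j _ => ?_
  rw [partialFracCoeff_eq_pow_mul_prod toFrac_C_tc_mul_inv, ← hF.sum_hlTerm_swap hn]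
  ring

theorem isHLZero_opB0 : IsHLZero opB0 := by
  intro μ ℓ _ hμ F hF
  apply Subtype.ext
  change partialMinus 0 (shiftHom 1 F.1) = tc ^ ℓ • F.1
  refine PInf.ext_of_le (ℓ + 1) fun m hm => ?_
  obtain ⟨n, rfl⟩ : ∃ n, m = n + 1 := ⟨m - 1, by omega⟩
  have hn : ℓ ≤ n := by omega
  have hnorm : toFrac (C (hlNorm tc⁻¹ μ n)) ≠ 0 :=
    (map_ne_zero_iff toFrac toFrac_injective).mpr (C_ne_zero.mpr (hlNorm_ne_zero μ n))
  have hsum := hF.sum_partialFracCoeff hn ((hμ n).mpr hn)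
  have hscal := congrArg (fun c => toFrac (C c)) (tc_pow_add_sum hn)
  simp only [map_add, map_mul, map_sub, map_pow, map_one] at hscal
  apply toFrac_injective
  apply mul_left_cancel₀ hnorm
  rw [hlNorm_succ tc⁻¹ hμ hn, C_mul, map_mul] at hsum
  rw [toFrac_proj_partialMinus (n + 1) (shiftHom_one_mem F.2), contract_shiftHom, proj_smul,
    smul_eq_C_mul, map_mul, C_pow, map_pow]
  linear_combination (1 - toFrac (C tc)) * hsum +
    toFrac (C (hlNorm tc⁻¹ μ n)) * toFrac (proj F.1 (n + 1)) * hscal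

/-! ### Operators on `𝒫_•` -/

theorem PBullet.map_mul_map {k l m : ℕ} (φ : PSym l →ₗ[QTQ] PSym m) (ψ : PSym k →ₗ[QTQ] PSym l) :
    PBullet.map φ * PBullet.map ψ = PBullet.map (φ ∘ₗ ψ) := by
  refine LinearMap.ext fun v => ?_
  change PBullet.single m (φ (DirectSum.component QTQ ℕ (fun k => PSym k) l
    (DirectSum.lof QTQ ℕ (fun k => PSym k) l _))) = _
  rw [DirectSum.component.lof_self]
  rfl

theorem PBullet.map_mul_map_of_ne {k l l' m : ℕ} (h : l ≠ l') (φ : PSym l →ₗ[QTQ] PSym m)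
    (ψ : PSym k →ₗ[QTQ] PSym l') : PBullet.map φ * PBullet.map ψ = 0 := by
  refine LinearMap.ext fun v => ?_
  change PBullet.single m (φ (DirectSum.component QTQ ℕ (fun k => PSym k) l
    (DirectSum.lof QTQ ℕ (fun k => PSym k) l' _))) = 0
  rw [DirectSum.component.of, dif_neg (Ne.symm h), map_zero, map_zero]

/-- The operator `Φ` on `𝒫_•` maps `𝒫(k)^+` to `𝒫(l)^+` by the restriction of `f`,
and is zero on the other summands. -/
def MapsBy (Φ : Module.End QTQ PBullet) (k l : ℕ) (f : PInf → PInf) : Prop :=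
  ∃ φ : PSym k →ₗ[QTQ] PSym l, (∀ F : PSym k, (φ F).1 = f F.1) ∧ Φ = PBullet.map φ

namespace MapsBy

variable {Φ Ψ : Module.End QTQ PBullet} {k l m : ℕ} {f g : PInf → PInf}

theorem mul (h : MapsBy Φ l m f) (h' : MapsBy Ψ k l g) : MapsBy (Φ * Ψ) k m fun F => f (g F) := by
  obtain ⟨φ, hφ, rfl⟩ := h
  obtain ⟨ψ, hψ, rfl⟩ := h'
  exact ⟨φ ∘ₗ ψ, fun F => by rw [LinearMap.comp_apply, hφ, hψ], PBullet.map_mul_map φ ψ⟩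

theorem add (h : MapsBy Φ k l f) (h' : MapsBy Ψ k l g) : MapsBy (Φ + Ψ) k l fun F => f F + g F := by
  obtain ⟨φ, hφ, rfl⟩ := h
  obtain ⟨ψ, hψ, rfl⟩ := h'
  refine ⟨φ + ψ, fun F => ?_, ?_⟩
  · beta_reduce
    rw [← hφ, ← hψ]
    rfl
  · rw [PBullet.map, PBullet.map, PBullet.map, LinearMap.add_comp, LinearMap.comp_add]

theorem smul (c : QTQ) (h : MapsBy Φ k l f) : MapsBy (c • Φ) k l fun F => c • f F := by
  obtain ⟨φ, hφ, rfl⟩ := h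
  refine ⟨c • φ, fun F => ?_, ?_⟩
  · beta_reduce
    rw [← hφ]
    rfl
  · rw [PBullet.map, PBullet.map, LinearMap.smul_comp, LinearMap.comp_smul]

theorem sub (h : MapsBy Φ k l f) (h' : MapsBy Ψ k l g) : MapsBy (Φ - Ψ) k l fun F => f F - g F := by
  obtain ⟨φ, hφ, rfl⟩ := h
  obtain ⟨ψ, hψ, rfl⟩ := h'
  refine ⟨φ - ψ, fun F => ?_, ?_⟩
  · beta_reduce
    rw [← hφ, ← hψ]
    rfl
  · rw [PBullet.map, PBullet.map, PBullet.map, LinearMap.sub_comp, LinearMap.comp_sub]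

theorem congr (h : MapsBy Φ k l f) (hfg : ∀ F ∈ PSym k, f F = g F) : MapsBy Φ k l g := by
  obtain ⟨φ, hφ, rfl⟩ := h
  exact ⟨φ, fun F => by rw [hφ, hfg F.1 F.2], rfl⟩

theorem eq (h : MapsBy Φ k l f) (h' : MapsBy Ψ k l g) (hfg : ∀ F ∈ PSym k, f F = g F) : Φ = Ψ := by
  obtain ⟨φ, hφ, rfl⟩ := h
  obtain ⟨ψ, hψ, rfl⟩ := h'
  congr 1
  exact LinearMap.ext fun F => Subtype.ext (by rw [hφ, hψ, hfg F.1 F.2])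

theorem eq_zero (h : MapsBy Φ k l f) (hf : ∀ F ∈ PSym k, f F = 0) : Φ = 0 := by
  rw [h.eq (h.smul 0) fun F hF => by rw [hf F hF, smul_zero], zero_smul]

end MapsBy

/-! ### The representation -/

/-- The restriction of an operator on `𝒫_∞^+` to an operator from `𝒫(k)^+` to `𝒫(l)^+`. -/
def restr {k l : ℕ} (f : PInf →ₗ[QTQ] PInf) (h : ∀ F ∈ PSym k, f F ∈ PSym l) :
    PSym k →ₗ[QTQ] PSym l where
  toFun F := ⟨f F.1, h F.1 F.2⟩
  map_add' F G := Subtype.ext (map_add f F.1 G.1)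
  map_smul' c F := Subtype.ext (map_smul f c F.1)

/-- The extension of `ω̃_{k+1}⁻¹` to `𝒫(k+1)^+`. -/
def omegaTildeSym (k : ℕ) : PSym (k + 1) →ₗ[QTQ] PSym (k + 1) :=
  restr (calTAsc k ∘ₗ calX k) fun _ hF =>
    calTAsc_mem (Nat.lt_succ_self k) ((PSym (k + 1)).mul_mem (xInf_mem (Nat.lt_succ_self k)) hF)

/-- The extension of `ω_{k+1}⁻¹` to `𝒫(k+1)^+`. -/
def omegaSym (k : ℕ) : PSym (k + 1) →ₗ[QTQ] PSym (k + 1) :=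
  restr (omegaInf (k + 1)).toLinearMap fun _ hF => omegaInf_mem hF

/-- The operator `∂^-_{k+1}` from `𝒫(k+1)^+` to `𝒫(k)^+`. -/
def partialMinusSym (k : ℕ) : PSym (k + 1) →ₗ[QTQ] PSym k :=
  restr (partialMinus k) fun _ hF => partialMinus_mem hF

theorem isSymLinearExt_omegaTildeSym (k : ℕ) :
    IsSymLinearExt (k + 1) (omegaTildeInv (k + 1)) (omegaTildeSym k) := by
  intro p _ G F hF
  change calTAsc k (xInf k * F.1) = _
  rw [hF, calTAsc_ofPoly_mul]

theorem isSymLinearExt_omegaSym (k : ℕ) :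
    IsSymLinearExt (k + 1) (omegaInv (k + 1)) (omegaSym k) := by
  intro p _ G F hF
  change omegaInf (k + 1) F.1 = _
  rw [hF, omegaInf_ofPoly_mul]

theorem isPartialMinus_partialMinusSym (k : ℕ) :
    IsPartialMinus (hlOp opB0) k (partialMinusSym k) := by
  intro p hp n G F hF
  change partialMinus k F.1 = _
  rw [hF]
  exact partialMinus_ofPoly_mul hp n G

/-- The action of the arrows of the quiver on `𝒫_•`. -/
def arrowMap : {k l : ℕ} → Arrow k l → (PSym k →ₗ[QTQ] PSym l)
  | _, _, .dPlus k => -(omegaTildeSym k ∘ₗ incl k)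
  | _, _, .dStar k => omegaSym k ∘ₗ incl k
  | _, _, .dMinus k => partialMinusSym k
  | _, _, .loopT _ i h => restr (calT i) fun _ hF => calT_mem h hF

/-- The action of the generators of the path algebra on `𝒫_•`. -/
def genMap : Gen → Module.End QTQ PBullet
  | .vertex k => PBullet.map (LinearMap.id : PSym k →ₗ[QTQ] PSym k)
  | .arrow a => PBullet.map (arrowMap a)

/-- The action of the free algebra on `𝒫_•`. -/
def freeAction : FreeGen →ₐ[QTQ] Module.End QTQ PBullet := FreeAlgebra.lift QTQ genMap

theorem freeAction_ι (g : Gen) : freeAction (FreeAlgebra.ι QTQ g) = genMap g :=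
  FreeAlgebra.lift_ι_apply _ _

theorem tc_smul_calTInv_xInf_mul_calTInv (i : ℕ) (F : PInf) :
    tc • calTInv i (xInf i * calTInv i F) = xInf (i + 1) * F := by
  rw [← calTInv_calT i (xInf (i + 1) * F), calT_xInf_succ_mul, ← tc_smul_calTInv, mul_smul_comm,
    map_smul]

namespace FreeGen

theorem mapsBy_e (k : ℕ) : MapsBy (freeAction (e k)) k k fun F => F :=
  ⟨LinearMap.id, fun _ => rfl, freeAction_ι _⟩

theorem mapsBy_dP (k : ℕ) : MapsBy (freeAction (dP k)) k (k + 1) (partialPlus k) :=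
  ⟨_, fun _ => rfl, freeAction_ι _⟩

theorem mapsBy_dS (k : ℕ) : MapsBy (freeAction (dS k)) k (k + 1) (omegaInf (k + 1)) :=
  ⟨_, fun _ => rfl, freeAction_ι _⟩

theorem mapsBy_dM (k : ℕ) : MapsBy (freeAction (dM k)) (k + 1) k (partialMinus k) :=
  ⟨_, fun _ => rfl, freeAction_ι _⟩

theorem mapsBy_T {k i : ℕ} (h : i + 1 < k) : MapsBy (freeAction (T k i)) k k (calT i) := by
  rw [T, dif_pos h]
  exact ⟨_, fun _ => rfl, freeAction_ι _⟩

theorem mapsBy_TInv {k i : ℕ} (h : i + 1 < k) :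
    MapsBy (freeAction (TInv k i)) k k (calTInv i) := by
  rw [TInv, map_smul, map_add, map_smul]
  exact ((mapsBy_T h).add ((mapsBy_e k).smul _)).smul _

theorem mapsBy_mul_TDesc {k l n : ℕ} (h : n ≤ k) {Φ : Module.End QTQ PBullet} {f : PInf → PInf}
    (hΦ : MapsBy Φ (k + 1) l f) :
    MapsBy (Φ * freeAction (TDesc (k + 1) n)) (k + 1) l fun F => f (calTDesc n F) := by
  induction n generalizing Φ f with
  | zero =>
    rw [TDesc, map_one, mul_one]
    exact hΦ
  | succ n ih =>
    rw [TDesc, map_mul, ← mul_assoc]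
    exact ih (by omega) (hΦ.mul (mapsBy_T (by omega)))

theorem mapsBy_mul_TInvDesc {k l n : ℕ} (h : n ≤ k) {Φ : Module.End QTQ PBullet}
    {f : PInf → PInf} (hΦ : MapsBy Φ (k + 1) l f) :
    MapsBy (Φ * freeAction (TInvDesc (k + 1) n)) (k + 1) l fun F => f (calTInvDesc n F) := by
  induction n generalizing Φ f with
  | zero =>
    rw [TInvDesc, map_one, mul_one]
    exact hΦ
  | succ n ih =>
    rw [TInvDesc, map_mul, ← mul_assoc]
    exact ih (by omega) (hΦ.mul (mapsBy_TInv (by omega)))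

theorem mapsBy_commP (k : ℕ) : MapsBy (freeAction (commP k)) (k + 1) (k + 1) (commPlus k) := by
  rw [commP, map_sub, map_mul, map_mul]
  exact ((mapsBy_dP k).mul (mapsBy_dM k)).sub ((mapsBy_dM (k + 1)).mul (mapsBy_dP (k + 1)))

theorem mapsBy_commS (k : ℕ) : MapsBy (freeAction (commS k)) (k + 1) (k + 1) (commStar k) := by
  rw [commS, map_sub, map_mul, map_mul]
  exact ((mapsBy_dS k).mul (mapsBy_dM k)).sub ((mapsBy_dM (k + 1)).mul (mapsBy_dS (k + 1)))

theorem mapsBy_y {k i : ℕ} (h : i ≤ k) :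
    MapsBy (freeAction (y k i)) (k + 1) (k + 1) fun F => xInf i * F := by
  induction i with
  | zero =>
    rw [y, map_smul, map_mul]
    have hcommP := (mapsBy_commP k).congr fun F => commPlus_eq
    have htc : tc - 1 ≠ 0 := sub_ne_zero.mpr (sub_ne_zero.mp one_sub_tc_ne_zero).symm
    refine ((mapsBy_mul_TDesc le_rfl hcommP).smul _).congr fun F _ => ?_
    rw [calTAsc_xInf_calTDesc, smul_smul (tc - 1), mul_comm (tc - 1),
      inv_smul_smul₀ (mul_ne_zero (pow_ne_zero _ tc_ne_zero) htc)]
  | succ i ih =>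
    rw [y, map_smul, map_mul, map_mul]
    have hTInv := mapsBy_TInv (show i + 1 < k + 1 by omega)
    exact (((hTInv.mul (ih (by omega))).mul hTInv).smul tc).congr
      fun F _ => tc_smul_calTInv_xInf_mul_calTInv i F

theorem mapsBy_z {k i : ℕ} (h : i ≤ k) :
    MapsBy (freeAction (z k i)) (k + 1) (k + 1) (zOp k i) := by
  induction i with
  | zero =>
    rw [z, map_smul, map_mul]
    exact (mapsBy_mul_TInvDesc le_rfl (mapsBy_commS k)).smul _
  | succ i ih =>
    rw [z, map_smul, map_mul, map_mul]
    exact (((mapsBy_T (by omega)).mul (ih (by omega))).mul (mapsBy_T (by omega))).smul _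

theorem freeAction_e_mul_e (k : ℕ) : freeAction (e k * e k) = freeAction (e k) := by
  rw [map_mul]
  exact ((mapsBy_e k).mul (mapsBy_e k)).eq (mapsBy_e k) fun _ _ => rfl

theorem freeAction_e_mul_e_of_ne {k l : ℕ} (h : k ≠ l) :
    freeAction (e k * e l) = freeAction 0 := by
  simp only [map_mul, map_zero, e, freeAction_ι]
  exact PBullet.map_mul_map_of_ne h _ _

theorem freeAction_arrow_mul_e {k l : ℕ} (a : Arrow k l) :
    freeAction (FreeAlgebra.ι QTQ (Gen.arrow a) * e k) =
      freeAction (FreeAlgebra.ι QTQ (Gen.arrow a)) := by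
  simp only [map_mul, e, freeAction_ι]
  exact PBullet.map_mul_map _ _

theorem freeAction_e_mul_arrow {k l : ℕ} (a : Arrow k l) :
    freeAction (e l * FreeAlgebra.ι QTQ (Gen.arrow a)) =
      freeAction (FreeAlgebra.ι QTQ (Gen.arrow a)) := by
  simp only [map_mul, e, freeAction_ι]
  exact PBullet.map_mul_map _ _

theorem freeAction_T_comm {k i j : ℕ} (hij : i + 1 < j) (hj : j + 1 < k) :
    freeAction (T k i * T k j) = freeAction (T k j * T k i) := by
  rw [map_mul, map_mul]
  have hi := mapsBy_T (show i + 1 < k by omega)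
  exact (hi.mul (mapsBy_T hj)).eq ((mapsBy_T hj).mul hi) fun F _ => calT_comm (Or.inl hij) F

theorem freeAction_T_braid {k i : ℕ} (hi : i + 2 < k) :
    freeAction (T k i * T k (i + 1) * T k i) = freeAction (T k (i + 1) * T k i * T k (i + 1)) := by
  simp only [map_mul]
  have hT := mapsBy_T (show i + 1 < k by omega)
  have hT' := mapsBy_T (show i + 1 + 1 < k by omega)
  exact ((hT.mul hT').mul hT).eq ((hT'.mul hT).mul hT') fun F _ => calT_braid i F

theorem freeAction_T_quad {k i : ℕ} (hi : i + 1 < k) :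
    freeAction ((T k i - e k) * (T k i + tc • e k)) = freeAction 0 := by
  rw [map_mul, map_sub, map_add, map_smul, map_zero]
  refine (((mapsBy_T hi).sub (mapsBy_e k)).mul
    ((mapsBy_T hi).add ((mapsBy_e k).smul tc))).eq_zero fun F _ => ?_
  rw [map_add, map_smul, calT_quad]
  module

theorem freeAction_dM_dM_T (k : ℕ) :
    freeAction (dM k * dM (k + 1) * T (k + 2) k) = freeAction (dM k * dM (k + 1)) := by
  simp only [map_mul]
  have hdM := (mapsBy_dM k).mul (mapsBy_dM (k + 1))
  exact (hdM.mul (mapsBy_T (by omega))).eq hdM fun F hF => partialMinus_partialMinus_calT hF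

theorem freeAction_T_dM {k i : ℕ} (hi : i + 1 < k) :
    freeAction (T k i * dM k) = freeAction (dM k * T (k + 1) i) := by
  simp only [map_mul]
  exact ((mapsBy_T hi).mul (mapsBy_dM k)).eq ((mapsBy_dM k).mul (mapsBy_T (by omega)))
    fun F hF => (partialMinus_calT hi hF).symm

theorem freeAction_T_dP_dP (k : ℕ) :
    freeAction (T (k + 2) 0 * dP (k + 1) * dP k) = freeAction (dP (k + 1) * dP k) := by
  simp only [map_mul]
  exact (((mapsBy_T (by omega)).mul (mapsBy_dP (k + 1))).mul (mapsBy_dP k)).eq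
    ((mapsBy_dP (k + 1)).mul (mapsBy_dP k)) fun F hF => calT_partialPlus_partialPlus hF

theorem freeAction_dP_T {k i : ℕ} (hi : i + 1 < k) :
    freeAction (dP k * T k i) = freeAction (T (k + 1) (i + 1) * dP k) := by
  simp only [map_mul]
  exact ((mapsBy_dP k).mul (mapsBy_T hi)).eq ((mapsBy_T (by omega)).mul (mapsBy_dP k))
    fun F _ => partialPlus_calT hi F

theorem freeAction_dM_commP (k : ℕ) :
    freeAction (dM (k + 1) * commP (k + 1) * T (k + 2) k) =
      freeAction (tc • (commP k * dM (k + 1))) := by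
  simp only [map_mul, map_smul]
  exact (((mapsBy_dM (k + 1)).mul (mapsBy_commP (k + 1))).mul (mapsBy_T (by omega))).eq
    (((mapsBy_commP k).mul (mapsBy_dM (k + 1))).smul tc) fun F hF => partialMinus_commPlus hF

theorem freeAction_commP_dP (k : ℕ) :
    freeAction (T (k + 2) 0 * commP (k + 1) * dP (k + 1)) =
      freeAction (tc • (dP (k + 1) * commP k)) := by
  simp only [map_mul, map_smul]
  exact (((mapsBy_T (by omega)).mul (mapsBy_commP (k + 1))).mul (mapsBy_dP (k + 1))).eq
    (((mapsBy_dP (k + 1)).mul (mapsBy_commP k)).smul tc) fun F hF => commPlus_partialPlus hF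

theorem freeAction_T_dS_dS (k : ℕ) :
    freeAction (T (k + 2) 0 * dS (k + 1) * dS k) = freeAction (dS (k + 1) * dS k) := by
  simp only [map_mul]
  exact (((mapsBy_T (by omega)).mul (mapsBy_dS (k + 1))).mul (mapsBy_dS k)).eq
    ((mapsBy_dS (k + 1)).mul (mapsBy_dS k)) fun F hF => calT_zero_omegaInf_omegaInf hF

theorem freeAction_dS_T {k i : ℕ} (hi : i + 1 < k) :
    freeAction (dS k * T k i) = freeAction (T (k + 1) (i + 1) * dS k) := by
  simp only [map_mul]
  exact ((mapsBy_dS k).mul (mapsBy_T hi)).eq ((mapsBy_T (by omega)).mul (mapsBy_dS k))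
    fun F _ => omegaInf_calT (by omega) F

theorem freeAction_dM_commS (k : ℕ) :
    freeAction (tc • (dM (k + 1) * commS (k + 1))) =
      freeAction (commS k * dM (k + 1) * T (k + 2) k) := by
  simp only [map_mul, map_smul]
  exact (((mapsBy_dM (k + 1)).mul (mapsBy_commS (k + 1))).smul tc).eq
    (((mapsBy_commS k).mul (mapsBy_dM (k + 1))).mul (mapsBy_T (by omega)))
    fun F hF => partialMinus_commStar hF

theorem freeAction_commS_dS (k : ℕ) :
    freeAction (tc • (commS (k + 1) * dS (k + 1))) =
      freeAction (T (k + 2) 0 * dS (k + 1) * commS k) := by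
  simp only [map_mul, map_smul]
  exact (((mapsBy_commS (k + 1)).mul (mapsBy_dS (k + 1))).smul tc).eq
    (((mapsBy_T (by omega)).mul (mapsBy_dS (k + 1))).mul (mapsBy_commS k))
    fun F hF => commStar_omegaInf hF

theorem freeAction_dP_z {k i : ℕ} (hi : i < k) :
    freeAction (dP (k + 1) * z k i) = freeAction (z (k + 1) (i + 1) * dP (k + 1)) := by
  simp only [map_mul]
  exact ((mapsBy_dP (k + 1)).mul (mapsBy_z hi.le)).eq
    ((mapsBy_z (by omega)).mul (mapsBy_dP (k + 1))) fun F hF => partialPlus_zOp hi.le hF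

theorem freeAction_dS_y {k i : ℕ} (hi : i < k) :
    freeAction (dS (k + 1) * y k i) = freeAction (y (k + 1) (i + 1) * dS (k + 1)) := by
  simp only [map_mul]
  exact ((mapsBy_dS (k + 1)).mul (mapsBy_y hi.le)).eq
    ((mapsBy_y (by omega)).mul (mapsBy_dS (k + 1)))
    fun F _ => by rw [map_mul, omegaInf_xInf_of_lt (by omega)]

theorem freeAction_z_dP (k : ℕ) :
    freeAction (z k 0 * dP k) = freeAction (-(qc * tc ^ (k + 1)) • (y k 0 * dS k)) := by
  simp only [map_mul, map_smul]
  exact ((mapsBy_z (Nat.zero_le k)).mul (mapsBy_dP k)).eq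
    (((mapsBy_y (Nat.zero_le k)).mul (mapsBy_dS k)).smul _) fun F hF => zOp_partialPlus hF

theorem Rel.freeAction_eq {a b : FreeGen} (h : Rel a b) : freeAction a = freeAction b := by
  cases h with
  | vertex_sq k => exact freeAction_e_mul_e k
  | vertex_ne k l h => exact freeAction_e_mul_e_of_ne h
  | source a => exact freeAction_arrow_mul_e a
  | target a => exact freeAction_e_mul_arrow a
  | T_comm k i j hij hj => exact freeAction_T_comm hij hj
  | T_braid k i hi => exact freeAction_T_braid hi
  | T_quad k i hi => exact freeAction_T_quad hi
  | dM_dM_T k => exact freeAction_dM_dM_T k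
  | T_dM k i hi => exact freeAction_T_dM hi
  | T_dP_dP k => exact freeAction_T_dP_dP k
  | dP_T k i hi => exact freeAction_dP_T hi
  | dM_commP k => exact freeAction_dM_commP k
  | commP_dP k => exact freeAction_commP_dP k
  | T_dS_dS k => exact freeAction_T_dS_dS k
  | dS_T k i hi => exact freeAction_dS_T hi
  | dM_commS k => exact freeAction_dM_commS k
  | commS_dS k => exact freeAction_commS_dS k
  | dP_z k i hi => exact freeAction_dP_z hi
  | dS_y k i hi => exact freeAction_dS_y hi
  | z_dP k => exact freeAction_z_dP k

end FreeGen

/-- The action of the double Dyck path algebra on `𝒫_•`. -/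
def ddpaAction : DDPA →ₐ[QTQ] Module.End QTQ PBullet :=
  RingQuot.liftAlgHom QTQ ⟨freeAction, fun _ _ h => h.freeAction_eq⟩

theorem ddpaAction_mk (a : FreeGen) : ddpaAction (DDPA.mk a) = freeAction a :=
  RingQuot.liftAlgHom_mkAlgHom_apply _ _ _ _

theorem ddpaAction_mk_ι (g : Gen) : ddpaAction (DDPA.mk (FreeAlgebra.ι QTQ g)) = genMap g :=
  (ddpaAction_mk _).trans (freeAction_ι g)

theorem actsGloballyBy_calT {k i : ℕ} (h : i + 1 < k) :
    ActsGloballyBy (ddpaAction (DDPA.mk (FreeGen.T k i))) k (calT i) := by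
  rw [ddpaAction_mk]
  exact FreeGen.mapsBy_T h

theorem actsGloballyBy_calX {k i : ℕ} (h : i ≤ k) :
    ActsGloballyBy (ddpaAction (DDPA.mk (FreeGen.y k i))) (k + 1) (calX i) := by
  rw [ddpaAction_mk]
  exact FreeGen.mapsBy_y h

theorem actsGloballyBy_calY {k i : ℕ} (h : i ≤ k) :
    ActsGloballyBy (ddpaAction (DDPA.mk (FreeGen.z k i))) (k + 1) (calY i) := by
  rw [ddpaAction_mk]
  exact (FreeGen.mapsBy_z h).congr fun _ hF => (calY_of_mem h hF).symm

end StableDAHA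

end

open StableDAHA

theorem mainTheorem2 :
    (∀ (i : ℕ), ∀ F ∈ PAs,
      HasStableLimit (fun m => polyY m i (proj F m)) (calY i F) ∧ calY i F ∈ PAs) ∧
    ∃ (B₀ : Module.End QTQ SymFn)
      (ωt ω : (k : ℕ) → PSym (k + 1) →ₗ[QTQ] PSym (k + 1))
      (δ : (k : ℕ) → PSym (k + 1) →ₗ[QTQ] PSym k),
      IsHLZero B₀ ∧
      (∀ k, IsSymLinearExt (k + 1) (omegaTildeInv (k + 1)) (ωt k)) ∧
      (∀ k, IsSymLinearExt (k + 1) (omegaInv (k + 1)) (ω k)) ∧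
      (∀ k, IsPartialMinus (hlOp B₀) k (δ k)) ∧
      ∃ ρ : DDPA →ₐ[QTQ] Module.End QTQ PBullet,
        (∀ k, ρ (DDPA.mk (FreeGen.e k)) = PBullet.map (LinearMap.id : PSym k →ₗ[QTQ] PSym k)) ∧
        (∀ k, ρ (DDPA.mk (FreeGen.dP k)) = PBullet.map (-(ωt k ∘ₗ incl k))) ∧
        (∀ k, ρ (DDPA.mk (FreeGen.dS k)) = PBullet.map (ω k ∘ₗ incl k)) ∧
        (∀ k, ρ (DDPA.mk (FreeGen.dM k)) = PBullet.map (δ k)) ∧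
        (∀ k i, i + 1 < k → ActsGloballyBy (ρ (DDPA.mk (FreeGen.T k i))) k (calT i)) ∧
        (∀ k i, i ≤ k → ActsGloballyBy (ρ (DDPA.mk (FreeGen.y k i))) (k + 1) (calX i)) ∧
        (∀ k i, i ≤ k → ActsGloballyBy (ρ (DDPA.mk (FreeGen.z k i))) (k + 1) (calY i)) := by
  refine ⟨fun i _ hF => hasStableLimit_calY i hF, opB0, omegaTildeSym, omegaSym, partialMinusSym,
    isHLZero_opB0, isSymLinearExt_omegaTildeSym, isSymLinearExt_omegaSym,
    isPartialMinus_partialMinusSym, ddpaAction, ?_, ?_, ?_, ?_, ?_, ?_, ?_⟩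
  · exact fun k => ddpaAction_mk_ι (.vertex k)
  · exact fun k => ddpaAction_mk_ι (.arrow (.dPlus k))
  · exact fun k => ddpaAction_mk_ι (.arrow (.dStar k))
  · exact fun k => ddpaAction_mk_ι (.arrow (.dMinus k))
  · exact fun _ _ => actsGloballyBy_calT
  · exact fun _ _ => actsGloballyBy_calX
  · exact fun _ _ => actsGloballyBy_calY
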